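/- **Setting.** For an $n$-qubit state $|\psi\rangle$ and $x=(a,b)\in\mathbb F_2^{2n}$ let $W_x=\bigotimes_j i^{a_jb_j}X^{a_j}Z^{b_j}$, $p_\Psi(x)=2^{-n}|\langle\psi|W_x|\psi\rangle|^2$ and $q_\Psi(x)=\sum_y p_\Psi(y)p_\Psi(x+y)$. The Gowers proxy of $|\psi\rangle$ is $\mathbb E_{x\sim q_\Psi}[2^np_\Psi(x)]$. A stabilizer state is a state with $|\{x:\langle\psi|W_x|\psi\rangle=\pm1\}|=2^n$, and $\mathcal F_{\mathsf{Stab}}(\psi)=\max_{s\ \mathrm{stabilizer}}|\langle s|\psi\rangle|^2$. Algorithms are quantum programs, given for each value of the parameters, made of gates, mid-circuit measurements, branching and loops, in which all classical computation is counted as well. A $k$-qubit gate costs $4^k$ steps; measurements and queries cost one step each. The time also bounds the length of the program. Stabilizer states are output as Clifford circuits over $\{H,S,\mathrm{CNOT}\}$ of polynomial length in $n$ (applied to $|0^n\rangle$), numbers in binary fixed-point notation. **Theorem.** There is a universal constant $C$ such that the following holds for every $\delta\in(0,1)$, with polynomial bounds that depend only on $\delta$. Let $n\ge1$, $\varepsilon,\upsilon\in(0,1)$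 and $0<\eta\le\varepsilon$. Let $\mathcal A$ be an algorithm that is given $\mathcal S_{\mathcal A}\ge1$ copies of an $n$-qubit state, halts in time $\mathcal T_{\mathcal A}\ge\mathcal S_{\mathcal A}$ on every input state, and, whenever the Gowers proxy of the input state $|\psi\rangle$ is at least $\varepsilon^6$, outputs with probability at least $1-\delta$ a stabilizer state $|\phi\rangle$ with $|\langle\phi|\psi\rangle|^2\ge\eta$. Then there is an algorithm $\mathcal A'$ that uses $\mathcal A$ as a subroutine and does the following, for every $n$-qubit state $|\psi\rangle$ and every unitary $U_\psi$ with $U_\psi|0^n\rangle=|\psi\rangle$. Given access to $U_\psi$ and $\mathsf{con}U_\psi$, with probability at least $1-\upsilon$ it outputs some $k\le C/\eta^2$, stabilizer states $|\phi_1\rangle,\dots,|\phi_k\rangle$, coefficients $\beta_i\in\mathbb C$ with $0<|\beta_i|<1$, and a number $\tilde\alpha$, such that for some $\alpha\in[0,1]$ with $|\tilde\alpha-\alpha|\le\varepsilon$ and some state $|\phi^\perp\rangle$ $$|\psi\rangle=\sum_{i\le k}\beta_i|\phi_i\rangle+\alpha|\phi^\perp\rangle,\qquad |\alpha|^2\cdot\mathcal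 F_{\mathsf{Stab}}(\phi^\perp)<\varepsilon,$$ and in doing so it uses * at most $\mathrm{poly}(n,1/\varepsilon,1/\eta,\log(1/\upsilon))\cdot\mathcal S_{\mathcal A}$ queries to $U_\psi,\mathsf{con}U_\psi$, * at most $\mathrm{poly}(n,1/\varepsilon,1/\eta,\log(1/\upsilon))\cdot\mathcal T_{\mathcal A}$ time (the steps of $\mathcal A$ included), * at most $\frac{C}{\eta^2}\left\lceil\frac{\log(C/(\upsilon\eta^2))}{\log(1/\delta)}\right\rceil$ invocations of $\mathcal A$, which is $O(1/\eta^2)$ if $\delta\le\upsilon\eta^2/C$. In particular, if $\eta$ is at least a fixed polynomial in $\varepsilon$, the overheads are $\mathrm{poly}(n,1/\varepsilon,\log(1/\upsilon))$. Nothing is assumed to be error-free: all estimates and state preparations of $\mathcal A'$ are part of the program, and their errors and failures are covered by the success probability. -/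

import Mathlib

open scoped Matrix

noncomputable section

namespace StabDecomp

/-! ## States, Weyl operators, the Gowers proxy -/

/-- Computational basis labels of `n` qubits. -/
abbrev Bits (n : ℕ) : Type := Fin n → Bool

/-- Vectors of `n` qubits, in the computational basis. -/
abbrev Vec (n : ℕ) : Type := Bits n → ℂ

/-- `ψ` is a (pure, normalised) quantum state. -/
def IsState {n : ℕ} (ψ : Vec n) : Prop := ∑ b, ‖ψ b‖ ^ 2 = 1

/-- The inner product `⟨φ|ψ⟩`. -/
def overlap {n : ℕ} (φ ψ : Vec n) : ℂ := star φ ⬝ᵥ ψ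

/-- The all-zero basis label. -/
def zeroBits (n : ℕ) : Bits n := fun _ => false

/-- The single-qubit matrix `i^{ab} X^a Z^b`. -/
def pauli (a b : Bool) : Matrix Bool Bool ℂ := fun s t =>
  if s = xor t a then
    (if a && b then Complex.I else 1) * (if b && t then -1 else 1)
  else 0

/-- The Weyl operator `W_x`, the tensor product of the matrices `i^{a_j b_j} X^{a_j} Z^{b_j}`
for `x = (a, b)`. -/
def weyl {n : ℕ} (x : Bits n × Bits n) : Matrix (Bits n) (Bits n) ℂ := fun s t =>
  ∏ j, pauli (x.1 j) (x.2 j) (s j) (t j)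

/-- Addition in `𝔽₂^{2n}`. -/
def weylAdd {n : ℕ} (x y : Bits n × Bits n) : Bits n × Bits n :=
  (fun j => xor (x.1 j) (y.1 j), fun j => xor (x.2 j) (y.2 j))

/-- The expectation `⟨ψ|W_x|ψ⟩`. -/
def weylExp {n : ℕ} (ψ : Vec n) (x : Bits n × Bits n) : ℂ := overlap ψ (weyl x *ᵥ ψ)

/-- The characteristic distribution `p_Ψ(x) = 2^{-n} |⟨ψ|W_x|ψ⟩|²`. -/
def charDist {n : ℕ} (ψ : Vec n) (x : Bits n × Bits n) : ℝ := ‖weylExp ψ x‖ ^ 2 / 2 ^ n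

/-- The Weyl distribution `q_Ψ(x) = ∑_y p_Ψ(y) p_Ψ(x + y)`. -/
def weylDist {n : ℕ} (ψ : Vec n) (x : Bits n × Bits n) : ℝ :=
  ∑ y, charDist ψ y * charDist ψ (weylAdd x y)

/-- The proxy of the Gowers-3 norm: the expectation over `x ∼ q_Ψ` of `2^n p_Ψ(x)`. -/
def gowersProxy {n : ℕ} (ψ : Vec n) : ℝ := ∑ x, weylDist ψ x * (2 ^ n * charDist ψ x)

/-- The unsigned stabilizer group `{x : ⟨ψ|W_x|ψ⟩ ∈ {-1, 1}}`. -/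
def unsignedStab {n : ℕ} (ψ : Vec n) : Set (Bits n × Bits n) :=
  {x | weylExp ψ x = 1 ∨ weylExp ψ x = -1}

/-- Stabilizer states: states of maximal stabilizer dimension `n`. -/
def IsStabilizer {n : ℕ} (φ : Vec n) : Prop := IsState φ ∧ (unsignedStab φ).ncard = 2 ^ n

/-- The stabilizer fidelity: the maximum of `|⟨s|ψ⟩|²` over the stabilizer states `s`. -/
def stabFidelity {n : ℕ} (ψ : Vec n) : ℝ :=
  sSup {r | ∃ s : Vec n, IsStabilizer s ∧ r = ‖overlap s ψ‖ ^ 2}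

/-! ## Classical descriptions of stabilizer states -/

/-- Elementary Clifford gates: Hadamard, phase gate, controlled-`X` with control `i`, target `j`
(read as the identity if `i = j`). -/
inductive CliffordGate (n : ℕ) : Type
  | H (i : Fin n)
  | S (i : Fin n)
  | CX (i j : Fin n)

/-- The action of an elementary Clifford gate on vectors. -/
def CliffordGate.act {n : ℕ} : CliffordGate n → Vec n → Vec n
  | .H i, v => fun b =>
      (v (Function.update b i false) + (if b i then -1 else 1) * v (Function.update b i true))
        / (Real.sqrt 2 : ℂ)
  | .S i, v => fun b => (if b i then Complex.I else 1) * v b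
  | .CX i j, v => fun b =>
      if i = j then v b else v (Function.update b j (xor (b j) (b i)))

/-- All elementary Clifford gates on `n` qubits, in a fixed order. -/
def allGates (n : ℕ) : List (CliffordGate n) :=
  (List.finRange n).map .H ++ (List.finRange n).map .S ++
    (List.finRange n).flatMap (fun i => (List.finRange n).map (.CX i))

/-- A fixed sequence of elementary gates, every gate occurring `16 n²` times in turn. Every
Clifford circuit with at most `16 n²` gates is a subsequence of it, and such circuits prepare
every stabilizer state (up to a global phase). -/
def gateSeq (n : ℕ) : List (CliffordGate n) :=
  (List.replicate (16 * n ^ 2) (allGates n)).flatten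

/-- The classical description of a stabilizer state: the bit mask that selects a Clifford circuit
as a subsequence of `gateSeq n`. It has polynomially many bits in `n`. -/
abbrev StabDesc (n : ℕ) : Type := Fin (gateSeq n).length → Bool

/-- The Clifford circuit that a description selects, in order of application. -/
def StabDesc.circuit {n : ℕ} (d : StabDesc n) : List (CliffordGate n) :=
  (List.finRange (gateSeq n).length).filterMap
    (fun i => if d i then some ((gateSeq n).get i) else none)

/-- The described state: the circuit applied to `|0^n⟩`. -/
def StabDesc.state {n : ℕ} (d : StabDesc n) : Vec n :=
  d.circuit.foldl (fun v g => g.act v) (Pi.single (zeroBits n) 1)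

/-- The number in `[-1, 1)` with binary digits `b`, in two's complement fixed-point notation. -/
def fixedPoint {B : ℕ} (b : Fin (B + 1) → Bool) : ℝ :=
  ∑ j, if b j then (if j = 0 then -1 else (1 / 2 : ℝ) ^ (j : ℕ)) else 0

/-! ## Quantum programs and their cost

A program acts on a finite set of qubits ("wires"). Classical data are qubits as well, so that
classical computation is counted like everything else. -/

/-- Quantum programs on the wires `ι` with external instructions `E`:
unitary gates, measurements (in the computational basis) that control a branching or a loop,
and external instructions. -/
inductive Prog (E : Type) (ι : Type) : Type
  | skip : Prog E ι
  | gate {k : ℕ} (w : Fin k ↪ ι) (G : Matrix.unitaryGroup (Bits k) ℂ) : Prog E ι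
  | ext (e : E) : Prog E ι
  | seq (p q : Prog E ι) : Prog E ι
  /-- Measure the wire `i`; continue with `p` on outcome `1` and with `q` on outcome `0`. -/
  | branch (i : ι) (p q : Prog E ι) : Prog E ι
  /-- Measure the wire `i`; stop on outcome `0`; on outcome `1` run `p` and start again. -/
  | loop (i : ι) (p : Prog E ι) : Prog E ι

/-- The length of a program. A `k`-qubit gate counts `4^k`, which is the order of the number of
one- and two-qubit gates into which an arbitrary `k`-qubit unitary decomposes exactly. -/
def Prog.size {E ι : Type} : Prog E ι → ℕ
  | .skip => 1
  | .gate (k := k) _ _ => 4 ^ k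
  | .ext _ => 1
  | .seq p q => p.size + q.size
  | .branch _ p q => 1 + p.size + q.size
  | .loop _ p => 1 + p.size

/-- One branch of a computation: the unnormalised state of the wires (its squared norm is the
probability of the branch), and the number of steps, of oracle queries and of subroutine calls. -/
structure Conf (ι : Type) where
  state : (ι → Bool) → ℂ
  time : ℕ
  queries : ℕ
  calls : ℕ

/-- A `k`-qubit operator, applied to the wires `w`. -/
def applyOp {ι : Type} {k : ℕ} (w : Fin k ↪ ι) (G : Matrix (Bits k) (Bits k) ℂ)
    (v : (ι → Bool) → ℂ) : (ι → Bool) → ℂ :=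
  fun b => ∑ a : Bits k, G (fun j => b (w j)) a * v (Function.extend w a b)

/-- The branch in which measuring the wire `i` gives `r`; this takes one step. -/
def Conf.measure {ι : Type} (i : ι) (r : Bool) (c : Conf ι) : Conf ι :=
  { c with state := fun b => if b i = r then c.state b else 0, time := c.time + 1 }

/-- A loop with test wire `i`, in which at most `fuel` tests are made; branches that are still
inside the loop after that are dropped. -/
def loopRun {ι : Type} (i : ι) (body : Conf ι → List (Conf ι)) : ℕ → Conf ι → List (Conf ι)
  | 0, _ => []
  | fuel + 1, c =>
      c.measure i false :: (body (c.measure i true)).flatMap (loopRun i body fuel)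

/-- All branches in which a program halts, when every execution of a loop makes at most `fuel`
tests. The program, with wires `κ`, acts on the wires `ι` through the embedding `f`. As every test
takes a step, `fuel = T` covers every branch that takes at most `T` steps. -/
def Prog.run {E κ ι : Type} (f : κ ↪ ι) (sem : E → Conf ι → List (Conf ι)) (fuel : ℕ) :
    Prog E κ → Conf ι → List (Conf ι)
  | .skip, c => [{ c with time := c.time + 1 }]
  | .gate (k := k) w G, c =>
      [{ c with state := applyOp (w.trans f) (G : Matrix (Bits k) (Bits k) ℂ) c.state,
                time := c.time + 4 ^ k }]
  | .ext e, c => sem e c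
  | .seq p q, c => (Prog.run f sem fuel p c).flatMap (Prog.run f sem fuel q)
  | .branch i p q, c =>
      Prog.run f sem fuel p (c.measure (f i) true) ++
        Prog.run f sem fuel q (c.measure (f i) false)
  | .loop i p, c => loopRun (f i) (Prog.run f sem fuel p) fuel c

open Classical in
/-- The total probability of those branches in a list that satisfy `ok`, and in which measuring
all wires at the end gives an outcome satisfying `good`. -/
def probOf {ι : Type} [Fintype ι] [DecidableEq ι] (cs : List (Conf ι)) (ok : Conf ι → Prop)
    (good : (ι → Bool) → Prop) : ℝ :=
  (cs.map fun c => if ok c then ∑ b, if good b then ‖c.state b‖ ^ 2 else 0 else 0).sum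

/-! ## Base algorithms -/

/-- An algorithm that receives `S` copies of an `n`-qubit state and outputs the description of a
stabilizer state. -/
structure BaseAlg (n S : ℕ) where
  wire : Type
  [fin : Fintype wire]
  [dec : DecidableEq wire]
  prog : Prog Empty wire
  /-- the wires that hold the copies at the beginning; all other wires start in `|0⟩` -/
  inp : Fin S × Fin n ↪ wire
  /-- the wires that hold the output at the end -/
  out : Fin (gateSeq n).length → wire

attribute [instance] BaseAlg.fin BaseAlg.dec

open Classical in
/-- The initial configuration: `|ψ⟩^{⊗S}` on the input wires, `|0⟩` on the others. -/
def BaseAlg.start {n S : ℕ} (A : BaseAlg n S) (ψ : Vec n) : Conf A.wire where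
  state := fun b =>
    if ∀ i, i ∉ Set.range A.inp → b i = false then ∏ c, ψ (fun j => b (A.inp (c, j))) else 0
  time := 0
  queries := 0
  calls := 0

/-- The probability that `A`, on copies of `ψ`, halts within `T` steps with an output
satisfying `good`. -/
def BaseAlg.prob {n S : ℕ} (A : BaseAlg n S) (ψ : Vec n) (T : ℕ) (good : StabDesc n → Prop) : ℝ :=
  probOf (A.prog.run (Function.Embedding.refl _) (fun e => e.elim) T (A.start ψ))
    (fun c => c.time ≤ T) (fun b => good (fun l => b (A.out l)))

/-- `A` has time complexity at most `T`: its program has length at most `T`, receiving the copies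
takes a step for each of them, and on every input state it halts within `T` steps. -/
def BaseAlg.HasTime {n S : ℕ} (A : BaseAlg n S) (T : ℕ) : Prop :=
  A.prog.size ≤ T ∧ S ≤ T ∧ ∀ ψ : Vec n, IsState ψ → A.prob ψ T (fun _ => True) = 1

/-- Given copies of any `n`-qubit state whose Gowers proxy is at least `γ`, the algorithm outputs
with probability at least `1 - δ` a stabilizer state of fidelity at least `η`. -/
def BaseAlg.Succeeds {n S : ℕ} (A : BaseAlg n S) (T : ℕ) (γ η δ : ℝ) : Prop :=
  ∀ ψ : Vec n, IsState ψ → γ ≤ gowersProxy ψ →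
    1 - δ ≤ A.prob ψ T (fun d => η ≤ ‖overlap d.state ψ‖ ^ 2)

/-! ## Decomposition algorithms -/

/-- The external instructions of an algorithm with access to an `n`-qubit unitary `U`, to its
controlled version and to a subroutine with wires `κ`. The wire `0` of `cquery` is the control. -/
inductive Access (n : ℕ) (κ ι : Type) : Type
  | query (w : Fin n ↪ ι)
  | cquery (w : Fin (n + 1) ↪ ι)
  | call (w : κ ↪ ι)

/-- The controlled version of an operator. -/
def controlled {n : ℕ} (U : Matrix (Bits n) (Bits n) ℂ) :
    Matrix (Bits (n + 1)) (Bits (n + 1)) ℂ := fun s t =>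
  if s 0 = t 0 then
    (if s 0 then U (Fin.tail s) (Fin.tail t) else if Fin.tail s = Fin.tail t then 1 else 0)
  else 0

/-- The meaning of the external instructions: a query takes one step; a call runs the program of
the subroutine, whose steps are counted. -/
def Access.sem {n S : ℕ} {ι : Type} (A : BaseAlg n S) (U : Matrix (Bits n) (Bits n) ℂ)
    (fuel : ℕ) : Access n A.wire ι → Conf ι → List (Conf ι)
  | .query w, c =>
      [{ c with state := applyOp w U c.state, time := c.time + 1, queries := c.queries + 1 }]
  | .cquery w, c =>
      [{ c with state := applyOp w (controlled U) c.state, time := c.time + 1,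
                queries := c.queries + 1 }]
  | .call w, c =>
      A.prog.run w (fun e => e.elim) fuel { c with time := c.time + 1, calls := c.calls + 1 }

/-- An algorithm with access to `U`, to controlled-`U` and to a subroutine with wires `κ`, that
outputs a list of at most `terms` pairs of a coefficient and a stabilizer state, and a number.
All numbers are output in fixed-point notation. All wires start in `|0⟩`. -/
structure DecompAlg (n : ℕ) (κ : Type) where
  wire : Type
  [fin : Fintype wire]
  [dec : DecidableEq wire]
  prog : Prog (Access n κ wire) wire
  terms : ℕ
  prec : ℕ
  /-- tells whether the term is present in the output -/
  used : Fin terms → wire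
  /-- real and imaginary part of the coefficient -/
  re : Fin terms → Fin (prec + 1) → wire
  im : Fin terms → Fin (prec + 1) → wire
  /-- the description of the stabilizer state -/
  desc : Fin terms → Fin (gateSeq n).length → wire
  /-- the weight of the residual state -/
  weight : Fin (prec + 1) → wire

attribute [instance] DecompAlg.fin DecompAlg.dec

section Output

variable {n : ℕ} {κ : Type} (D : DecompAlg n κ) (b : D.wire → Bool)

/-- The indices of the terms that are output. -/
def DecompAlg.support : Finset (Fin D.terms) := Finset.univ.filter fun i => b (D.used i) = true

/-- The coefficient `β_i`. -/
def DecompAlg.coeff (i : Fin D.terms) : ℂ :=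
  ⟨fixedPoint fun j => b (D.re i j), fixedPoint fun j => b (D.im i j)⟩

/-- The stabilizer state `|φ_i⟩`. -/
def DecompAlg.stab (i : Fin D.terms) : Vec n := StabDesc.state fun l => b (D.desc i l)

/-- The number output for the weight of the residual state. -/
def DecompAlg.weightOut : ℝ := fixedPoint fun j => b (D.weight j)

/-- The output is a decomposition `|ψ⟩ = ∑ β_i |φ_i⟩ + α |φ^⊥⟩` with at most `kmax` stabilizer
states, `0 < |β_i| < 1`, `0 ≤ α ≤ 1` and `α² F_Stab(φ^⊥) < ε`. (The phase of `α` is absorbed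
into `|φ^⊥⟩`. A finite output can determine `α` only approximately.) -/
def DecompAlg.IsDecomposition (ψ : Vec n) (ε kmax : ℝ) : Prop :=
  ((D.support b).card : ℝ) ≤ kmax ∧
  (∀ i ∈ D.support b, IsStabilizer (D.stab b i) ∧ 0 < ‖D.coeff b i‖ ∧ ‖D.coeff b i‖ < 1) ∧
  ∃ (α : ℝ) (φ : Vec n), 0 ≤ α ∧ α ≤ 1 ∧ |D.weightOut b - α| ≤ ε ∧ IsState φ ∧
    ψ = ∑ i ∈ D.support b, D.coeff b i • D.stab b i + (α : ℂ) • φ ∧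
    α ^ 2 * stabFidelity φ < ε

end Output

open Classical in
/-- The initial configuration: all wires in `|0⟩`. -/
def DecompAlg.start {n : ℕ} {κ : Type} (D : DecompAlg n κ) : Conf D.wire where
  state := fun b => if ∀ i, b i = false then 1 else 0
  time := 0
  queries := 0
  calls := 0

/-- The probability that `D`, with access to `U` and controlled-`U` and with the subroutine `A`,
halts within `T` steps, `Q` queries and `N` calls of `A`, with an output satisfying `good`. -/
def DecompAlg.prob {n S : ℕ} (A : BaseAlg n S) (D : DecompAlg n A.wire)
    (U : Matrix (Bits n) (Bits n) ℂ) (T Q N : ℕ) (good : (D.wire → Bool) → Prop) : ℝ :=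
  probOf (D.prog.run (Function.Embedding.refl _) (Access.sem A U T) T D.start)
    (fun c => c.time ≤ T ∧ c.queries ≤ Q ∧ c.calls ≤ N) good

end StabDecomp

end

/-!
The decomposition is found greedily. Put `c = 2 ^ (-h)` with `c²` of order `η ε`, and keep a
residual vector `r = ψ - ∑ i, c ω_i φ_i` with stabilizer states `φ_i` and phases `ω_i` in
`{1, -1, i, -i}`. If `‖r‖² F_Stab(r / ‖r‖) < ε`, then `r` may be output as the remainder. Otherwise
`ε ≤ F_Stab(r / ‖r‖)`, as `‖r‖ ≤ 1`. The projection onto a stabilizer state is the average of the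
signed Weyl operators in its stabilizer group, and the Gowers proxy is a sixth moment of Weyl
coefficients (`gowersProxy_eq`), so that Jensen's inequality bounds the proxy of the residual state
below by `ε ^ 6` (`overlap_pow_le_gowersProxy`, `le_gowersProxy_of_le_stabFidelity`). Hence the
subroutine, given copies of the residual state, finds with probability `1 - δ` a stabilizer state
`φ` of fidelity at least `η`, and for one of the four phases the subtraction of `c ω φ` lowers
`‖r‖²` by at least `c²` (`Par.Valid.exists_forced`). The algorithm need not trust the subroutine: a
term is accepted only if estimates of the squared norms before and after show a decrease, which
then is at least `c² / 4` (`Par.Valid.inv_succ`). As `‖r‖²` starts with `1`, there are at most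
`4 / c²` terms, which is `O(1 / (η ε))` and hence `O(1 / η²)`. The coefficients have few digits and
are output exactly; only the weight `‖r‖` of the remainder is rounded
(`Par.Valid.isDecomposition`).

The residual state is prepared from a linear combination of unitaries with a single controlled
query (`wp_lcu`, `le_wp_attempt`): an index register in superposition selects `ψ` or one of the
terms, and the attempt succeeds if the index returns to zero, which happens with probability
`‖r‖² / Λ²`, where `Λ` is the sum of the absolute values of the coefficients. Counting the successes
estimates `‖r‖²` (`hoeffding_counter`, `le_wp_est`), and repeating until success prepares the copies
(`loop_value`, `le_wp_copies`). As long as `‖r‖² ≥ ε / 2`, the success probability is polynomially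
large; once an estimate indicates that `‖r‖² < ε`, the algorithm stops.

Programs are analysed by a quantitative weakest-precondition calculus: `wp σ fuel p G c` is the sum
of `G` over the branches of `p` on `c`, where `G` is homogeneous of degree two in the state and
antitone in the costs (`Post`). Since the success probability counts only the branches within the
cost bounds, bounds on probabilities and costs are proved together, and lower bounds on `wp` suffice
throughout. The outcome for the whole program is `le_prob_alg`. Its costs are bounded in
`Par.Small`, and `stdPar` and `repeats` fix the parameters.
-/

noncomputable section

namespace StabDecomp

/-! ### Operators on registers -/

section ApplyOp

variable {ι : Type}

lemma extend_comp {κ : Type} (w : κ ↪ ι) (a : κ → Bool) (b : ι → Bool) :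
    (fun j => Function.extend w a b (w j)) = a := by
  funext j; exact w.injective.extend_apply a b j

lemma extend_self {κ : Type} (w : κ ↪ ι) (b : ι → Bool) :
    Function.extend w (fun j => b (w j)) b = b := by
  funext i
  by_cases h : ∃ j, w j = i
  · obtain ⟨j, rfl⟩ := h
    rw [w.injective.extend_apply]
  · rw [Function.extend_apply' _ _ _ h]

lemma extend_extend {κ : Type} (w : κ ↪ ι) (a a' : κ → Bool) (b : ι → Bool) :
    Function.extend w a (Function.extend w a' b) = Function.extend w a b := by
  funext i
  by_cases h : ∃ j, w j = i
  · obtain ⟨j, rfl⟩ := h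
    rw [w.injective.extend_apply, w.injective.extend_apply]
  · rw [Function.extend_apply' _ _ _ h, Function.extend_apply' _ _ _ h,
      Function.extend_apply' _ _ _ h]

/-- The squared norm of a vector. -/
def nsq [Fintype ι] [DecidableEq ι] (v : (ι → Bool) → ℂ) : ℝ := ∑ b, ‖v b‖ ^ 2

lemma nsq_nonneg [Fintype ι] [DecidableEq ι] (v : (ι → Bool) → ℂ) : 0 ≤ nsq v :=
  Finset.sum_nonneg fun _ _ => by positivity

lemma nsq_smul [Fintype ι] [DecidableEq ι] (z : ℂ) (v : (ι → Bool) → ℂ) :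
    nsq (z • v) = ‖z‖ ^ 2 * nsq v := by
  simp [nsq, Finset.mul_sum, mul_pow]

lemma nsq_eq_dotProduct [Fintype ι] [DecidableEq ι] (v : (ι → Bool) → ℂ) :
    ((nsq v : ℝ) : ℂ) = star v ⬝ᵥ v := by
  simp only [nsq, dotProduct, Pi.star_apply]
  push_cast
  refine Finset.sum_congr rfl fun b _ => ?_
  rw [← Complex.conj_mul']; rfl

variable {k : ℕ} (w : Fin k ↪ ι)

lemma applyOp_mul (A B : Matrix (Bits k) (Bits k) ℂ) (v : (ι → Bool) → ℂ) :
    applyOp w A (applyOp w B v) = applyOp w (A * B) v := by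
  funext b
  simp only [applyOp, Matrix.mul_apply, Finset.sum_mul, Finset.mul_sum, extend_comp,
    extend_extend]
  rw [Finset.sum_comm]
  simp only [mul_assoc]

lemma applyOp_one (v : (ι → Bool) → ℂ) : applyOp w 1 v = v := by
  funext b
  simp only [applyOp, Matrix.one_apply, ite_mul, one_mul, zero_mul]
  rw [Finset.sum_ite_eq]
  simp [extend_self]

lemma applyOp_smul (A : Matrix (Bits k) (Bits k) ℂ) (z : ℂ) (v : (ι → Bool) → ℂ) :
    applyOp w A (z • v) = z • applyOp w A v := by
  funext b
  simp only [applyOp, Pi.smul_apply, smul_eq_mul, Finset.mul_sum]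
  exact Finset.sum_congr rfl fun _ _ => by ring

lemma applyOp_add (A : Matrix (Bits k) (Bits k) ℂ) (u v : (ι → Bool) → ℂ) :
    applyOp w A (u + v) = applyOp w A u + applyOp w A v := by
  funext b
  simp only [applyOp, Pi.add_apply, mul_add, Finset.sum_add_distrib]

/-- The action of an operator on a register, as a linear map. -/
def applyOpₗ (A : Matrix (Bits k) (Bits k) ℂ) :
    ((ι → Bool) → ℂ) →ₗ[ℂ] ((ι → Bool) → ℂ) where
  toFun := applyOp w A
  map_add' := applyOp_add w A
  map_smul' := applyOp_smul w A

lemma dotProduct_applyOp [Fintype ι] [DecidableEq ι] (A : Matrix (Bits k) (Bits k) ℂ)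
    (u v : (ι → Bool) → ℂ) : star u ⬝ᵥ applyOp w A v = star (applyOp w Aᴴ u) ⬝ᵥ v := by
  simp only [dotProduct, applyOp, Pi.star_apply, Finset.mul_sum, star_sum, Finset.sum_mul,
    ← Fintype.sum_prod_type']
  let e : (ι → Bool) × Bits k → (ι → Bool) × Bits k :=
    fun p => (Function.extend w p.2 p.1, fun j => p.1 (w j))
  have he : Function.Involutive e := by
    rintro ⟨b, a⟩
    simp only [e, extend_extend, extend_self, extend_comp]
  refine Fintype.sum_equiv he.toPerm _ _ ?_
  rintro ⟨b, a⟩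
  simp only [Function.Involutive.coe_toPerm, e, extend_extend, extend_self, extend_comp,
    Matrix.conjTranspose_apply, star_mul', star_star]
  ring

lemma dotProduct_applyOp_unitary [Fintype ι] [DecidableEq ι]
    (G : Matrix.unitaryGroup (Bits k) ℂ) (u v : (ι → Bool) → ℂ) :
    star (applyOp w (G : Matrix (Bits k) (Bits k) ℂ) u) ⬝ᵥ
      applyOp w (G : Matrix (Bits k) (Bits k) ℂ) v = star u ⬝ᵥ v := by
  rw [dotProduct_applyOp, applyOp_mul]
  have : (G : Matrix (Bits k) (Bits k) ℂ)ᴴ * (G : Matrix (Bits k) (Bits k) ℂ) = 1 :=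
    Matrix.mem_unitaryGroup_iff'.1 G.2
  rw [this, applyOp_one]

lemma nsq_applyOp [Fintype ι] [DecidableEq ι] (G : Matrix.unitaryGroup (Bits k) ℂ)
    (v : (ι → Bool) → ℂ) : nsq (applyOp w (G : Matrix (Bits k) (Bits k) ℂ) v) = nsq v := by
  have h := dotProduct_applyOp_unitary w G v v
  rw [← nsq_eq_dotProduct, ← nsq_eq_dotProduct] at h
  exact_mod_cast h

/-- The unitary that permutes the computational basis by `σ`. -/
def permU {k : ℕ} (σ : Equiv.Perm (Bits k)) : Matrix.unitaryGroup (Bits k) ℂ :=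
  ⟨Matrix.of fun s t => if s = σ t then 1 else 0, by
    rw [Matrix.mem_unitaryGroup_iff']
    ext s t
    rw [Matrix.star_eq_conjTranspose, Matrix.mul_apply]
    simp only [Matrix.conjTranspose_apply, Matrix.one_apply, Matrix.of_apply]
    rw [Finset.sum_eq_single (σ t)]
    · by_cases h : s = t
      · simp [h]
      · simp [h, Ne.symm h]
    · intro b _ hb
      simp [hb]
    · simp⟩

lemma permU_apply (σ : Equiv.Perm (Bits k)) (s t : Bits k) :
    (permU σ : Matrix (Bits k) (Bits k) ℂ) s t = if s = σ t then 1 else 0 := rfl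

lemma applyOp_permU (σ : Equiv.Perm (Bits k)) (v : (ι → Bool) → ℂ) (b : ι → Bool) :
    applyOp w (permU σ : Matrix (Bits k) (Bits k) ℂ) v b =
      v (Function.extend w (σ.symm fun j => b (w j)) b) := by
  simp only [applyOp, permU_apply, ite_mul, one_mul, zero_mul]
  rw [Finset.sum_eq_single (σ.symm fun j => b (w j))]
  · simp
  · intro a _ ha
    rw [if_neg]
    rintro h
    exact ha (by rw [h]; simp)
  · simp

end ApplyOp

/-! ### Clifford gates -/

/-- The Hadamard gate. -/
def hadU : Matrix.unitaryGroup (Bits 1) ℂ :=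
  ⟨Matrix.of fun s t => (if s 0 && t 0 then -1 else 1) / (Real.sqrt 2 : ℂ), by
    rw [Matrix.mem_unitaryGroup_iff']
    ext s t
    rw [Matrix.star_eq_conjTranspose, Matrix.mul_apply]
    simp only [Matrix.conjTranspose_apply, Matrix.of_apply]
    rw [← (Equiv.funUnique (Fin 1) Bool).symm.sum_comp]
    have h2 : (Real.sqrt 2 : ℂ) * (Real.sqrt 2 : ℂ) = 2 := by
      norm_cast; exact Real.mul_self_sqrt (by norm_num)
    have hst : s = t ↔ s 0 = t 0 := by
      constructor
      · rintro rfl; rfl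
      · intro h; funext i; rw [Subsingleton.elim i 0, h]
    have h0 : (Real.sqrt 2 : ℂ) ≠ 0 := by
      intro h; rw [h] at h2; norm_num at h2
    have h3 : ((Real.sqrt 2 : ℂ) ^ 2) = 2 := by rw [sq, h2]
    rw [Matrix.one_apply]
    simp only [hst]
    rcases s 0 <;> rcases t 0 <;> simp <;> field_simp <;> rw [h3] <;> norm_num⟩

/-- The phase gate. -/
def phaseU : Matrix.unitaryGroup (Bits 1) ℂ :=
  ⟨Matrix.diagonal fun s => if s 0 then Complex.I else 1, by
    rw [Matrix.mem_unitaryGroup_iff', Matrix.star_eq_conjTranspose,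
      Matrix.diagonal_conjTranspose, Matrix.diagonal_mul_diagonal, ← Matrix.diagonal_one]
    congr 1
    funext s
    by_cases h : s 0 = true <;> simp [h]⟩

/-- The embedding of a single wire. -/
def wire1 {ι : Type} (i : ι) : Fin 1 ↪ ι := ⟨fun _ => i, fun a b _ => Subsingleton.elim a b⟩

/-- The embedding of two different wires. -/
def wire2 {ι : Type} (i j : ι) (h : i ≠ j) : Fin 2 ↪ ι :=
  ⟨![i, j], by
    intro a b hab
    fin_cases a <;> fin_cases b <;> simp_all [Ne.symm h]⟩

lemma extend_wire1 {ι : Type} [DecidableEq ι] (i : ι) (a : Bits 1) (b : ι → Bool) :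
    Function.extend (wire1 i) a b = Function.update b i (a 0) := by
  funext j
  by_cases h : j = i
  · subst h
    have := (wire1 j).injective.extend_apply a b 0
    rw [Function.update_self]; exact this
  · rw [Function.update_of_ne h, Function.extend_apply']
    rintro ⟨x, rfl⟩
    exact h rfl

/-- The controlled-`X` permutation of two bits. -/
def cxPerm : Equiv.Perm (Bits 2) :=
  Function.Involutive.toPerm (fun b => ![b 0, xor (b 1) (b 0)]) (by
    intro b; funext i; fin_cases i <;> simp)

/-- Every elementary Clifford gate acts on at most two wires, by a unitary. -/
lemma CliffordGate.exists_unitary {n : ℕ} (g : CliffordGate n) :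
    ∃ k : ℕ, k ≤ 2 ∧ ∃ (w : Fin k ↪ Fin n) (G : Matrix.unitaryGroup (Bits k) ℂ),
      ∀ v, g.act v = applyOp w (G : Matrix (Bits k) (Bits k) ℂ) v := by
  cases g with
  | H i =>
    refine ⟨1, by norm_num, wire1 i, hadU, fun v => ?_⟩
    funext b
    simp only [CliffordGate.act, applyOp, hadU, Matrix.of_apply]
    rw [← (Equiv.funUnique (Fin 1) Bool).symm.sum_comp]
    simp only [extend_wire1, Fintype.sum_bool]
    have h1 : b (wire1 i 0) = b i := rfl
    simp only [h1]
    by_cases h : b i = true <;> simp [h] <;> ring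
  | S i =>
    refine ⟨1, by norm_num, wire1 i, phaseU, fun v => ?_⟩
    funext b
    simp only [CliffordGate.act, applyOp, phaseU, Matrix.diagonal_apply, ite_mul, zero_mul]
    rw [Finset.sum_ite_eq]
    simp only [Finset.mem_univ, if_true, extend_self]
    rfl
  | CX i j =>
    by_cases hij : i = j
    · refine ⟨0, by norm_num, ⟨Fin.elim0, fun a => a.elim0⟩, 1, fun v => ?_⟩
      rw [show ((1 : Matrix.unitaryGroup (Bits 0) ℂ) : Matrix (Bits 0) (Bits 0) ℂ) = 1 from rfl,
        applyOp_one]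
      funext b; simp [CliffordGate.act, hij]
    · refine ⟨2, le_rfl, wire2 i j hij, permU cxPerm, fun v => ?_⟩
      funext b
      rw [applyOp_permU]
      simp only [CliffordGate.act, if_neg hij]
      congr 1
      funext l
      by_cases hl : l = j
      · subst hl
        rw [Function.update_self]
        refine Eq.trans ?_ ((wire2 i l hij).injective.extend_apply _ b 1).symm
        rfl
      · rw [Function.update_of_ne hl]
        by_cases hl' : l = i
        · subst hl'
          refine Eq.trans ?_ ((wire2 l j hij).injective.extend_apply _ b 0).symm
          rfl
        · rw [Function.extend_apply']
          rintro ⟨x, hx⟩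
          fin_cases x
          · exact hl' hx.symm
          · exact hl hx.symm

lemma CliffordGate.overlap_act {n : ℕ} (g : CliffordGate n) (u v : Vec n) :
    overlap (g.act u) (g.act v) = overlap u v := by
  obtain ⟨k, -, w, G, h⟩ := g.exists_unitary
  rw [h, h]
  exact dotProduct_applyOp_unitary w G u v

lemma CliffordGate.nsq_act {n : ℕ} (g : CliffordGate n) (u : Vec n) : nsq (g.act u) = nsq u := by
  obtain ⟨k, -, w, G, h⟩ := g.exists_unitary
  rw [h]
  exact nsq_applyOp w G u

/-! ### Weyl operators -/

/-- The nonzero entry of `i^{ab} X^a Z^b` in row `s`. -/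
def pauliPhase (a b s : Bool) : ℂ :=
  (if a && b then Complex.I else 1) * (if b && xor s a then -1 else 1)

lemma weyl_mulVec {n : ℕ} (x : Bits n × Bits n) (v : Vec n) (s : Bits n) :
    (weyl x *ᵥ v) s = (∏ j, pauliPhase (x.1 j) (x.2 j) (s j)) *
      v (fun j => xor (s j) (x.1 j)) := by
  rw [Matrix.mulVec, dotProduct, Finset.sum_eq_single (fun j => xor (s j) (x.1 j))]
  · congr 1
    refine Finset.prod_congr rfl fun j _ => ?_
    rw [pauli, pauliPhase, if_pos]
    simp
  · intro t _ ht
    have : ∃ j, t j ≠ xor (s j) (x.1 j) := by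
      by_contra hcon
      push Not at hcon
      exact ht (funext hcon)
    obtain ⟨j, hj⟩ := this
    rw [weyl, Finset.prod_eq_zero (Finset.mem_univ j), zero_mul]
    rw [pauli, if_neg]
    intro h
    apply hj
    rw [h]; simp
  · simp

/-- Conjugation by a Clifford gate maps Weyl operators to Weyl operators, up to a sign. -/
lemma CliffordGate.exists_conj {n : ℕ} (g : CliffordGate n) :
    ∃ τ : Bits n × Bits n → Bits n × Bits n, Function.Involutive τ ∧
      ∀ x, ∃ e : ℂ, (e = 1 ∨ e = -1) ∧ ∀ v : Vec n, weyl x *ᵥ g.act v =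
          e • g.act (weyl (τ x) *ᵥ v) := by
  cases g with
  | H i =>
    refine ⟨fun x => (Function.update x.1 i (x.2 i), Function.update x.2 i (x.1 i)), ?_, ?_⟩
    · rintro ⟨a, b⟩; simp
    · rintro ⟨a, b⟩
      refine ⟨if a i && b i then -1 else 1, by split_ifs <;> simp, fun v => ?_⟩
      funext s
      simp only [weyl_mulVec, Pi.smul_apply, CliffordGate.act, smul_eq_mul]
      have hs : ∀ (c : Bool) , (fun j => xor (Function.update s i c j)
          (Function.update a i (b i) j)) =
          Function.update (fun j => xor (s j) (a j)) i (xor c (b i)) := by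
        intro c; funext j
        by_cases h : j = i
        · subst h; simp
        · simp [h]
      simp only [hs]
      have hp : ∀ (f : Fin n → ℂ), ∏ j, f j = f i * ∏ j ∈ Finset.univ.erase i, f j :=
        fun f => (Finset.mul_prod_erase _ _ (Finset.mem_univ i)).symm
      simp only [hp]
      have hq : ∀ c : Bool, ∏ j ∈ Finset.univ.erase i, pauliPhase (Function.update a i (b i) j)
          (Function.update b i (a i) j) (Function.update s i c j) =
          ∏ j ∈ Finset.univ.erase i, pauliPhase (a j) (b j) (s j) := by
        intro c
        refine Finset.prod_congr rfl fun j hj => ?_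
        have := Finset.ne_of_mem_erase hj
        simp [this]
      simp only [hq, Function.update_self]
      generalize ∏ j ∈ Finset.univ.erase i, pauliPhase (a j) (b j) (s j) = P
      rcases Bool.eq_false_or_eq_true (a i) with h1 | h1 <;>
        rcases Bool.eq_false_or_eq_true (b i) with h2 | h2 <;>
        rcases Bool.eq_false_or_eq_true (s i) with h3 | h3 <;>
        simp [pauliPhase, h1, h2, h3] <;> ring
  | S i =>
    refine ⟨fun x => (x.1, Function.update x.2 i (xor (x.2 i) (x.1 i))), ?_, ?_⟩
    · rintro ⟨a, b⟩; simp
    · rintro ⟨a, b⟩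
      refine ⟨if a i && !b i then -1 else 1, by split_ifs <;> simp, fun v => ?_⟩
      funext s
      simp only [weyl_mulVec, Pi.smul_apply, CliffordGate.act, smul_eq_mul]
      have hp : ∀ (f : Fin n → ℂ), ∏ j, f j = f i * ∏ j ∈ Finset.univ.erase i, f j :=
        fun f => (Finset.mul_prod_erase _ _ (Finset.mem_univ i)).symm
      simp only [hp]
      have hq : ∏ j ∈ Finset.univ.erase i, pauliPhase (a j)
          (Function.update b i (xor (b i) (a i)) j) (s j) =
          ∏ j ∈ Finset.univ.erase i, pauliPhase (a j) (b j) (s j) := by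
        refine Finset.prod_congr rfl fun j hj => ?_
        have := Finset.ne_of_mem_erase hj
        simp [this]
      simp only [hq, Function.update_self]
      generalize ∏ j ∈ Finset.univ.erase i, pauliPhase (a j) (b j) (s j) = P
      generalize v _ = v'
      have hI : Complex.I * Complex.I = -1 := Complex.I_mul_I
      rcases Bool.eq_false_or_eq_true (a i) with h1 | h1 <;>
        rcases Bool.eq_false_or_eq_true (b i) with h2 | h2 <;>
        rcases Bool.eq_false_or_eq_true (s i) with h3 | h3 <;>
        simp [pauliPhase, h1, h2, h3] <;>
        first
          | ring1
          | linear_combination (P * v') * hI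
          | linear_combination (-P * v') * hI
  | CX i j =>
    by_cases hij : i = j
    · refine ⟨id, fun _ => rfl, fun x => ⟨1, Or.inl rfl, fun v => ?_⟩⟩
      have : ∀ v, (CliffordGate.CX i j).act v = v := by
        intro v; funext b; simp [CliffordGate.act, hij]
      rw [this, this, one_smul]; rfl
    have hji : j ≠ i := Ne.symm hij
    refine ⟨fun x => (Function.update x.1 j (xor (x.1 j) (x.1 i)),
        Function.update x.2 i (xor (x.2 i) (x.2 j))), ?_, ?_⟩
    · rintro ⟨a, b⟩
      simp [hij, hji]
    · rintro ⟨a, b⟩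
      refine ⟨if a i && b j && (a j == b i) then -1 else 1,
        by split_ifs <;> simp, fun v => ?_⟩
      funext s
      simp only [weyl_mulVec, Pi.smul_apply, CliffordGate.act, smul_eq_mul, if_neg hij]
      have hs : (fun l => xor (Function.update s j (xor (s j) (s i)) l)
          (Function.update a j (xor (a j) (a i)) l)) =
          Function.update (fun l => xor (s l) (a l)) j
            (xor (xor (s j) (a j)) (xor (s i) (a i))) := by
        funext l
        by_cases h : l = j
        · subst h
          simp only [Function.update_self]
          cases s l <;> cases s i <;> cases a l <;> cases a i <;> rfl
        · simp [h]
      rw [hs]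
      have hp : ∀ (f : Fin n → ℂ), ∏ l, f l =
          f i * (f j * ∏ l ∈ (Finset.univ.erase i).erase j, f l) := by
        intro f
        rw [Finset.mul_prod_erase _ _ (Finset.mem_erase.2 ⟨hji, Finset.mem_univ j⟩),
          Finset.mul_prod_erase _ _ (Finset.mem_univ i)]
      simp only [hp]
      have hq : ∏ l ∈ (Finset.univ.erase i).erase j,
          pauliPhase (Function.update a j (xor (a j) (a i)) l)
          (Function.update b i (xor (b i) (b j)) l) (Function.update s j (xor (s j) (s i)) l) =
          ∏ l ∈ (Finset.univ.erase i).erase j, pauliPhase (a l) (b l) (s l) := by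
        refine Finset.prod_congr rfl fun l hl => ?_
        have h1 := Finset.ne_of_mem_erase hl
        have h2 := Finset.ne_of_mem_erase (Finset.mem_of_mem_erase hl)
        simp [h1, h2]
      simp only [hq, Function.update_self, Function.update_of_ne hij, Function.update_of_ne hji]
      generalize ∏ l ∈ (Finset.univ.erase i).erase j, pauliPhase (a l) (b l) (s l) = P
      generalize v _ = v'
      generalize a i = a1
      generalize b i = b1
      generalize s i = s1
      generalize a j = a2
      generalize b j = b2
      generalize s j = s2
      have hI : Complex.I * Complex.I = -1 := Complex.I_mul_I
      cases a1 <;> cases b1 <;> cases a2 <;> cases b2 <;> simp [pauliPhase] <;>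
        cases s1 <;> cases s2 <;> simp <;>
        first
          | ring1
          | linear_combination (P * v') * hI
          | linear_combination (-P * v') * hI

lemma overlap_smul_right {n : ℕ} (z : ℂ) (u v : Vec n) :
    overlap u (z • v) = z * overlap u v := by
  simp [overlap, dotProduct_smul]

/-- Clifford gates preserve the stabilizer dimension. -/
lemma CliffordGate.ncard_unsignedStab_act {n : ℕ} (g : CliffordGate n) (v : Vec n) :
    (unsignedStab (g.act v)).ncard = (unsignedStab v).ncard := by
  obtain ⟨τ, hinv, h⟩ := g.exists_conj
  have hτ : unsignedStab (g.act v) = τ ⁻¹' unsignedStab v := by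
    ext x
    obtain ⟨e, he, hx⟩ := h x
    simp only [unsignedStab, Set.mem_preimage, Set.mem_ofPred_eq, weylExp]
    rw [hx, overlap_smul_right, g.overlap_act]
    rcases he with rfl | rfl
    · simp
    · rw [neg_one_mul, neg_eq_iff_eq_neg, neg_inj, or_comm]
  rw [hτ, Set.ncard_preimage_of_injective_subset_range hinv.injective]
  rw [hinv.surjective.range_eq]
  exact Set.subset_univ _

lemma weylExp_zero_state {n : ℕ} (x : Bits n × Bits n) :
    weylExp (Pi.single (zeroBits n) 1) x = if x.1 = zeroBits n then 1 else 0 := by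
  have h1 : ∀ v : Vec n, overlap (Pi.single (zeroBits n) 1) v = v (zeroBits n) := by
    intro v
    simp only [overlap, dotProduct, Pi.star_apply]
    rw [Finset.sum_eq_single (zeroBits n)]
    · simp
    · intro b _ hb; simp [hb]
    · simp
  rw [weylExp, h1, weyl_mulVec]
  have h2 : (fun j => xor (zeroBits n j) (x.1 j)) = x.1 := by funext j; simp [zeroBits]
  rw [h2]
  split_ifs with h
  · rw [h]; simp [zeroBits, pauliPhase]
  · simp [h]

/-- The state of a circuit is a stabilizer state: `|0ⁿ⟩` is fixed by the `2ⁿ` Weyl operators without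
`X` part, and every Clifford gate permutes the Weyl operators up to signs. -/
lemma StabDesc.isStabilizer {n : ℕ} (d : StabDesc n) : IsStabilizer d.state := by
  have key : ∀ (l : List (CliffordGate n)) (v : Vec n), IsStabilizer v →
      IsStabilizer (l.foldl (fun v g => g.act v) v) := by
    intro l
    induction l with
    | nil => intro v hv; exact hv
    | cons g l ih =>
      intro v hv
      refine ih _ ⟨?_, ?_⟩
      · have := g.nsq_act v
        rw [IsState]
        exact this.trans hv.1
      · rw [g.ncard_unsignedStab_act, hv.2]
  refine key _ _ ⟨?_, ?_⟩
  · rw [IsState, Finset.sum_eq_single (zeroBits n)]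
    · simp
    · intro b _ hb; simp [hb]
    · simp
  · have : unsignedStab (Pi.single (zeroBits n) 1 : Vec n) =
        (fun b => (zeroBits n, b)) '' (Set.univ : Set (Bits n)) := by
      ext x
      rcases x with ⟨a, b⟩
      simp only [unsignedStab, Set.mem_ofPred_eq, weylExp_zero_state, Set.image_univ,
        Set.mem_range, Prod.mk.injEq, exists_eq_right]
      by_cases h : a = zeroBits n
      · simp [h]
      · simp [h, Ne.symm h]
    rw [this, Set.ncard_image_of_injective _ (fun a b h => (Prod.mk.inj h).2), Set.ncard_univ]
    simp

/-! ### Fourier analysis of the characteristic distribution -/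

lemma sum_prod_pauli {n : ℕ} (f : Fin n → Bool → Bool → ℂ) :
    ∑ x : Bits n × Bits n, ∏ j, f j (x.1 j) (x.2 j) = ∏ j, ∑ a, ∑ b, f j a b := by
  have h : ∀ j, ∑ a, ∑ b, f j a b = ∑ p : Bool × Bool, f j p.1 p.2 := fun j =>
    (Fintype.sum_prod_type' (f j)).symm
  simp only [h, Finset.prod_univ_sum, Fintype.piFinset_univ]
  exact Fintype.sum_equiv (Equiv.arrowProdEquivProdArrow (Fin n) (fun _ => Bool)
    (fun _ => Bool)).symm _ _ fun x => rfl

/-- The Weyl operators form an orthogonal basis of the space of matrices. -/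
lemma sum_weyl_mul_conj {n : ℕ} (s t s' t' : Bits n) :
    ∑ x, weyl x s t * star (weyl x s' t') = if s = s' ∧ t = t' then 2 ^ n else 0 := by
  simp only [weyl, star_prod, ← Finset.prod_mul_distrib]
  rw [sum_prod_pauli fun j a b => pauli a b (s j) (t j) * star (pauli a b (s' j) (t' j))]
  have h1 : ∀ s t s' t' : Bool, ∑ a, ∑ b, pauli a b s t * star (pauli a b s' t') =
      if s = s' ∧ t = t' then 2 else 0 := by
    intro s t s' t'
    cases s <;> cases t <;> cases s' <;> cases t' <;> simp [pauli] <;> norm_num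
  simp only [h1]
  by_cases h : s = s' ∧ t = t'
  · obtain ⟨rfl, rfl⟩ := h
    simp
  · rw [if_neg h]
    have : ∃ j, ¬ (s j = s' j ∧ t j = t' j) := by
      by_contra hc
      push Not at hc
      exact h ⟨funext fun j => (hc j).1, funext fun j => (hc j).2⟩
    obtain ⟨j, hj⟩ := this
    exact Finset.prod_eq_zero (Finset.mem_univ j) (if_neg hj)

lemma weylExp_eq_sum {n : ℕ} (φ : Vec n) (x : Bits n × Bits n) :
    weylExp φ x = ∑ s, ∑ t, star (φ s) * weyl x s t * φ t := by
  simp only [weylExp, overlap, dotProduct, Matrix.mulVec, Pi.star_apply, Finset.mul_sum,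
    mul_assoc]

/-- The Weyl coefficients of two states determine their overlap. -/
lemma sum_weylExp_mul_conj {n : ℕ} (φ ψ : Vec n) :
    ∑ x, weylExp φ x * star (weylExp ψ x) = ((2 ^ n * ‖overlap φ ψ‖ ^ 2 : ℝ) : ℂ) := by
  have h1 : ∀ x, weylExp φ x * star (weylExp ψ x) = ∑ s, ∑ t, ∑ s', ∑ t',
      (star (φ s') * φ t' * ψ s * star (ψ t)) * (weyl x s' t' * star (weyl x s t)) := by
    intro x
    simp only [weylExp_eq_sum, star_sum, Finset.sum_mul, Finset.mul_sum, star_mul', star_star]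
    refine Finset.sum_congr rfl fun s _ => ?_
    refine Finset.sum_congr rfl fun t _ => ?_
    refine Finset.sum_congr rfl fun s' _ => ?_
    refine Finset.sum_congr rfl fun t' _ => ?_
    ring
  simp only [h1]
  rw [Finset.sum_comm]
  have h2 : ∀ s, ∑ x, ∑ t, ∑ s', ∑ t', (star (φ s') * φ t' * ψ s * star (ψ t)) *
      (weyl x s' t' * star (weyl x s t)) =
      ∑ t, (star (φ s) * ψ s) * (φ t * star (ψ t)) * 2 ^ n := by
    intro s
    rw [Finset.sum_comm]
    refine Finset.sum_congr rfl fun t _ => ?_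
    rw [Finset.sum_comm]
    rw [Finset.sum_eq_single s]
    · rw [Finset.sum_comm, Finset.sum_eq_single t]
      · rw [← Finset.mul_sum, sum_weyl_mul_conj, if_pos ⟨rfl, rfl⟩]; ring
      · intro t' _ ht
        rw [← Finset.mul_sum, sum_weyl_mul_conj, if_neg (fun h => ht h.2), mul_zero]
      · simp
    · intro s' _ hs
      rw [Finset.sum_comm]
      refine Finset.sum_eq_zero fun t' _ => ?_
      rw [← Finset.mul_sum, sum_weyl_mul_conj, if_neg (fun h => hs h.1), mul_zero]
    · simp
  simp only [h2, ← Finset.sum_mul, ← Finset.mul_sum]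
  push_cast
  rw [← Complex.mul_conj']
  have h3 : ∑ s, star (φ s) * ψ s = overlap φ ψ := rfl
  have h4 : ∑ t, φ t * star (ψ t) = star (overlap φ ψ) := by
    simp only [overlap, dotProduct, star_sum, star_mul', Pi.star_apply, star_star]
  rw [h3, h4]
  simp only [Complex.star_def]
  ring

/-- The sign `(-1)^{[x, y]}` with which the Weyl operators `W_x` and `W_y` commute. -/
def commSign {n : ℕ} (x y : Bits n × Bits n) : ℝ :=
  ∏ j, if xor (x.1 j && y.2 j) (x.2 j && y.1 j) then -1 else 1

lemma commSign_comm {n : ℕ} (x y : Bits n × Bits n) : commSign x y = commSign y x := by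
  refine Finset.prod_congr rfl fun j _ => ?_
  cases x.1 j <;> cases x.2 j <;> cases y.1 j <;> cases y.2 j <;> rfl

lemma commSign_add {n : ℕ} (x y z : Bits n × Bits n) :
    commSign x (weylAdd y z) = commSign x y * commSign x z := by
  rw [commSign, commSign, commSign, ← Finset.prod_mul_distrib]
  refine Finset.prod_congr rfl fun j _ => ?_
  have h : ∀ a b c d e f : Bool, (if xor (a && xor d f) (b && xor c e) then (-1 : ℝ) else 1) =
      (if xor (a && d) (b && c) then -1 else 1) * if xor (a && f) (b && e) then -1 else 1 := by
    intro a b c d e f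
    cases a <;> cases b <;> cases c <;> cases d <;> cases e <;> cases f <;> simp
  exact h _ _ _ _ _ _

lemma weyl_mulVec_comm {n : ℕ} (x y : Bits n × Bits n) (v : Vec n) :
    weyl x *ᵥ (weyl y *ᵥ v) = (commSign x y : ℂ) • (weyl y *ᵥ (weyl x *ᵥ v)) := by
  funext s
  simp only [weyl_mulVec, Pi.smul_apply, smul_eq_mul, commSign, Complex.ofReal_prod]
  have h : (fun j => xor (xor (s j) (x.1 j)) (y.1 j)) =
      fun j => xor (xor (s j) (y.1 j)) (x.1 j) := by
    funext j; rw [Bool.xor_assoc, Bool.xor_comm (x.1 j), Bool.xor_assoc]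
  rw [h]
  simp only [← mul_assoc, ← Finset.prod_mul_distrib]
  congr 1
  refine Finset.prod_congr rfl fun j _ => ?_
  cases x.1 j <;> cases x.2 j <;> cases y.1 j <;> cases y.2 j <;> cases s j <;>
    simp [pauliPhase]

lemma overlap_weyl {n : ℕ} (y : Bits n × Bits n) (u v : Vec n) :
    overlap (weyl y *ᵥ u) (weyl y *ᵥ v) = overlap u v := by
  simp only [overlap, dotProduct, Pi.star_apply, weyl_mulVec, star_mul']
  have hinv : Function.Involutive (fun (s : Bits n) (j : Fin n) => xor (s j) (y.1 j)) := by
    intro s; funext j; simp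
  refine Fintype.sum_equiv hinv.toPerm _ _ fun s => ?_
  have h1 : star (∏ j, pauliPhase (y.1 j) (y.2 j) (s j)) *
      ∏ j, pauliPhase (y.1 j) (y.2 j) (s j) = 1 := by
    rw [star_prod, ← Finset.prod_mul_distrib]
    refine Finset.prod_eq_one fun j _ => ?_
    cases y.1 j <;> cases y.2 j <;> cases s j <;> simp [pauliPhase]
  rw [Function.Involutive.coe_toPerm]
  linear_combination (star (u fun j => xor (s j) (y.1 j)) * v fun j => xor (s j) (y.1 j)) * h1

/-- The characteristic distribution is its own symplectic Fourier transform. -/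
lemma sum_commSign_mul {n : ℕ} (ψ : Vec n) (y : Bits n × Bits n) :
    ∑ x, commSign x y * ‖weylExp ψ x‖ ^ 2 = 2 ^ n * ‖weylExp ψ y‖ ^ 2 := by
  have h := sum_weylExp_mul_conj (weyl y *ᵥ ψ) ψ
  have h1 : ∀ x, weylExp (weyl y *ᵥ ψ) x = (commSign x y : ℂ) * weylExp ψ x := by
    intro x
    rw [weylExp, weyl_mulVec_comm, overlap_smul_right, overlap_weyl, weylExp]
  have h2 : ‖overlap (weyl y *ᵥ ψ) ψ‖ = ‖weylExp ψ y‖ := by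
    rw [weylExp, overlap, overlap, Matrix.star_dotProduct, norm_star]
  rw [h2] at h
  have h3 : ∀ x, weylExp (weyl y *ᵥ ψ) x * star (weylExp ψ x) =
      ((commSign x y * ‖weylExp ψ x‖ ^ 2 : ℝ) : ℂ) := by
    intro x
    rw [h1, mul_assoc]
    push_cast
    rw [← Complex.mul_conj']
    rfl
  simp only [h3] at h
  exact_mod_cast h

/-- The Gowers proxy is a sixth moment of Weyl coefficients. The squared Weyl coefficients are their
own symplectic Fourier transform, up to a factor, and this turns the convolution into a product. -/
lemma gowersProxy_eq {n : ℕ} (ψ : Vec n) :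
    gowersProxy ψ = (∑ x, ‖weylExp ψ x‖ ^ 6) / 2 ^ n := by
  have hN : (2 : ℝ) ^ n ≠ 0 := by positivity
  set u : Bits n × Bits n → ℝ := fun x => ‖weylExp ψ x‖ ^ 2 with hu
  have hfour : ∀ y, ∑ x, commSign x y * u x = 2 ^ n * u y := sum_commSign_mul ψ
  have key : ∑ x, ∑ y, u x * u y * (2 ^ n * u (weylAdd x y)) = ∑ c, u c * (2 ^ n * u c) ^ 2 := by
    have h1 : ∀ x y, u x * u y * (2 ^ n * u (weylAdd x y)) =
        ∑ c, u c * ((commSign x c * u x) * (commSign y c * u y)) := by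
      intro x y
      rw [← hfour, Finset.mul_sum]
      refine Finset.sum_congr rfl fun c _ => ?_
      rw [commSign_add, commSign_comm c x, commSign_comm c y]; ring
    simp only [h1]
    have h2 : ∀ x, ∑ y, ∑ c, u c * ((commSign x c * u x) * (commSign y c * u y)) =
        ∑ c, u c * ((commSign x c * u x) * (2 ^ n * u c)) := by
      intro x
      rw [Finset.sum_comm]
      refine Finset.sum_congr rfl fun c _ => ?_
      rw [← Finset.mul_sum, ← Finset.mul_sum, hfour]
    simp only [h2]
    rw [Finset.sum_comm]
    refine Finset.sum_congr rfl fun c _ => ?_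
    rw [← Finset.mul_sum, ← Finset.sum_mul, hfour, sq]
  have h6 : ∀ x, ‖weylExp ψ x‖ ^ 6 = u x ^ 3 := by intro x; simp only [hu]; ring
  simp only [h6]
  have h7 : gowersProxy ψ = (∑ x, ∑ y, u x * u y * (2 ^ n * u (weylAdd x y))) / (2 ^ n) ^ 3 := by
    simp only [gowersProxy, weylDist, charDist, Finset.sum_div, Finset.sum_mul]
    refine Finset.sum_congr rfl fun x _ => Finset.sum_congr rfl fun y _ => ?_
    simp only [hu]; field_simp
  rw [h7, key, Finset.sum_div, Finset.sum_div]
  refine Finset.sum_congr rfl fun c _ => ?_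
  field_simp

lemma sum_norm_weylExp_sq {n : ℕ} {ψ : Vec n} (h : IsState ψ) :
    ∑ x, ‖weylExp ψ x‖ ^ 2 = 2 ^ n := by
  have h1 := sum_weylExp_mul_conj ψ ψ
  have h2 : overlap ψ ψ = 1 := by
    have := nsq_eq_dotProduct ψ
    rw [overlap, ← this, show nsq ψ = 1 from h]; simp
  rw [h2] at h1
  have h3 : ∀ x, weylExp ψ x * star (weylExp ψ x) = ((‖weylExp ψ x‖ ^ 2 : ℝ) : ℂ) := by
    intro x; push_cast; rw [← Complex.mul_conj']; rfl
  simp only [h3] at h1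
  have h4 := Complex.ofReal_injective (by simpa using h1 :
    ((∑ x, ‖weylExp ψ x‖ ^ 2 : ℝ) : ℂ) = ((2 ^ n : ℝ) : ℂ))
  exact h4

/-- The Gowers proxy bounds every stabilizer overlap: `|s⟩⟨s|` is the average of the `±W_x` over
the stabilizer group of `s`, so the claim is Jensen's inequality on that group. -/
lemma overlap_pow_le_gowersProxy {n : ℕ} {s : Vec n} (hs : IsStabilizer s) (ψ : Vec n) :
    (‖overlap s ψ‖ ^ 2) ^ 6 ≤ gowersProxy ψ := by
  classical
  set G : Finset (Bits n × Bits n) := (unsignedStab s).toFinset with hG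
  have hcard : G.card = 2 ^ n := by
    rw [← hs.2, Set.ncard_eq_toFinset_card']
  have hone : ∀ x ∈ G, ‖weylExp s x‖ = 1 := by
    intro x hx
    have : x ∈ unsignedStab s := by simpa [hG] using hx
    rcases this with h | h <;> rw [h] <;> simp
  have hsum := sum_norm_weylExp_sq hs.1
  have hzero : ∀ x, x ∉ G → weylExp s x = 0 := by
    have h1 : ∑ x ∈ G, ‖weylExp s x‖ ^ 2 = 2 ^ n := by
      rw [Finset.sum_congr rfl fun x hx => by rw [hone x hx]]
      simp [hcard]
    have h2 : ∑ x ∈ Gᶜ, ‖weylExp s x‖ ^ 2 = 0 := by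
      have := Finset.sum_add_sum_compl G fun x => ‖weylExp s x‖ ^ 2
      linarith
    intro x hx
    have := (Finset.sum_eq_zero_iff_of_nonneg (fun _ _ => by positivity)).1 h2 x
      (Finset.mem_compl.2 hx)
    simpa using this
  have hle : 2 ^ n * ‖overlap s ψ‖ ^ 2 ≤ ∑ x ∈ G, ‖weylExp ψ x‖ := by
    have h1 := sum_weylExp_mul_conj s ψ
    have h2 : ∑ x, weylExp s x * star (weylExp ψ x) =
        ∑ x ∈ G, weylExp s x * star (weylExp ψ x) := by
      symm
      refine Finset.sum_subset (Finset.subset_univ _) fun x _ hx => ?_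
      rw [hzero x hx, zero_mul]
    rw [h2] at h1
    have h3 : ‖(((2 ^ n * ‖overlap s ψ‖ ^ 2 : ℝ)) : ℂ)‖ = 2 ^ n * ‖overlap s ψ‖ ^ 2 := by
      rw [Complex.norm_real, Real.norm_of_nonneg (by positivity)]
    -- only the elements of the stabilizer group of `s` contribute, each with absolute value `1`
    rw [← h3, ← h1]
    refine (norm_sum_le _ _).trans (Finset.sum_le_sum fun x hx => ?_)
    rw [norm_mul, hone x hx, one_mul, norm_star]
  have hN : (0 : ℝ) < 2 ^ n := by positivity
  rw [gowersProxy_eq]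
  have hJ := Real.pow_arith_mean_le_arith_mean_pow G (fun _ => ((2 : ℝ) ^ n)⁻¹)
    (fun x => ‖weylExp ψ x‖) (fun _ _ => by positivity) (by simp [hcard])
    (fun _ _ => norm_nonneg _) 6
  rw [← Finset.mul_sum, ← Finset.mul_sum] at hJ
  have h1 : ‖overlap s ψ‖ ^ 2 ≤ ((2 : ℝ) ^ n)⁻¹ * ∑ x ∈ G, ‖weylExp ψ x‖ := by
    rw [inv_mul_eq_div, le_div_iff₀ hN]; linarith
  calc (‖overlap s ψ‖ ^ 2) ^ 6 ≤ (((2 : ℝ) ^ n)⁻¹ * ∑ x ∈ G, ‖weylExp ψ x‖) ^ 6 := by gcongr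
    _ ≤ ((2 : ℝ) ^ n)⁻¹ * ∑ x ∈ G, ‖weylExp ψ x‖ ^ 6 := hJ
    _ ≤ (∑ x, ‖weylExp ψ x‖ ^ 6) / 2 ^ n := by
      rw [inv_mul_eq_div]
      gcongr
      exact Finset.subset_univ _

lemma zero_state_isStabilizer (n : ℕ) : IsStabilizer (Pi.single (zeroBits n) 1 : Vec n) := by
  have := StabDesc.isStabilizer (n := n) (fun _ => false)
  have h : StabDesc.state (n := n) (fun _ => false) = Pi.single (zeroBits n) 1 := by
    simp [StabDesc.state, StabDesc.circuit]
  rwa [h] at this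

lemma gowersProxy_nonneg {n : ℕ} (ψ : Vec n) : 0 ≤ gowersProxy ψ := by
  rw [gowersProxy_eq]; positivity

/-- The stabilizer fidelity is at most the sixth root of the Gowers proxy. -/
lemma le_gowersProxy_of_le_stabFidelity {n : ℕ} (ψ : Vec n) {γ : ℝ} (h0 : 0 ≤ γ)
    (h : γ ≤ stabFidelity ψ) : γ ^ 6 ≤ gowersProxy ψ := by
  have h1 : stabFidelity ψ ≤ gowersProxy ψ ^ ((6 : ℝ)⁻¹) := by
    refine csSup_le ⟨_, _, zero_state_isStabilizer n, rfl⟩ ?_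
    rintro r ⟨s, hs, rfl⟩
    rw [Real.le_rpow_inv_iff_of_pos (by positivity) (gowersProxy_nonneg ψ) (by norm_num)]
    have := overlap_pow_le_gowersProxy hs ψ
    exact_mod_cast this
  have h2 := h.trans h1
  rw [Real.le_rpow_inv_iff_of_pos h0 (gowersProxy_nonneg ψ) (by norm_num)] at h2
  exact_mod_cast h2

lemma norm_overlap_sq_le {n : ℕ} (u v : Vec n) : ‖overlap u v‖ ^ 2 ≤ nsq u * nsq v := by
  have h1 : ‖overlap u v‖ ≤ ∑ b, ‖u b‖ * ‖v b‖ := by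
    rw [overlap, dotProduct]
    refine (norm_sum_le _ _).trans (le_of_eq ?_)
    simp
  calc ‖overlap u v‖ ^ 2 ≤ (∑ b, ‖u b‖ * ‖v b‖) ^ 2 := by gcongr
    _ ≤ nsq u * nsq v := Finset.sum_mul_sq_le_sq_mul_sq _ _ _

lemma stabFidelity_le_one {n : ℕ} {ψ : Vec n} (h : IsState ψ) : stabFidelity ψ ≤ 1 := by
  refine csSup_le ⟨_, _, zero_state_isStabilizer n, rfl⟩ ?_
  rintro r ⟨s, hs, rfl⟩
  have := norm_overlap_sq_le s ψ
  rw [show nsq s = 1 from hs.1, show nsq ψ = 1 from h] at this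
  linarith

/-! ### Weakest preconditions of quantum programs -/

/-- The amplitude vectors of a finite set of wires. -/
abbrev State (ι : Type) : Type := (ι → Bool) → ℂ

section Semantics

variable {E κ ι : Type}

/-- Rescaling the state of a branch, and charging additional costs to it. -/
def Conf.act (z : ℂ) (t q m : ℕ) (c : Conf ι) : Conf ι :=
  ⟨z • c.state, c.time + t, c.queries + q, c.calls + m⟩

/-- The meaning of external instructions: linear in the state, and independent of past costs. -/
structure Sem (E ι : Type) where
  run : E → Conf ι → List (Conf ι)
  run_act : ∀ e z t q m c, run e (c.act z t q m) = (run e c).map (Conf.act z t q m)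

lemma Conf.measure_act (i : ι) (r : Bool) (z : ℂ) (t q m : ℕ) (c : Conf ι) :
    (c.act z t q m).measure i r = (c.measure i r).act z t q m := by
  simp only [Conf.measure, Conf.act, Conf.mk.injEq, and_true]
  refine ⟨?_, by omega⟩
  funext b
  simp

lemma loopRun_act (i : ι) (body : Conf ι → List (Conf ι)) (z : ℂ) (t q m : ℕ)
    (hb : ∀ c, body (c.act z t q m) = (body c).map (Conf.act z t q m)) (fuel : ℕ) (c : Conf ι) :
    loopRun i body fuel (c.act z t q m) = (loopRun i body fuel c).map (Conf.act z t q m) := by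
  induction fuel generalizing c with
  | zero => rfl
  | succ fuel ih =>
    simp only [loopRun, Conf.measure_act, hb, List.map_cons, List.flatMap_map, List.map_flatMap, ih]

lemma Prog.run_act (f : κ ↪ ι) (σ : Sem E ι) (fuel : ℕ) (p : Prog E κ) (z : ℂ) (t q m : ℕ)
    (c : Conf ι) :
    p.run f σ.run fuel (c.act z t q m) = (p.run f σ.run fuel c).map (Conf.act z t q m) := by
  induction p generalizing c with
  | skip => simp [Prog.run, Conf.act]; omega
  | gate w G => simp [Prog.run, Conf.act, applyOp_smul]; omega
  | ext e => exact σ.run_act e z t q m c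
  | seq p q ihp ihq =>
    simp only [Prog.run, ihp, List.flatMap_map, List.map_flatMap, ihq]
  | branch i p q ihp ihq =>
    simp only [Prog.run, Conf.measure_act, ihp, ihq, List.map_append]
  | loop i p ih =>
    simp only [Prog.run]
    exact loopRun_act (f i) _ z t q m ih fuel c

/-- A quantitative postcondition: a functional that is quadratic under rescaling of the state, and
antitone in the costs. -/
structure Post (ι : Type) where
  val : Conf ι → ℝ
  nonneg' : ∀ c, 0 ≤ val c
  smul' : ∀ z c, val (c.act z 0 0 0) = ‖z‖ ^ 2 * val c
  anti' : ∀ t q m c, val (c.act 1 t q m) ≤ val c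

instance : CoeFun (Post ι) (fun _ => Conf ι → ℝ) := ⟨Post.val⟩

lemma Post.nonneg (G : Post ι) (c : Conf ι) : 0 ≤ G c := G.nonneg' c

lemma Post.smul (G : Post ι) (z : ℂ) (v : State ι) (t q m : ℕ) :
    G ⟨z • v, t, q, m⟩ = ‖z‖ ^ 2 * G ⟨v, t, q, m⟩ := G.smul' z ⟨v, t, q, m⟩

lemma Post.zero (G : Post ι) (t q m : ℕ) : G ⟨0, t, q, m⟩ = 0 := by
  have := G.smul 0 0 t q m
  simpa using this

lemma Post.anti (G : Post ι) (v : State ι) {t q m t' q' m' : ℕ} (ht : t ≤ t') (hq : q ≤ q')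
    (hm : m ≤ m') : G ⟨v, t', q', m'⟩ ≤ G ⟨v, t, q, m⟩ := by
  have := G.anti' (t' - t) (q' - q) (m' - m) ⟨v, t, q, m⟩
  simp only [Conf.act, one_smul] at this
  rwa [Nat.add_sub_cancel' ht, Nat.add_sub_cancel' hq, Nat.add_sub_cancel' hm] at this

/-- The sum of a postcondition over all branches of a program: the quantum analogue of the weakest
precondition. -/
def wp (σ : Sem E ι) (fuel : ℕ) (p : Prog E ι) (G : Post ι) : Post ι where
  val c := ((p.run (Function.Embedding.refl ι) σ.run fuel c).map G).sum
  nonneg' c := List.sum_nonneg (by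
    intro x hx
    obtain ⟨c', -, rfl⟩ := List.mem_map.1 hx
    exact G.nonneg c')
  smul' z c := by
    rw [Prog.run_act, List.map_map, ← List.sum_map_mul_left]
    congr 1
    exact List.map_congr_left fun c' _ => G.smul' z c'
  anti' t q m c := by
    rw [Prog.run_act, List.map_map]
    exact List.sum_le_sum fun c' _ => G.anti' t q m c'

variable (σ : Sem E ι) (fuel : ℕ)

lemma sum_map_flatMap {α β : Type*} (l : List α) (f : α → List β) (g : β → ℝ) :
    ((l.flatMap f).map g).sum = (l.map fun a => ((f a).map g).sum).sum := by
  induction l with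
  | nil => rfl
  | cons a l ih => simp [List.flatMap_cons, ih]

lemma wp_seq (p q : Prog E ι) (G : Post ι) (c : Conf ι) :
    wp σ fuel (.seq p q) G c = wp σ fuel p (wp σ fuel q G) c :=
  sum_map_flatMap _ _ _

lemma wp_skip (G : Post ι) (v : State ι) (t q m : ℕ) :
    wp σ fuel .skip G ⟨v, t, q, m⟩ = G ⟨v, t + 1, q, m⟩ := by
  simp [wp, Prog.run]

lemma wp_gate {k : ℕ} (w : Fin k ↪ ι) (M : Matrix.unitaryGroup (Bits k) ℂ) (G : Post ι)
    (v : State ι) (t q m : ℕ) :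
    wp σ fuel (.gate w M) G ⟨v, t, q, m⟩ =
      G ⟨applyOp w (M : Matrix (Bits k) (Bits k) ℂ) v, t + 4 ^ k, q, m⟩ := by
  simp only [wp, Prog.run, List.map_cons, List.map_nil, List.sum_cons, List.sum_nil, add_zero]
  rfl

/-- The projection of a vector to the outcome `r` of the wire `i`. -/
def projWire (i : ι) (r : Bool) (v : State ι) : State ι := fun b => if b i = r then v b else 0

lemma wp_branch (i : ι) (p q : Prog E ι) (G : Post ι) (v : State ι) (t n m : ℕ) :
    wp σ fuel (.branch i p q) G ⟨v, t, n, m⟩ =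
      wp σ fuel p G ⟨projWire i true v, t + 1, n, m⟩ +
        wp σ fuel q G ⟨projWire i false v, t + 1, n, m⟩ := by
  simp only [wp, Prog.run, List.map_append, List.sum_append]
  rfl

/-- All vectors in the support of `v` satisfy `P`. -/
def SuppOn (v : State ι) (P : (ι → Bool) → Prop) : Prop := ∀ b, v b ≠ 0 → P b

lemma projWire_of_suppOn {i : ι} {r : Bool} {v : State ι} (h : SuppOn v fun b => b i = r) :
    projWire i r v = v := by
  funext b
  by_cases hb : v b = 0
  · simp [projWire, hb]
  · simp [projWire, h b hb]

lemma projWire_of_suppOn_ne {i : ι} {r r' : Bool} {v : State ι} (h : SuppOn v fun b => b i = r)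
    (hr : r ≠ r') : projWire i r' v = 0 := by
  funext b
  by_cases hb : v b = 0
  · simp [projWire, hb]
  · simp [projWire, h b hb, hr]

lemma wp_branch_true {i : ι} (p q : Prog E ι) (G : Post ι) {v : State ι} (t n m : ℕ)
    (h : SuppOn v fun b => b i = true) :
    wp σ fuel (.branch i p q) G ⟨v, t, n, m⟩ = wp σ fuel p G ⟨v, t + 1, n, m⟩ := by
  rw [wp_branch, projWire_of_suppOn h, projWire_of_suppOn_ne h (by simp), Post.zero, add_zero]

lemma wp_branch_false {i : ι} (p q : Prog E ι) (G : Post ι) {v : State ι} (t n m : ℕ)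
    (h : SuppOn v fun b => b i = false) :
    wp σ fuel (.branch i p q) G ⟨v, t, n, m⟩ = wp σ fuel q G ⟨v, t + 1, n, m⟩ := by
  rw [wp_branch, projWire_of_suppOn h, projWire_of_suppOn_ne h (by simp), Post.zero, zero_add]

/-- Sequential composition of a list of programs. -/
def Prog.seqs : List (Prog E ι) → Prog E ι
  | [] => .skip
  | p :: ps => .seq p (Prog.seqs ps)

lemma Prog.size_seqs (l : List (Prog E ι)) :
    (Prog.seqs l).size = (l.map Prog.size).sum + 1 := by
  induction l with
  | nil => rfl
  | cons p l ih => simp [Prog.seqs, Prog.size, ih, add_assoc]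

/-- The program acts without branching, by the linear map `L`, at the given costs. -/
def Lin (p : Prog E ι) (L : State ι →ₗ[ℂ] State ι) (t q : ℕ) : Prop :=
  ∀ (G : Post ι) (v : State ι) (t' q' m : ℕ),
    wp σ fuel p G ⟨v, t', q', m⟩ = G ⟨L v, t' + t, q' + q, m⟩

variable {σ fuel}

lemma Lin.skip : Lin σ fuel (.skip : Prog E ι) LinearMap.id 1 0 := fun G v t q m => by
  rw [wp_skip]; rfl

lemma Lin.gate {k : ℕ} (w : Fin k ↪ ι) (M : Matrix.unitaryGroup (Bits k) ℂ) :
    Lin σ fuel (.gate w M) (applyOpₗ w (M : Matrix (Bits k) (Bits k) ℂ)) (4 ^ k) 0 :=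
  fun G v t q m => by rw [wp_gate]; rfl

lemma Lin.seq {p q : Prog E ι} {L L' : State ι →ₗ[ℂ] State ι} {t t' n n' : ℕ}
    (hp : Lin σ fuel p L t n) (hq : Lin σ fuel q L' t' n') :
    Lin σ fuel (.seq p q) (L' ∘ₗ L) (t + t') (n + n') := fun G v s r m => by
  rw [wp_seq, hp, hq, add_assoc, add_assoc]; rfl

end Semantics

/-! ### Vectors on registers -/

section Fill

variable {κ κ' ι : Type}

lemma extend_apply_of_ne (w : κ ↪ ι) (a : κ → Bool) (b : ι → Bool) {i : ι}
    (h : ∀ j, w j ≠ i) : Function.extend w a b i = b i :=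
  Function.extend_apply' _ _ _ fun ⟨j, hj⟩ => h j hj

lemma extend_comm (w : κ ↪ ι) (w' : κ' ↪ ι) (h : ∀ i j, w i ≠ w' j) (a : κ → Bool)
    (a' : κ' → Bool) (b : ι → Bool) :
    Function.extend w a (Function.extend w' a' b) =
      Function.extend w' a' (Function.extend w a b) := by
  funext i
  by_cases h1 : ∃ j, w j = i
  · obtain ⟨j, rfl⟩ := h1
    rw [w.injective.extend_apply, extend_apply_of_ne w' _ _ fun l => (h j l).symm,
      w.injective.extend_apply]
  · have h1' : ∀ j, w j ≠ i := fun j hj => h1 ⟨j, hj⟩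
    rw [extend_apply_of_ne w _ _ h1']
    by_cases h2 : ∃ j, w' j = i
    · obtain ⟨j, rfl⟩ := h2
      rw [w'.injective.extend_apply, w'.injective.extend_apply]
    · have h2' : ∀ j, w' j ≠ i := fun j hj => h2 ⟨j, hj⟩
      rw [extend_apply_of_ne w' _ _ h2', extend_apply_of_ne w' _ _ h2',
        extend_apply_of_ne w _ _ h1']

/-- The vector `u` on the register `w`, tensored with the part of `v` in which `w` is zero. -/
def fill (w : κ ↪ ι) (u : State κ) (v : State ι) : State ι :=
  fun b => u (fun j => b (w j)) * v (Function.extend w (fun _ => false) b)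

lemma fill_apply (w : κ ↪ ι) (u : State κ) (v : State ι) (b : ι → Bool) :
    fill w u v b = u (fun j => b (w j)) * v (Function.extend w (fun _ => false) b) := rfl

lemma fill_smul_left (w : κ ↪ ι) (z : ℂ) (u : State κ) (v : State ι) :
    fill w (z • u) v = z • fill w u v := by
  funext b; simp [fill, mul_assoc]

lemma fill_smul_right (w : κ ↪ ι) (z : ℂ) (u : State κ) (v : State ι) :
    fill w u (z • v) = z • fill w u v := by
  funext b; simp only [fill, Pi.smul_apply, smul_eq_mul]; ring

lemma fill_sum_left {α : Type*} (s : Finset α) (w : κ ↪ ι) (u : α → State κ) (v : State ι) :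
    fill w (∑ i ∈ s, u i) v = ∑ i ∈ s, fill w (u i) v := by
  funext b; simp [fill, Finset.sum_mul, Finset.sum_apply]

lemma fill_sum_right {α : Type*} (s : Finset α) (w : κ ↪ ι) (u : State κ) (v : α → State ι) :
    fill w u (∑ i ∈ s, v i) = ∑ i ∈ s, fill w u (v i) := by
  funext b; simp [fill, Finset.mul_sum, Finset.sum_apply]

lemma fill_comm (w : κ ↪ ι) (w' : κ' ↪ ι) (h : ∀ i j, w i ≠ w' j) (u : State κ)
    (u' : State κ') (v : State ι) : fill w u (fill w' u' v) = fill w' u' (fill w u v) := by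
  funext b
  simp only [fill, extend_comm w' w (fun i j => (h j i).symm)]
  have h1 : (fun j => Function.extend w (fun _ => false) b (w' j)) = fun j => b (w' j) := by
    funext j; exact extend_apply_of_ne w _ _ fun l => h l j
  have h2 : (fun j => Function.extend w' (fun _ => false) b (w j)) = fun j => b (w j) := by
    funext j; exact extend_apply_of_ne w' _ _ fun l => (h j l).symm
  rw [h1, h2]; ring

lemma applyOp_fill {k : ℕ} (l : Fin k ↪ κ) (w : κ ↪ ι) (M : Matrix (Bits k) (Bits k) ℂ)
    (u : State κ) (v : State ι) :
    applyOp (l.trans w) M (fill w u v) = fill w (applyOp l M u) v := by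
  funext b
  simp only [applyOp, fill, Finset.sum_mul]
  refine Finset.sum_congr rfl fun a _ => ?_
  have h1 : (fun j => Function.extend (l.trans w) a b (w j)) =
      Function.extend l a fun j => b (w j) := by
    funext j
    by_cases h : ∃ i, l i = j
    · obtain ⟨i, rfl⟩ := h
      rw [l.injective.extend_apply]
      exact (l.trans w).injective.extend_apply a b i
    · rw [Function.extend_apply' _ _ _ h, Function.extend_apply']
      rintro ⟨i, hi⟩
      exact h ⟨i, w.injective hi⟩
  have h2 : Function.extend w (fun _ => false) (Function.extend (l.trans w) a b) =
      Function.extend w (fun _ => false) b := by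
    funext i
    by_cases h : ∃ j, w j = i
    · obtain ⟨j, rfl⟩ := h
      rw [w.injective.extend_apply, w.injective.extend_apply]
    · rw [Function.extend_apply' _ _ _ h, Function.extend_apply' _ _ _ h,
        Function.extend_apply']
      rintro ⟨j, hj⟩
      exact h ⟨l j, hj⟩
  rw [h1, h2]
  simp only [Function.Embedding.trans_apply, mul_assoc]

lemma applyOp_refl {k : ℕ} (M : Matrix (Bits k) (Bits k) ℂ) (u : State (Fin k)) :
    applyOp (Function.Embedding.refl _) M u = M *ᵥ u := by
  funext s
  simp only [applyOp, Matrix.mulVec, dotProduct]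
  refine Finset.sum_congr rfl fun a _ => ?_
  congr 2
  exact extend_comp (Function.Embedding.refl (Fin k)) a s

lemma applyOp_fill_self {k : ℕ} (w : Fin k ↪ ι) (M : Matrix (Bits k) (Bits k) ℂ)
    (u : State (Fin k)) (v : State ι) : applyOp w M (fill w u v) = fill w (M *ᵥ u) v := by
  have h := applyOp_fill (Function.Embedding.refl _) w M u v
  rwa [Function.Embedding.refl_trans, applyOp_refl] at h

lemma applyOp_fill_disjoint {k : ℕ} (l : Fin k ↪ ι) (w : κ ↪ ι) (h : ∀ i j, l i ≠ w j)
    (M : Matrix (Bits k) (Bits k) ℂ) (u : State κ) (v : State ι) :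
    applyOp l M (fill w u v) = fill w u (applyOp l M v) := by
  funext b
  simp only [applyOp, fill, Finset.mul_sum]
  refine Finset.sum_congr rfl fun a _ => ?_
  have h1 : (fun j => Function.extend l a b (w j)) = fun j => b (w j) := by
    funext j; exact extend_apply_of_ne l _ _ fun i => h i j
  have h2 : (fun j => Function.extend w (fun _ => false) b (l j)) = fun j => b (l j) := by
    funext j; exact extend_apply_of_ne w _ _ fun i => (h j i).symm
  rw [h1, h2, extend_comm w l fun i j => (h j i).symm]
  ring

lemma projWire_fill (j : κ) (r : Bool) (w : κ ↪ ι) (u : State κ) (v : State ι) :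
    projWire (w j) r (fill w u v) = fill w (projWire j r u) v := by
  funext b
  simp only [projWire, fill, ite_mul, zero_mul]

section Single

variable [Fintype κ]

/-- The basis vector `|s⟩` of a register. -/
def ket (s : κ → Bool) : State κ := Pi.single s 1

lemma ket_apply (s t : κ → Bool) : ket s t = if t = s then 1 else 0 := by
  simp [ket, Pi.single_apply]

lemma fill_ket_zero (w : κ ↪ ι) (v : State ι) (h : SuppOn v fun b => ∀ j, b (w j) = false) :
    fill w (ket fun _ => false) v = v := by
  funext b
  rw [fill, ket_apply]
  split_ifs with h1
  · have h2 : Function.extend w (fun _ => false) b = b := by rw [← h1, extend_self]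
    rw [h2, one_mul]
  · by_cases h2 : v b = 0
    · rw [h2, zero_mul]
    · exact absurd (funext (h b h2)) h1

lemma suppOn_fill_ket (w : κ ↪ ι) (s : κ → Bool) (v : State ι) :
    SuppOn (fill w (ket s) v) fun b => ∀ j, b (w j) = s j := by
  intro b hb j
  rw [fill, ket_apply] at hb
  split_ifs at hb with h
  · exact congrFun h j
  · simp at hb

variable [DecidableEq κ]

lemma sum_smul_ket (u : State κ) : ∑ s, u s • ket s = u := by
  funext t
  simp only [Finset.sum_apply, Pi.smul_apply, ket_apply, smul_eq_mul, mul_ite, mul_one, mul_zero]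
  rw [Finset.sum_ite_eq]; simp

lemma fill_eq_sum (w : κ ↪ ι) (u : State κ) (v : State ι) :
    fill w u v = ∑ s, u s • fill w (ket s) v := by
  conv_lhs => rw [← sum_smul_ket u]
  rw [fill_sum_left]
  simp only [fill_smul_left]

lemma nsq_ket (s : κ → Bool) : nsq (ket s) = 1 := by
  rw [nsq, Finset.sum_eq_single s]
  · simp [ket_apply]
  · intro t _ ht; simp [ket_apply, ht]
  · simp

end Single

lemma SuppOn.fill {w : κ ↪ ι} {u : State κ} {v : State ι} {P : (ι → Bool) → Prop}
    (h : SuppOn v P) (hP : ∀ b, P (Function.extend w (fun _ => false) b) → P b) :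
    SuppOn (fill w u v) P := by
  intro b hb
  exact hP b (h _ (right_ne_zero_of_mul hb))

lemma SuppOn.fill_disjoint {w : κ ↪ ι} {u : State κ} {v : State ι} {i : ι} {r : Bool}
    (h : SuppOn v fun b => b i = r) (hi : ∀ j, w j ≠ i) :
    SuppOn (StabDecomp.fill w u v) fun b => b i = r :=
  h.fill fun b hb => by rwa [extend_apply_of_ne w _ _ hi] at hb

lemma SuppOn.applyOp_disjoint {k : ℕ} {l : Fin k ↪ ι} {M : Matrix (Bits k) (Bits k) ℂ}
    {v : State ι} {i : ι} {r : Bool} (h : SuppOn v fun b => b i = r) (hi : ∀ j, l j ≠ i) :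
    SuppOn (applyOp l M v) fun b => b i = r := by
  intro b hb
  by_contra hcon
  apply hb
  refine Finset.sum_eq_zero fun a _ => ?_
  have : v (Function.extend l a b) = 0 := by
    by_contra h0
    have h1 := h _ h0
    exact hcon ((extend_apply_of_ne l a b hi).symm.trans h1)
  rw [this, mul_zero]

lemma SuppOn.mono {v : State ι} {P Q : (ι → Bool) → Prop} (hP : SuppOn v P)
    (h : ∀ b, P b → Q b) : SuppOn v Q := fun b hb => h b (hP b hb)

end Fill

/-! ### Multiplexed gates -/

section Mux

variable {ι : Type} {a b k : ℕ}

/-- Splitting bit strings into a target and a control part. -/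
def splitBits (φ : Fin a ⊕ Fin b ≃ Fin k) : Bits k ≃ Bits b × Bits a :=
  ((Equiv.arrowCongr φ.symm (Equiv.refl Bool)).trans
    (Equiv.sumArrowEquivProdArrow (Fin a) (Fin b) Bool)).trans (Equiv.prodComm _ _)

lemma splitBits_apply (φ : Fin a ⊕ Fin b ≃ Fin k) (s : Bits k) :
    splitBits φ s = (fun j => s (φ (.inr j)), fun i => s (φ (.inl i))) := rfl

/-- The unitary that applies `V x` to the target bits if the control bits have the value `x`. -/
def mux (φ : Fin a ⊕ Fin b ≃ Fin k) (V : Bits a → Matrix.unitaryGroup (Bits b) ℂ) :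
    Matrix.unitaryGroup (Bits k) ℂ :=
  ⟨(Matrix.blockDiagonal fun x => (V x : Matrix (Bits b) (Bits b) ℂ)).submatrix
      (splitBits φ) (splitBits φ), by
    rw [Matrix.mem_unitaryGroup_iff', Matrix.star_eq_conjTranspose,
      Matrix.conjTranspose_submatrix, Matrix.submatrix_mul_equiv,
      Matrix.blockDiagonal_conjTranspose, ← Matrix.blockDiagonal_mul]
    have : (fun x => (V x : Matrix (Bits b) (Bits b) ℂ)ᴴ * (V x : Matrix (Bits b) (Bits b) ℂ)) =
        1 := by
      funext x
      exact Matrix.mem_unitaryGroup_iff'.1 (V x).2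
    rw [this, Matrix.blockDiagonal_one, Matrix.submatrix_one_equiv]⟩

lemma mux_apply (φ : Fin a ⊕ Fin b ≃ Fin k) (V : Bits a → Matrix.unitaryGroup (Bits b) ℂ)
    (s t : Bits k) : (mux φ V : Matrix (Bits k) (Bits k) ℂ) s t =
      if (fun i => s (φ (.inl i))) = (fun i => t (φ (.inl i))) then
        (V fun i => s (φ (.inl i)) : Matrix (Bits b) (Bits b) ℂ)
          (fun j => s (φ (.inr j))) (fun j => t (φ (.inr j))) else 0 := by
  simp only [mux, Matrix.submatrix_apply, Matrix.blockDiagonal_apply, splitBits_apply]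

/-- On vectors with classical control bits, a multiplexed gate is the selected gate. -/
lemma applyOp_mux (φ : Fin a ⊕ Fin b ≃ Fin k) (V : Bits a → Matrix.unitaryGroup (Bits b) ℂ)
    (w : Fin k ↪ ι) (tw : Fin b ↪ ι) (ht : ∀ j, w (φ (.inr j)) = tw j) (x : Bits a)
    (f : State ι) (hf : SuppOn f fun c => ∀ i, c (w (φ (.inl i))) = x i) :
    applyOp w (mux φ V : Matrix (Bits k) (Bits k) ℂ) f =
      applyOp tw (V x : Matrix (Bits b) (Bits b) ℂ) f := by
  have hne : ∀ i j, tw j ≠ w (φ (.inl i)) := by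
    intro i j h
    rw [← ht] at h
    simpa using φ.injective (w.injective h)
  funext c
  simp only [applyOp, mux_apply]
  rw [← (splitBits φ).symm.sum_comp, Fintype.sum_prod_type, Finset.sum_congr rfl]
  intro y _
  by_cases hc : (fun i => c (w (φ (.inl i)))) = x
  · rw [Finset.sum_eq_single x]
    · have h1 : splitBits φ ((splitBits φ).symm (y, x)) = (y, x) := Equiv.apply_symm_apply _ _
      rw [splitBits_apply, Prod.mk.injEq] at h1
      rw [h1.1, h1.2, if_pos hc, hc]
      simp only [ht]
      congr 2
      funext i
      by_cases h : ∃ j, w j = i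
      · obtain ⟨j, rfl⟩ := h
        rw [w.injective.extend_apply]
        obtain ⟨j, rfl⟩ := φ.surjective j
        rcases j with j | j
        · rw [extend_apply_of_ne tw _ _ fun l => hne j l]
          rw [congrFun h1.2 j, ← hc]
        · rw [congrFun h1.1 j, ht, tw.injective.extend_apply]
      · have h' : ∀ j, w j ≠ i := fun j hj => h ⟨j, hj⟩
        rw [extend_apply_of_ne w _ _ h', extend_apply_of_ne tw _ _ fun j => by
          rw [← ht]; exact h' _]
    · intro x' _ hx'
      have h1 : splitBits φ ((splitBits φ).symm (y, x')) = (y, x') := Equiv.apply_symm_apply _ _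
      rw [splitBits_apply, Prod.mk.injEq] at h1
      rw [h1.2, if_neg, zero_mul]
      rw [hc]
      exact Ne.symm hx'
    · simp
  · have h0 : f (Function.extend tw y c) = 0 := by
      by_contra h0
      apply hc
      funext i
      rw [← hf _ h0 i, extend_apply_of_ne tw _ _ fun l => hne i l]
    rw [h0, mul_zero]
    refine Finset.sum_eq_zero fun x' _ => ?_
    have h1 : splitBits φ ((splitBits φ).symm (y, x')) = (y, x') := Equiv.apply_symm_apply _ _
    rw [splitBits_apply, Prod.mk.injEq] at h1
    rw [h1.2]
    split_ifs with h2
    · have h3 : f (Function.extend w ((splitBits φ).symm (y, x')) c) = 0 := by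
        by_contra h3
        apply hc
        funext i
        rw [congrFun h2 i, ← hf _ h3 i, w.injective.extend_apply, congrFun h1.2 i]
      rw [h3, mul_zero]
    · rw [zero_mul]

/-- The union of two disjoint registers. -/
def joint (c : Fin a ↪ ι) (t : Fin b ↪ ι) (h : ∀ i j, c i ≠ t j) : Fin (a + b) ↪ ι :=
  finSumFinEquiv.symm.toEmbedding.trans
    ⟨Sum.elim c t, c.injective.sumElim t.injective h⟩

lemma joint_inl (c : Fin a ↪ ι) (t : Fin b ↪ ι) (h : ∀ i j, c i ≠ t j) (i : Fin a) :
    joint c t h (finSumFinEquiv (.inl i)) = c i := by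
  simp [joint]

lemma joint_inr (c : Fin a ↪ ι) (t : Fin b ↪ ι) (h : ∀ i j, c i ≠ t j) (j : Fin b) :
    joint c t h (finSumFinEquiv (.inr j)) = t j := by
  simp [joint]

lemma applyOp_mux_joint (c : Fin a ↪ ι) (t : Fin b ↪ ι) (h : ∀ i j, c i ≠ t j)
    (V : Bits a → Matrix.unitaryGroup (Bits b) ℂ) (r : ι → Bool) (f : State ι)
    (hf : SuppOn f fun b' => ∀ i, b' (c i) = r (c i)) :
    applyOp (joint c t h) (mux finSumFinEquiv V : Matrix (Bits (a + b)) (Bits (a + b)) ℂ) f =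
      applyOp t (V fun i => r (c i) : Matrix (Bits b) (Bits b) ℂ) f := by
  refine applyOp_mux _ _ _ _ (joint_inr c t h) _ _ ?_
  simp only [joint_inl]
  exact hf

/-- Control wires in front, in the convention of `controlled`. -/
def ctrlEquiv (n : ℕ) : Fin 1 ⊕ Fin n ≃ Fin (n + 1) :=
  finSumFinEquiv.trans (finCongr (Nat.add_comm 1 n))

lemma ctrlEquiv_inl (n : ℕ) (i : Fin 1) : ctrlEquiv n (.inl i) = 0 := by
  ext; simp [ctrlEquiv]

lemma ctrlEquiv_inr (n : ℕ) (j : Fin n) : ctrlEquiv n (.inr j) = j.succ := by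
  ext; simp [ctrlEquiv]

lemma controlled_eq_mux {n : ℕ} (U : Matrix.unitaryGroup (Bits n) ℂ) :
    controlled (U : Matrix (Bits n) (Bits n) ℂ) =
      (mux (ctrlEquiv n) (fun x => if x 0 then U else 1) :
        Matrix (Bits (n + 1)) (Bits (n + 1)) ℂ) := by
  ext s t
  rw [mux_apply]
  simp only [controlled, ctrlEquiv_inl, ctrlEquiv_inr]
  have h1 : ((fun _ : Fin 1 => s 0) = fun _ => t 0) ↔ s 0 = t 0 :=
    ⟨fun h => congrFun h 0, fun h => by rw [h]⟩
  simp only [h1]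
  have h5 : ((fun j : Fin n => s j.succ) = fun j => t j.succ) ↔ Fin.tail s = Fin.tail t := Iff.rfl
  split_ifs with h2 h3 h4
  · rfl
  · change _ = (1 : Matrix (Bits n) (Bits n) ℂ) _ _
    rw [Matrix.one_apply, if_pos (h5.2 h4)]
  · change _ = (1 : Matrix (Bits n) (Bits n) ℂ) _ _
    rw [Matrix.one_apply, if_neg fun h => h4 (h5.1 h)]
  · rfl

/-- Adding a control wire in front of a register. -/
def consWire {n : ℕ} (c : ι) (t : Fin n ↪ ι) (h : ∀ j, c ≠ t j) : Fin (n + 1) ↪ ι :=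
  ⟨Fin.cons c t, Fin.cons_injective_iff.2 ⟨by rintro ⟨j, hj⟩; exact h j hj.symm, t.injective⟩⟩

lemma applyOp_controlled {n : ℕ} (c : ι) (t : Fin n ↪ ι) (h : ∀ j, c ≠ t j)
    (U : Matrix.unitaryGroup (Bits n) ℂ) (x : Bool) (f : State ι)
    (hf : SuppOn f fun b => b c = x) :
    applyOp (consWire c t h) (controlled (U : Matrix (Bits n) (Bits n) ℂ)) f =
      if x then applyOp t (U : Matrix (Bits n) (Bits n) ℂ) f else f := by
  rw [controlled_eq_mux, applyOp_mux (tw := t) (x := fun _ => x)]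
  · cases x
    · simp only [Bool.false_eq_true, if_false]
      exact applyOp_one t f
    · simp
  · intro j; rw [ctrlEquiv_inr]; rfl
  · intro b hb i; rw [ctrlEquiv_inl]; exact hf b hb

/-- Every unit vector is the first column of a unitary matrix. -/
lemma exists_unitary_column {m : ℕ} (u : State (Fin m)) (hu : nsq u = 1) :
    ∃ G : Matrix.unitaryGroup (Bits m) ℂ,
      ∀ y, (G : Matrix (Bits m) (Bits m) ℂ) y (zeroBits m) = u y := by
  let v : Bits m → EuclideanSpace ℂ (Bits m) := fun _ => WithLp.toLp 2 u
  have hv : Orthonormal ℂ (({zeroBits m} : Set (Bits m)).domRestrict v) := by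
    rw [orthonormal_iff_ite]
    intro i j
    have hij : i = j := Subsingleton.elim i j
    rw [if_pos hij]
    change inner ℂ (WithLp.toLp 2 u : EuclideanSpace ℂ (Bits m)) (WithLp.toLp 2 u) = 1
    rw [EuclideanSpace.inner_toLp_toLp, dotProduct_comm, ← nsq_eq_dotProduct, hu]; simp
  obtain ⟨b, hb⟩ := hv.exists_orthonormalBasis_extension_of_card_eq (by simp)
  refine ⟨⟨_, OrthonormalBasis.toMatrix_orthonormalBasis_mem_unitary
    (EuclideanSpace.basisFun (Bits m) ℂ) b⟩, fun y => ?_⟩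
  simp only [Module.Basis.toMatrix_apply]
  rw [hb (zeroBits m) rfl]
  simp [v]

end Mux

/-! ### Measuring and resetting registers -/

section Measure

variable {E κ ι : Type} (σ : Sem E ι) (fuel : ℕ)

/-- The measurement of a list of wires. -/
def measAll (l : List ι) : Prog E ι := .seqs (l.map fun i => .branch i .skip .skip)

/-- The projection of a vector to the outcome `y` of the register `w`. -/
def projReg [Fintype κ] (w : κ ↪ ι) (y : κ → Bool) (f : State ι) : State ι :=
  fun b => if (fun j => b (w j)) = y then f b else 0

lemma SuppOn.projWire {f : State ι} {P : (ι → Bool) → Prop} (h : SuppOn f P) (i : ι) (r : Bool) :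
    SuppOn (projWire i r f) fun b => P b ∧ b i = r := by
  intro b hb
  simp only [StabDecomp.projWire] at hb
  split_ifs at hb with h1
  · exact ⟨h b hb, h1⟩
  · exact absurd rfl hb

lemma size_measAll (l : List ι) : (measAll l : Prog E ι).size = 3 * l.length + 1 := by
  rw [measAll, Prog.size_seqs, List.map_map]
  have : (Prog.size ∘ fun i => (Prog.branch i .skip .skip : Prog E ι)) = fun _ => 3 := by
    funext i; simp [Prog.size]
  rw [this]; simp [mul_comm]

/-- Measuring a register branches over its values. Outcomes of norm zero contribute nothing to
either side. The wires of the register that are not measured must have known values `s`. -/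
lemma sum_projReg_le_wp_measAll [Fintype κ] [DecidableEq κ] (w : κ ↪ ι) (G : Post ι)
    (l : List κ) (f : State ι) (s : κ → Bool) (t q m : ℕ)
    (h : ∀ j, j ∉ l → SuppOn f fun b => b (w j) = s j) :
    ∑ y, G ⟨projReg w y f, t + (3 * l.length + 1), q, m⟩ ≤
      wp σ fuel (measAll (l.map w)) G ⟨f, t, q, m⟩ := by
  induction l generalizing f s t with
  | nil =>
    simp only [measAll, List.map_nil, Prog.seqs, wp_skip, List.length_nil]
    rw [Finset.sum_eq_single s]
    · have : projReg w s f = f := by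
        funext b
        by_cases hb : f b = 0
        · simp [projReg, hb]
        · rw [projReg, if_pos]
          funext j
          exact h j (by simp) b hb
      rw [this]
    · intro y _ hy
      have : projReg w y f = 0 := by
        funext b
        by_cases hb : f b = 0
        · simp [projReg, hb]
        · rw [projReg, if_neg]; rfl
          intro h1
          apply hy
          rw [← h1]
          funext j
          exact h j (by simp) b hb
      rw [this, Post.zero]
    · simp
  | cons i l ih =>
    have key : ∀ r, ∑ y, G ⟨projReg w y (projWire (w i) r f), t + 2 + (3 * l.length + 1), q, m⟩ ≤
        wp σ fuel (measAll (l.map w)) G ⟨projWire (w i) r f, t + 2, q, m⟩ := by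
      intro r
      refine ih _ (Function.update s i r) _ fun j hj => ?_
      by_cases hji : j = i
      · subst hji
        have := SuppOn.projWire (f := f) (P := fun _ => True) (fun _ _ => trivial) (w j) r
        exact this.mono fun b hb => by simpa using hb
      · rw [Function.update_of_ne hji]
        exact ((h j (by simp [hji, hj])).projWire (w i) r).mono fun b hb => hb.1
    have hsplit : wp σ fuel (measAll ((i :: l).map w)) G ⟨f, t, q, m⟩ =
        wp σ fuel (measAll (l.map w)) G ⟨projWire (w i) true f, t + 2, q, m⟩ +
          wp σ fuel (measAll (l.map w)) G ⟨projWire (w i) false f, t + 2, q, m⟩ := by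
      rw [measAll, List.map_cons, List.map_cons, Prog.seqs, wp_seq, wp_branch, wp_skip, wp_skip]
      rfl
    rw [hsplit]
    refine le_trans ?_ (add_le_add (key true) (key false))
    rw [← Finset.sum_add_distrib]
    refine Finset.sum_le_sum fun y _ => ?_
    have hy : projReg w y (projWire (w i) (y i) f) = projReg w y f := by
      funext b
      simp only [projReg, projWire]
      split_ifs with h1 h2
      · rfl
      · exact absurd (congrFun h1 i) h2
      · rfl
    have ht : t + 2 + (3 * l.length + 1) ≤ t + (3 * (i :: l).length + 1) := by
      rw [List.length_cons]; omega
    cases hyi : y i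
    · rw [hyi] at hy
      rw [hy]
      exact (G.anti _ ht le_rfl le_rfl).trans (le_add_of_nonneg_left (G.nonneg _))
    · rw [hyi] at hy
      rw [hy]
      exact (G.anti _ ht le_rfl le_rfl).trans (le_add_of_nonneg_right (G.nonneg _))

/-- The negation of a bit. -/
def notU : Matrix.unitaryGroup (Bits 1) ℂ :=
  permU (Function.Involutive.toPerm (fun b j => !(b j)) (fun b => by funext j; simp))

lemma applyOp_notU [DecidableEq ι] (i : ι) (f : State ι) (b : ι → Bool) :
    applyOp (wire1 i) (notU : Matrix (Bits 1) (Bits 1) ℂ) f b =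
      f (Function.update b i (!(b i))) := by
  rw [notU, applyOp_permU, extend_wire1]; rfl

/-- Measuring each wire of a list and flipping it if it is `1`. -/
def resetAll (l : List ι) : Prog E ι :=
  .seqs (l.map fun i => .branch i (.gate (wire1 i) notU) .skip)

lemma size_resetAll (l : List ι) : (resetAll l : Prog E ι).size = 6 * l.length + 1 := by
  rw [resetAll, Prog.size_seqs, List.map_map]
  have : (Prog.size ∘ fun i => (Prog.branch i (.gate (wire1 i) notU) .skip : Prog E ι)) =
      fun _ => 6 := by
    funext i; simp [Prog.size]
  rw [this]; simp [mul_comm]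

lemma wire1_trans (w : κ ↪ ι) (j : κ) : (wire1 j).trans w = wire1 (w j) := by
  ext; rfl

lemma nsq_projWire [Fintype κ] [DecidableEq κ] (j : κ) (u : State κ) :
    nsq (projWire j true u) + nsq (projWire j false u) = nsq u := by
  simp only [nsq, ← Finset.sum_add_distrib]
  refine Finset.sum_congr rfl fun s _ => ?_
  simp only [projWire]
  cases s j <;> simp

/-- Resetting a register restores the background, with all of the norm. -/
lemma nsq_mul_le_wp_resetAll [Fintype κ] [DecidableEq κ] (w : κ ↪ ι) (G : Post ι) (l : List κ)
    (u : State κ) (v : State ι) (t q m : ℕ) (hv : SuppOn v fun b => ∀ j, b (w j) = false)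
    (hu : ∀ j, j ∉ l → SuppOn u fun s => s j = false) :
    nsq u * G ⟨v, t + (6 * l.length + 1), q, m⟩ ≤
      wp σ fuel (resetAll (l.map w)) G ⟨fill w u v, t, q, m⟩ := by
  induction l generalizing u t with
  | nil =>
    simp only [resetAll, List.map_nil, Prog.seqs, wp_skip, List.length_nil]
    have h1 : u = u (fun _ => false) • ket fun _ => false := by
      funext s
      rw [Pi.smul_apply, ket_apply]
      split_ifs with hs
      · rw [hs]; simp
      · simp only [smul_zero]
        by_contra h0
        exact hs (funext fun j => hu j (by simp) s h0)
    rw [h1, nsq_smul, nsq_ket, fill_smul_left, G.smul, fill_ket_zero w v hv]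
    simp
  | cons i l ih =>
    have hsplit : wp σ fuel (resetAll ((i :: l).map w)) G ⟨fill w u v, t, q, m⟩ =
        wp σ fuel (resetAll (l.map w)) G ⟨fill w (applyOp (wire1 i)
          (notU : Matrix (Bits 1) (Bits 1) ℂ) (projWire i true u)) v, t + 5, q, m⟩ +
          wp σ fuel (resetAll (l.map w)) G ⟨fill w (projWire i false u) v, t + 2, q, m⟩ := by
      rw [resetAll, List.map_cons, List.map_cons, Prog.seqs, wp_seq, wp_branch, wp_skip, wp_gate,
        projWire_fill, projWire_fill, ← wire1_trans, applyOp_fill]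
      rfl
    have h1 := ih (applyOp (wire1 i) (notU : Matrix (Bits 1) (Bits 1) ℂ) (projWire i true u))
      (t + 5) (by
        intro j hj
        by_cases hji : j = i
        · subst hji
          intro s hs
          rw [applyOp_notU] at hs
          simp only [projWire, Function.update_self] at hs
          by_contra hcon
          simp [hcon] at hs
        · refine SuppOn.applyOp_disjoint (((hu j (by simp [hji, hj])).projWire i true).mono
            fun b hb => hb.1) fun _ => ?_
          exact fun h => hji h.symm)
    have h2 := ih (projWire i false u) (t + 2) (by
        intro j hj
        by_cases hji : j = i
        · subst hji
          exact (SuppOn.projWire (f := u) (P := fun _ => True) (fun _ _ => trivial) j false).mono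
            fun b hb => hb.2
        · exact ((hu j (by simp [hji, hj])).projWire i false).mono fun b hb => hb.1)
    rw [hsplit, ← nsq_projWire i u, add_mul]
    rw [nsq_applyOp] at h1
    refine add_le_add (le_trans ?_ h1) (le_trans ?_ h2)
    · refine mul_le_mul_of_nonneg_left (G.anti _ ?_ le_rfl le_rfl) (nsq_nonneg _)
      rw [List.length_cons]; omega
    · refine mul_le_mul_of_nonneg_left (G.anti _ ?_ le_rfl le_rfl) (nsq_nonneg _)
      rw [List.length_cons]; omega

end Measure

/-! ### Binary codes of numbers -/

/-- A numbering of the bit strings of length `k`, in which `0` is the zero string. -/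
def bitsEquiv (k : ℕ) : Bits k ≃ ZMod (2 ^ k) :=
  let e : Bits k ≃ ZMod (2 ^ k) := Fintype.equivOfCardEq (by simp [ZMod.card])
  e.trans (Equiv.subRight (e (zeroBits k)))

/-- The code of the number `i`. -/
def enc (k i : ℕ) : Bits k := (bitsEquiv k).symm i

/-- The number with a given code. -/
def dec (k : ℕ) (y : Bits k) : ℕ := (bitsEquiv k y).val

lemma dec_enc {k i : ℕ} (h : i < 2 ^ k) : dec k (enc k i) = i := by
  rw [dec, enc, Equiv.apply_symm_apply, ZMod.val_natCast_of_lt h]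

lemma enc_zero (k : ℕ) : enc k 0 = zeroBits k := by
  rw [enc, Equiv.symm_apply_eq]
  simp [bitsEquiv]

lemma enc_inj {k i j : ℕ} (hi : i < 2 ^ k) (hj : j < 2 ^ k) (h : enc k i = enc k j) : i = j := by
  rw [← dec_enc hi, ← dec_enc hj, h]

/-- Incrementation of a counter. -/
def incPerm (k : ℕ) : Equiv.Perm (Bits k) :=
  ((bitsEquiv k).trans (Equiv.addRight 1)).trans (bitsEquiv k).symm

lemma incPerm_enc (k i : ℕ) : incPerm k (enc k i) = enc k (i + 1) := by
  simp [incPerm, enc]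

/-! ### The wires of the decomposition algorithm -/

/-- The wires: `sub` for the subroutine, `idx` and `tgt` for linear combinations of unitaries, `z`
for the failure of an attempt, `desc`, `ph`, `acc` for the terms of the decomposition (stabilizer
state, digits of the phase, presence), `cnt` for the norm estimates, `wt` for the final weight,
and `grd` for the comparison of an estimate with a threshold. -/
inductive Wire (κ : Type) (m n L K c h : ℕ) : Type
  | sub (a : κ)
  | idx (i : Fin m)
  | tgt (i : Fin n)
  | z
  | desc (i : Fin (K + 1)) (l : Fin L)
  | ph (i : Fin (K + 1)) (r : Fin 4)
  | acc (i : Fin (K + 1))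
  | cnt (i : Fin (K + 1)) (j : Fin c)
  | wt (j : Fin (h + 1))
  | grd
  deriving DecidableEq, Fintype

/-- The wires that are never in superposition outside of an attempt. -/
def Wire.IsCtl {κ : Type} {m n L K c h : ℕ} : Wire κ m n L K c h → Prop
  | .sub _ => False
  | .tgt _ => False
  | _ => True

/-- The sizes of the registers: `m + 1` index wires, at most `K` terms, counters with `cb` bits,
numbers with `h` digits; the coefficients have absolute value `2^{-h}`. -/
structure Par where
  m : ℕ
  K : ℕ
  cb : ℕ
  h : ℕ

section Layout

variable (P : Par) (n : ℕ) (κ : Type)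

/-- The wires, for given sizes of the registers. -/
abbrev Par.W : Type := Wire κ (P.m + 1) n (gateSeq n).length P.K P.cb P.h

/-- The `i`-th slot. -/
def Par.s (i : ℕ) : Fin (P.K + 1) := Fin.ofNat (P.K + 1) i

lemma Par.s_inj {i j : ℕ} (hi : i ≤ P.K) (hj : j ≤ P.K) (h : P.s i = P.s j) : i = j := by
  have := congrArg Fin.val h
  simpa [Par.s, Nat.mod_eq_of_lt (Nat.lt_succ_of_le hi),
    Nat.mod_eq_of_lt (Nat.lt_succ_of_le hj)] using this

variable {n κ}

/-- The index register. -/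
def Par.idxE : Fin (P.m + 1) ↪ P.W n κ := ⟨.idx, fun _ _ h => by injection h⟩

/-- The work register on which norm estimates are made. -/
def Par.tgtE : Fin n ↪ P.W n κ := ⟨.tgt, fun _ _ h => by injection h⟩

/-- The wires of the subroutine. -/
def Par.subE : κ ↪ P.W n κ := ⟨.sub, fun _ _ h => by injection h⟩

/-- The digits of the phase in slot `i`. -/
def Par.phE (i : ℕ) : Fin 4 ↪ P.W n κ := ⟨.ph (P.s i), fun _ _ h => by injection h⟩

/-- The `i`-th counter. -/
def Par.cntE (i : ℕ) : Fin P.cb ↪ P.W n κ := ⟨.cnt (P.s i), fun _ _ h => by injection h⟩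

/-- The register of the final weight. -/
def Par.wtE : Fin (P.h + 1) ↪ P.W n κ := ⟨.wt, fun _ _ h => by injection h⟩

/-- The description of the stabilizer state in slot `i`. -/
def Par.descE (i : ℕ) : Fin (gateSeq n).length ↪ P.W n κ :=
  ⟨.desc (P.s i), fun _ _ h => by injection h⟩

variable (n κ)

/-- A register of `n` wires on which states are prepared. -/
structure Par.Target where
  emb : Fin n ↪ P.W n κ
  not_ctl : ∀ j, ¬ (emb j).IsCtl

variable {n κ}

lemma Par.Target.ne {P : Par} (tg : P.Target n κ) {i : P.W n κ} (hi : i.IsCtl) (j : Fin n) :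
    i ≠ tg.emb j := fun h => tg.not_ctl j (h ▸ hi)

lemma Par.idxE_ctl (j : Fin (P.m + 1)) : (P.idxE j : P.W n κ).IsCtl := trivial

/-- The index value with which `ψ` is prepared. -/
def Par.x0 : Bits (P.m + 1) := Fin.cons true (zeroBits P.m)

/-- The index value with which the stabilizer state in slot `i` is prepared. -/
def Par.e (i : ℕ) : Bits (P.m + 1) := Fin.cons false (enc P.m i)

/-- The unit `±1, ±i` described by four digits: for the real and for the imaginary part the sign
and whether it is present. -/
def omegaOf (p : Fin 4 → Bool) : ℂ :=
  ⟨if p 1 then (if p 0 then -1 else 1) else 0, if p 3 then (if p 2 then -1 else 1) else 0⟩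

/-- A global phase, as a gate without wires; the identity if `z` is not of absolute value `1`. -/
def scalarU (z : ℂ) : Matrix.unitaryGroup (Bits 0) ℂ :=
  if h : ‖z‖ = 1 then ⟨z • (1 : Matrix (Bits 0) (Bits 0) ℂ), by
    rw [Matrix.mem_unitaryGroup_iff', star_smul, star_one, Matrix.smul_mul, one_mul, smul_smul,
      Complex.star_def, Complex.conj_mul', h]
    simp⟩ else 1

lemma scalarU_coe {z : ℂ} (h : ‖z‖ = 1) :
    (scalarU z : Matrix (Bits 0) (Bits 0) ℂ) = z • (1 : Matrix (Bits 0) (Bits 0) ℂ) := by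
  rw [scalarU, dif_pos h]

end Layout

/-! ### Linear combinations of unitaries -/

lemma applyOp_smul_mat {ι : Type} {k : ℕ} (w : Fin k ↪ ι) (z : ℂ) (M : Matrix (Bits k) (Bits k) ℂ)
    (v : State ι) : applyOp w (z • M) v = z • applyOp w M v := by
  funext b
  simp only [applyOp, Matrix.smul_apply, Pi.smul_apply, smul_eq_mul, Finset.mul_sum, mul_assoc]

section Gates

variable {n : ℕ}

/-- The number of wires of an elementary Clifford gate. -/
def CliffordGate.arity (g : CliffordGate n) : ℕ := g.exists_unitary.choose

/-- The wires of an elementary Clifford gate. -/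
def CliffordGate.wires (g : CliffordGate n) : Fin g.arity ↪ Fin n :=
  g.exists_unitary.choose_spec.2.choose

/-- The unitary of an elementary Clifford gate. -/
def CliffordGate.mat (g : CliffordGate n) : Matrix.unitaryGroup (Bits g.arity) ℂ :=
  g.exists_unitary.choose_spec.2.choose_spec.choose

lemma CliffordGate.arity_le (g : CliffordGate n) : g.arity ≤ 2 :=
  g.exists_unitary.choose_spec.1

lemma CliffordGate.act_eq (g : CliffordGate n) (v : Vec n) :
    g.act v = applyOp g.wires (g.mat : Matrix (Bits g.arity) (Bits g.arity) ℂ) v :=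
  g.exists_unitary.choose_spec.2.choose_spec.choose_spec v

variable {E κ : Type} (P : Par)

lemma Par.ctl_desc_ne (i : ℕ) (l : Fin (gateSeq n).length) (a : Fin (P.m + 1)) (b : Fin 1) :
    (P.idxE a : P.W n κ) ≠ wire1 (.desc (P.s i) l) b := by
  intro h; injection h

/-- The index register and a bit of the description in slot `i`. -/
def Par.idxDesc (i : ℕ) (l : Fin (gateSeq n).length) : Fin (P.m + 1 + 1) ↪ P.W n κ :=
  joint P.idxE (wire1 (.desc (P.s i) l)) (P.ctl_desc_ne i l)

lemma Par.idxDesc_ctl (i : ℕ) (l : Fin (gateSeq n).length) (a) :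
    (P.idxDesc i l a : P.W n κ).IsCtl := by
  obtain ⟨a, rfl⟩ := finSumFinEquiv.surjective a
  rcases a with a | a
  · rw [Par.idxDesc, joint_inl]; trivial
  · rw [Par.idxDesc, joint_inr]; trivial

lemma Par.ctl_ph_ne (i : ℕ) (a : Fin (P.m + 1)) (b : Fin 4) :
    (P.idxE a : P.W n κ) ≠ P.phE i b := by
  intro h; injection h

/-- The index register and the phase in slot `i`. -/
def Par.idxPh (i : ℕ) : Fin (P.m + 1 + 4) ↪ P.W n κ := joint P.idxE (P.phE i) (P.ctl_ph_ne i)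

lemma Par.idxPh_ctl (i : ℕ) (a) : (P.idxPh i a : P.W n κ).IsCtl := by
  obtain ⟨a, rfl⟩ := finSumFinEquiv.surjective a
  rcases a with a | a
  · rw [Par.idxPh, joint_inl]; trivial
  · rw [Par.idxPh, joint_inr]; trivial

open Classical in
/-- The `l`-th gate of the circuit in slot `i`, controlled by the index and by the mask bit. -/
def Par.slotGate (i : ℕ) (l : Fin (gateSeq n).length) (tg : P.Target n κ) : Prog E (P.W n κ) :=
  let g := (gateSeq n).get l
  .gate (joint (P.idxDesc i l) (g.wires.trans tg.emb)
      fun a b => tg.ne (P.idxDesc_ctl i l a) (g.wires b))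
    (mux finSumFinEquiv fun x =>
      if (fun a => x (finSumFinEquiv (.inl a))) = P.e i ∧ x (finSumFinEquiv (.inr 0)) = true
      then g.mat else 1)

open Classical in
/-- The phase `-ω_i`, controlled by the index. -/
def Par.phaseGate (i : ℕ) (tg : P.Target n κ) : Prog E (P.W n κ) :=
  .gate (joint (P.idxPh i) ((⟨Fin.elim0, fun a => a.elim0⟩ : Fin 0 ↪ Fin n).trans tg.emb)
      fun _ b => b.elim0)
    (mux finSumFinEquiv fun x =>
      if (fun a => x (finSumFinEquiv (.inl a))) = P.e i
      then scalarU (-omegaOf fun r => x (finSumFinEquiv (.inr r))) else 1)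

/-- Preparation of `-ω_i |φ_i⟩` on the target, controlled by the index. -/
def Par.slotProg (i : ℕ) (tg : P.Target n κ) : Prog E (P.W n κ) :=
  .seq (.seqs ((List.finRange (gateSeq n).length).map fun l => P.slotGate i l tg))
    (P.phaseGate i tg)

/-- The normalisation of a linear combination of `ψ` and `t` stabilizer states. -/
def Par.Lam (t : ℕ) : ℝ := 1 + t * (1 / 2 : ℝ) ^ P.h

open Classical in
/-- The square roots of the coefficients of the linear combination. -/
def Par.amp (t : ℕ) : State (Fin (P.m + 1)) := fun y =>
  ((if y = P.x0 then Real.sqrt (1 / P.Lam t) else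
    if ∃ i < t, y = P.e i then Real.sqrt ((1 / 2 : ℝ) ^ P.h / P.Lam t) else 0 : ℝ) : ℂ)

end Gates

section Acts

variable {n S : ℕ} {A : BaseAlg n S} {P : Par} {U : Matrix.unitaryGroup (Bits n) ℂ} {F : ℕ}

/-- The meaning of the external instructions of the decomposition algorithm. -/
def accessSem {n S : ℕ} (A : BaseAlg n S) (ι : Type) (U : Matrix.unitaryGroup (Bits n) ℂ) (F : ℕ) :
    Sem (Access n A.wire ι) ι where
  run := Access.sem A (U : Matrix (Bits n) (Bits n) ℂ) F
  run_act := by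
    intro e z t q m c
    cases e with
    | query w => simp [Access.sem, Conf.act, applyOp_smul]; omega
    | cquery w => simp [Access.sem, Conf.act, applyOp_smul]; omega
    | call w =>
      have h := Prog.run_act w (⟨fun e => e.elim, fun e => e.elim⟩ : Sem Empty ι) F A.prog z t q m
        { c with time := c.time + 1, calls := c.calls + 1 }
      simp only [Access.sem]
      rw [← h]
      congr 1
      simp [Conf.act]; omega

/-- Agreement with a reference assignment on the control wires. -/
def Agrees {κ : Type} (r : P.W n κ → Bool) (b : P.W n κ → Bool) : Prop :=
  ∀ i : P.W n κ, i.IsCtl → b i = r i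

/-- The reference assignment with the index set to `y`. -/
def withIdx {κ : Type} (r : P.W n κ → Bool) (y : Bits (P.m + 1)) : P.W n κ → Bool :=
  Function.extend P.idxE y r

lemma withIdx_idx {κ : Type} (r : P.W n κ → Bool) (y : Bits (P.m + 1)) (a : Fin (P.m + 1)) :
    withIdx r y (P.idxE a) = y a := P.idxE.injective.extend_apply _ _ _

lemma withIdx_of_ne {κ : Type} (r : P.W n κ → Bool) (y : Bits (P.m + 1)) {i : P.W n κ}
    (h : ∀ a, P.idxE a ≠ i) : withIdx r y i = r i := extend_apply_of_ne _ _ _ h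

lemma suppOn_fill_idx {κ : Type} {v : State (P.W n κ)} {r : P.W n κ → Bool}
    (hv : SuppOn v (Agrees r)) (y : Bits (P.m + 1)) :
    SuppOn (fill P.idxE (ket y) v) (Agrees (withIdx r y)) := by
  intro b hb i hi
  have h1 := suppOn_fill_ket P.idxE y v b hb
  by_cases h : ∃ a, P.idxE a = i
  · obtain ⟨a, rfl⟩ := h
    rw [withIdx_idx, h1]
  · have h' : ∀ a, P.idxE a ≠ i := fun a ha => h ⟨a, ha⟩
    rw [withIdx_of_ne _ _ h', ← hv _ (right_ne_zero_of_mul hb) i hi, extend_apply_of_ne _ _ _ h']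

lemma suppOn_fill_tgt {κ : Type} {v : State (P.W n κ)} {r : P.W n κ → Bool} (tg : P.Target n κ)
    (u : Vec n) (hv : SuppOn v (Agrees r)) : SuppOn (fill tg.emb u v) (Agrees r) := by
  refine hv.fill fun b hb i hi => ?_
  rw [← hb i hi, extend_apply_of_ne]
  exact fun j => (tg.ne hi j).symm

variable (A U F)

/-- For every value `y` of the index register, the program acts on the target by `Φ y`. -/
def Acts (tg : P.Target n A.wire) (v : State (P.W n A.wire))
    (p : Prog (Access n A.wire (P.W n A.wire)) (P.W n A.wire)) (q : ℕ)
    (Φ : Bits (P.m + 1) → Vec n → Vec n) : Prop :=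
  ∃ L, Lin (accessSem A _ U F) F p L p.size q ∧ ∀ y u,
    L (fill tg.emb u (fill P.idxE (ket y) v)) = fill tg.emb (Φ y u) (fill P.idxE (ket y) v)

variable {A U F} {tg : P.Target n A.wire} {v : State (P.W n A.wire)}

lemma Acts.seq {p p' : Prog (Access n A.wire (P.W n A.wire)) (P.W n A.wire)} {q q' : ℕ}
    {Φ Φ' : Bits (P.m + 1) → Vec n → Vec n} (h : Acts A U F tg v p q Φ)
    (h' : Acts A U F tg v p' q' Φ') :
    Acts A U F tg v (.seq p p') (q + q') fun y u => Φ' y (Φ y u) := by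
  obtain ⟨L, hL, hΦ⟩ := h
  obtain ⟨L', hL', hΦ'⟩ := h'
  refine ⟨_, hL.seq hL', fun y u => ?_⟩
  rw [LinearMap.comp_apply, hΦ, hΦ']

lemma Acts.congr {p : Prog (Access n A.wire (P.W n A.wire)) (P.W n A.wire)} {q : ℕ}
    {Φ Φ' : Bits (P.m + 1) → Vec n → Vec n} (h : Acts A U F tg v p q Φ)
    (h' : ∀ y u, Φ y u = Φ' y u) : Acts A U F tg v p q Φ' := by
  have : Φ = Φ' := by funext y u; exact h' y u
  rwa [← this]

lemma Acts.seqs {α : Type} (l : List α)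
    (p : α → Prog (Access n A.wire (P.W n A.wire)) (P.W n A.wire))
    (Φ : α → Bits (P.m + 1) → Vec n → Vec n) (h : ∀ i ∈ l, Acts A U F tg v (p i) 0 (Φ i)) :
    Acts A U F tg v (.seqs (l.map p)) 0 fun y u => l.foldl (fun u i => Φ i y u) u := by
  induction l with
  | nil => exact ⟨_, Lin.skip, fun y u => rfl⟩
  | cons i l ih =>
    exact (h i (by simp)).seq (ih fun j hj => h j (by simp [hj]))

/-- A gate on target wires, controlled by classical wires. -/
lemma acts_mux {a k : ℕ} (c : Fin a ↪ P.W n A.wire) (hc : ∀ i, (c i).IsCtl) (l : Fin k ↪ Fin n)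
    (hd : ∀ i j, c i ≠ (l.trans tg.emb) j) (V : Bits a → Matrix.unitaryGroup (Bits k) ℂ)
    {r : P.W n A.wire → Bool} (hv : SuppOn v (Agrees r)) :
    Acts A U F tg v (.gate (joint c (l.trans tg.emb) hd) (mux finSumFinEquiv V)) 0 fun y u =>
      applyOp l (V fun i => withIdx r y (c i) : Matrix (Bits k) (Bits k) ℂ) u := by
  refine ⟨_, Lin.gate _ _, fun y u => ?_⟩
  change applyOp _ _ _ = _
  rw [applyOp_mux_joint _ _ _ _ (withIdx r y), applyOp_fill]
  exact (suppOn_fill_tgt tg u (suppOn_fill_idx hv y)).mono fun b hb i => hb _ (hc i)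

/-- The stabilizer state that a reference assignment describes in slot `i`. -/
def slotDesc {κ : Type} (r : P.W n κ → Bool) (i : ℕ) : StabDesc n := fun l => r (.desc (P.s i) l)

/-- The phase that a reference assignment describes in slot `i`. -/
def slotOmega {κ : Type} (r : P.W n κ → Bool) (i : ℕ) : ℂ := omegaOf fun j => r (.ph (P.s i) j)

open Classical in
/-- The circuit in slot `i` is the fixed sequence `gateSeq n` with a bit for each gate that tells
whether it is applied; so one program, controlled by the index and by these bits, serves all
stabilizer states. -/
lemma acts_slotProg (i : ℕ) {r : P.W n A.wire → Bool} (hv : SuppOn v (Agrees r))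
    (hω : ‖slotOmega r i‖ = 1) :
    Acts A U F tg v (P.slotProg i tg) 0 fun y u => if y = P.e i then
      -slotOmega r i • (slotDesc r i).circuit.foldl (fun v g => g.act v) u else u := by
  have h1 : Acts A U F tg v (.seqs ((List.finRange (gateSeq n).length).map
      fun l => P.slotGate i l tg)) 0 _ := Acts.seqs _ _
    (fun l y u => if y = P.e i ∧ slotDesc r i l = true then ((gateSeq n).get l).act u else u)
    (by
      intro l _
      refine (acts_mux (U := U) (F := F) (P.idxDesc i l) (P.idxDesc_ctl i l)
        ((gateSeq n).get l).wires
        (fun a b => tg.ne (P.idxDesc_ctl i l a) (((gateSeq n).get l).wires b))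
        (fun x => if (fun a => x (finSumFinEquiv (.inl a))) = P.e i ∧
          x (finSumFinEquiv (.inr 0)) = true then ((gateSeq n).get l).mat else 1) hv).congr
          fun y u => ?_
      simp only [Par.idxDesc, joint_inl, joint_inr, withIdx_idx]
      have h2 : withIdx r y ((wire1 (.desc (P.s i) l) : Fin 1 ↪ P.W n A.wire) 0) =
          slotDesc r i l := withIdx_of_ne _ _ fun a h => by injection h
      rw [h2]
      by_cases h3 : y = P.e i ∧ slotDesc r i l = true
      · rw [if_pos h3, if_pos h3, CliffordGate.act_eq]
      · rw [if_neg h3, if_neg h3]; exact applyOp_one _ u)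
  have h2 : Acts A U F tg v (P.phaseGate i tg) 0 fun y u =>
      if y = P.e i then -slotOmega r i • u else u := by
    refine (acts_mux (U := U) (F := F) (P.idxPh i) (P.idxPh_ctl i)
        (⟨Fin.elim0, fun a => a.elim0⟩ : Fin 0 ↪ Fin n)
        (fun _ b => b.elim0)
        (fun x => if (fun a => x (finSumFinEquiv (.inl a))) = P.e i
          then scalarU (-omegaOf fun r => x (finSumFinEquiv (.inr r))) else 1) hv).congr
        fun y u => ?_
    simp only [Par.idxPh, joint_inl, joint_inr, withIdx_idx]
    have h2 : (fun j => withIdx r y (P.phE i j)) = fun j => r (.ph (P.s i) j) := by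
      funext j; exact withIdx_of_ne _ _ fun a h => by injection h
    by_cases h3 : y = P.e i
    · rw [if_pos h3, if_pos h3, h2, scalarU_coe (by rw [norm_neg]; exact hω)]
      rw [applyOp_smul_mat, applyOp_one]
      rfl
    · rw [if_neg h3, if_neg h3]; exact applyOp_one _ u
  refine (h1.seq h2).congr fun y u => ?_
  by_cases h3 : y = P.e i
  · simp only [h3, true_and, if_true]
    congr 1
    symm
    rw [StabDesc.circuit, List.foldl_filterMap]
    congr 1
    funext u l
    split_ifs <;> rfl
  · simp only [h3, false_and, if_false]
    induction (List.finRange (gateSeq n).length) with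
    | nil => rfl
    | cons _ _ ih => exact ih

end Acts

section Lcu

variable {n S : ℕ} {A : BaseAlg n S} {P : Par} {U : Matrix.unitaryGroup (Bits n) ℂ} {F : ℕ}
  {κ : Type}

lemma Par.Lam_pos (t : ℕ) : 0 < P.Lam t := by
  rw [Par.Lam]; positivity

lemma Par.e_inj {i j : ℕ} (hi : i < 2 ^ P.m) (hj : j < 2 ^ P.m) (h : P.e i = P.e j) : i = j :=
  enc_inj hi hj (Fin.cons_injective2 h).2

lemma Par.x0_ne_e (i : ℕ) : P.x0 ≠ P.e i := fun h => by
  have := (Fin.cons_injective2 h).1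
  simp at this

lemma Par.amp_x0 (t : ℕ) : P.amp t P.x0 = (Real.sqrt (1 / P.Lam t) : ℂ) := by
  simp [Par.amp]

lemma Par.amp_e {t i : ℕ} (hi : i < t) :
    P.amp t (P.e i) = (Real.sqrt ((1 / 2 : ℝ) ^ P.h / P.Lam t) : ℂ) := by
  rw [Par.amp, if_neg (Ne.symm (P.x0_ne_e i)), if_pos ⟨i, hi, rfl⟩]

/-- Sums over the index register that are weighted by the amplitudes. -/
lemma Par.sum_amp {M : Type*} [AddCommMonoid M] {t : ℕ} (ht : t ≤ 2 ^ P.m)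
    (f : Bits (P.m + 1) → M) (hf : ∀ y, P.amp t y = 0 → f y = 0) :
    ∑ y, f y = f P.x0 + ∑ i ∈ Finset.range t, f (P.e i) := by
  classical
  have h1 : ∑ i ∈ Finset.range t, f (P.e i) = ∑ y ∈ (Finset.range t).image P.e, f y := by
    rw [Finset.sum_image]
    intro i hi j hj h
    exact P.e_inj ((Finset.mem_range.1 hi).trans_le ht) ((Finset.mem_range.1 hj).trans_le ht) h
  rw [h1, ← Finset.sum_insert]
  · symm
    refine Finset.sum_subset (Finset.subset_univ _) fun y _ hy => hf y ?_
    rw [Finset.mem_insert, not_or, Finset.mem_image] at hy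
    rw [Par.amp, if_neg hy.1, if_neg]
    · simp
    · rintro ⟨i, hi, rfl⟩
      exact hy.2 ⟨i, Finset.mem_range.2 hi, rfl⟩
  · rw [Finset.mem_image]
    rintro ⟨i, -, h⟩
    exact P.x0_ne_e i h.symm

lemma Par.norm_amp_x0 (t : ℕ) : ‖P.amp t P.x0‖ ^ 2 = 1 / P.Lam t := by
  rw [P.amp_x0, Complex.norm_real, Real.norm_of_nonneg (Real.sqrt_nonneg _),
    Real.sq_sqrt (one_div_nonneg.2 (P.Lam_pos t).le)]

lemma Par.norm_amp_e {t i : ℕ} (hi : i < t) :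
    ‖P.amp t (P.e i)‖ ^ 2 = (1 / 2 : ℝ) ^ P.h / P.Lam t := by
  rw [P.amp_e hi, Complex.norm_real, Real.norm_of_nonneg (Real.sqrt_nonneg _), Real.sq_sqrt]
  have := P.Lam_pos t
  positivity

lemma Par.nsq_amp {t : ℕ} (ht : t ≤ 2 ^ P.m) : nsq (P.amp t) = 1 := by
  rw [nsq, P.sum_amp ht _ fun y hy => by rw [hy]; simp, P.norm_amp_x0,
    Finset.sum_congr rfl fun i hi => P.norm_amp_e (Finset.mem_range.1 hi)]
  have := P.Lam_pos t
  rw [Finset.sum_const, Finset.card_range, nsmul_eq_mul]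
  field_simp
  rw [Par.Lam]

open Classical in
/-- A unitary that maps `|0⟩` to the amplitude vector of the linear combination. -/
def Par.lcuGate (t : ℕ) : Matrix.unitaryGroup (Bits (P.m + 1)) ℂ :=
  if h : nsq (P.amp t) = 1 then (exists_unitary_column _ h).choose else 1

lemma Par.lcuGate_apply {t : ℕ} (ht : t ≤ 2 ^ P.m) (y : Bits (P.m + 1)) :
    (P.lcuGate t : Matrix (Bits (P.m + 1)) (Bits (P.m + 1)) ℂ) y (zeroBits _) = P.amp t y := by
  rw [Par.lcuGate, dif_pos (P.nsq_amp ht)]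
  exact (exists_unitary_column _ (P.nsq_amp ht)).choose_spec y

/-- Preparation of a linear combination of `ψ` and the first `t` stabilizer states: the
coefficients are put on the index register, the states are prepared under the control of this
register, and the index register is rotated back. -/
def Par.lcu (t : ℕ) (tg : P.Target n κ) : Prog (Access n κ (P.W n κ)) (P.W n κ) :=
  .seq (.gate P.idxE (P.lcuGate t))
    (.seq (.seq (.ext (.cquery (consWire (P.idxE 0) tg.emb fun j => tg.ne (P.idxE_ctl 0) j)))
        (.seqs ((List.range t).map fun i => P.slotProg i tg)))
      (.gate P.idxE (star (P.lcuGate t))))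

/-- The residual vector: `ψ` minus the first `t` terms of the decomposition. -/
def residual (P : Par) (ψ : Vec n) (r : P.W n κ → Bool) (t : ℕ) : Vec n :=
  ψ - ∑ i ∈ Finset.range t,
    (((1 / 2 : ℝ) ^ P.h : ℝ) : ℂ) • slotOmega r i • (slotDesc r i).state

lemma mulVec_ket {k : ℕ} (M : Matrix (Bits k) (Bits k) ℂ) (y y' : Bits k) :
    (M *ᵥ ket y) y' = M y' y := by
  rw [ket, Matrix.mulVec_single]; simp

lemma nsq_mulVec {k : ℕ} (M : Matrix.unitaryGroup (Bits k) ℂ) (u : State (Fin k)) :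
    nsq ((M : Matrix (Bits k) (Bits k) ℂ) *ᵥ u) = nsq u := by
  rw [← applyOp_refl, nsq_applyOp]

lemma StabDesc.nsq_state (d : StabDesc n) : nsq d.state = 1 := d.isStabilizer.1

variable {tg : P.Target n A.wire} {v : State (P.W n A.wire)}

lemma acts_cquery {r : P.W n A.wire → Bool} (hv : SuppOn v (Agrees r)) :
    Acts A U F tg v (.ext (.cquery (consWire (P.idxE 0) tg.emb fun j => tg.ne (P.idxE_ctl 0) j)))
      1 fun y u => if y 0 then (U : Matrix (Bits n) (Bits n) ℂ) *ᵥ u else u := by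
  refine ⟨applyOpₗ (consWire (P.idxE 0) tg.emb fun j => tg.ne (P.idxE_ctl 0) j)
    (controlled (U : Matrix (Bits n) (Bits n) ℂ)), ?_, fun y u => ?_⟩
  · intro G v t q m
    simp only [wp, Prog.run, accessSem, Access.sem, List.map_cons, List.map_nil, List.sum_cons,
      List.sum_nil, add_zero]
    rfl
  · change applyOp _ _ _ = _
    rw [applyOp_controlled (x := y 0)]
    · by_cases h : y 0 = true
      · rw [if_pos h, applyOp_fill_self]; simp only [h, if_true]
      · rw [if_neg h]; simp [h]
    · exact (suppOn_fill_tgt tg u (suppOn_fill_idx hv y)).mono fun b hb => by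
        rw [hb _ (P.idxE_ctl 0), withIdx_idx]

open Classical in
/-- The vector that is prepared on the target if the index has the value `y`. -/
def selected (U : Matrix.unitaryGroup (Bits n) ℂ) (r : P.W n κ → Bool) (t : ℕ)
    (y : Bits (P.m + 1)) : Vec n :=
  (List.range t).foldl (fun u i => if y = P.e i then
      -slotOmega r i • (slotDesc r i).circuit.foldl (fun v g => g.act v) u else u)
    (if y 0 then (U : Matrix (Bits n) (Bits n) ℂ) *ᵥ ket (zeroBits n) else ket (zeroBits n))

lemma selected_x0 (r : P.W n κ → Bool) (t : ℕ) : selected U r t P.x0 =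
    (U : Matrix (Bits n) (Bits n) ℂ) *ᵥ ket (zeroBits n) := by
  rw [selected]
  induction t with
  | zero => simp [Par.x0]
  | succ t ih => rw [List.range_succ, List.foldl_append, ih]; simp [P.x0_ne_e]

lemma selected_e (r : P.W n κ → Bool) {t i : ℕ} (hi : i < t) (ht : t ≤ 2 ^ P.m) :
    selected U r t (P.e i) = -slotOmega r i • (slotDesc r i).state := by
  have h0 : ∀ s ≤ i, selected U r s (P.e i) = ket (zeroBits n) := by
    intro s hs
    rw [selected]
    induction s with
    | zero => simp [Par.e]
    | succ s ih =>
      rw [List.range_succ, List.foldl_append, ih (by omega)]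
      have : P.e i ≠ P.e s := fun h => by
        have := P.e_inj (hi.trans_le ht) (by omega) h
        omega
      simp [this]
  induction t with
  | zero => omega
  | succ t ih =>
    rw [selected, List.range_succ, List.foldl_append]
    change List.foldl _ (selected U r t (P.e i)) [t] = _
    rcases Nat.lt_succ_iff_lt_or_eq.1 hi with h | rfl
    · rw [ih h (by omega)]
      have : P.e i ≠ P.e t := fun h' => by
        have := P.e_inj (by omega) (by omega) h'
        omega
      simp [this]
    · rw [h0 i le_rfl]
      simp [StabDesc.state, ket]

lemma nsq_column : nsq ((U : Matrix (Bits n) (Bits n) ℂ) *ᵥ ket (zeroBits n)) = 1 := by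
  rw [nsq_mulVec, nsq_ket]

/-- Linear combination of unitaries: the part of the result in which the index register is zero
is proportional to the residual vector. -/
lemma wp_lcu (ψ : Vec n) (hU : (U : Matrix (Bits n) (Bits n) ℂ) *ᵥ ket (zeroBits n) = ψ)
    {r : P.W n A.wire → Bool} (hv : SuppOn v (Agrees r)) (hr : ∀ a, r (P.idxE a) = false)
    (hv0 : SuppOn v fun b => ∀ j, b (tg.emb j) = false) {t : ℕ} (ht : t ≤ 2 ^ P.m)
    (hω : ∀ i < t, ‖slotOmega r i‖ = 1) :
    ∃ ξ : Bits (P.m + 1) → Vec n, ∑ y, nsq (ξ y) = 1 ∧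
      ξ (zeroBits _) = ((1 / P.Lam t : ℝ) : ℂ) • residual P ψ r t ∧
      ∀ (G : Post (P.W n A.wire)) (τ q m : ℕ),
        wp (accessSem A _ U F) F (P.lcu t tg) G ⟨v, τ, q, m⟩ =
          G ⟨∑ y, fill P.idxE (ket y) (fill tg.emb (ξ y) v),
            τ + (P.lcu t tg : Prog (Access n A.wire (P.W n A.wire)) (P.W n A.wire)).size,
            q + 1, m⟩ := by
  set M := (P.lcuGate t : Matrix (Bits (P.m + 1)) (Bits (P.m + 1)) ℂ) with hM
  set χ := selected U r t with hχ
  have hidx0 : fill P.idxE (ket (zeroBits _)) v = v :=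
    fill_ket_zero _ _ (hv.mono fun b hb a => by rw [hb _ (P.idxE_ctl a), hr])
  have hdisj : ∀ a j, P.idxE a ≠ tg.emb j := fun a j => tg.ne (P.idxE_ctl a) j
  refine ⟨fun y' => ∑ y, (P.amp t y * (star M) y' y) • χ y, ?_, ?_, ?_⟩
  -- The final rotation of the index register preserves the norm, column by column.
  · have h1 : ∀ b, ∑ y', ‖(∑ y, (P.amp t y * (star M) y' y) • χ y) b‖ ^ 2 =
        ∑ y, ‖P.amp t y‖ ^ 2 * ‖χ y b‖ ^ 2 := by
      intro b
      have h2 := nsq_mulVec (star (P.lcuGate t)) fun y => P.amp t y * χ y b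
      have h3 : ∀ y', ((star (P.lcuGate t) : Matrix.unitaryGroup (Bits (P.m + 1)) ℂ) :
          Matrix (Bits (P.m + 1)) (Bits (P.m + 1)) ℂ) y' = (star M) y' := fun _ => rfl
      simp only [nsq, Matrix.mulVec, dotProduct, h3, norm_mul, mul_pow] at h2
      rw [← h2]
      refine Finset.sum_congr rfl fun y' _ => ?_
      congr 2
      rw [Finset.sum_apply]
      refine Finset.sum_congr rfl fun y _ => ?_
      rw [Pi.smul_apply, smul_eq_mul]; ring
    simp only [nsq]
    rw [Finset.sum_comm]
    simp only [h1]
    rw [Finset.sum_comm]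
    simp only [← Finset.mul_sum]
    have h2 : ∀ y, ‖P.amp t y‖ ^ 2 * ∑ b, ‖χ y b‖ ^ 2 = ‖P.amp t y‖ ^ 2 := by
      intro y
      by_cases hy : P.amp t y = 0
      · simp [hy]
      · have : nsq (χ y) = 1 := by
          by_cases h3 : y = P.x0
          · rw [h3, hχ, selected_x0, nsq_column]
          · by_cases h4 : ∃ i < t, y = P.e i
            · obtain ⟨i, hi, rfl⟩ := h4
              rw [hχ, selected_e r hi ht, nsq_smul, norm_neg, hω i hi, StabDesc.nsq_state]
              norm_num
            · exact absurd (by rw [Par.amp, if_neg h3, if_neg h4]; simp) hy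
        rw [show ∑ b, ‖χ y b‖ ^ 2 = nsq (χ y) from rfl, this, mul_one]
    simp only [h2]
    exact P.nsq_amp ht
  -- The index value zero is reached with the conjugate amplitudes, so that the weights are their
  -- squares.
  · have h1 : ∀ y, (star M) (zeroBits _) y = star (P.amp t y) := by
      intro y
      rw [Matrix.star_eq_conjTranspose, Matrix.conjTranspose_apply, hM, P.lcuGate_apply ht]
    simp only [h1]
    rw [P.sum_amp ht _ fun y hy => by rw [hy]; simp]
    have h2 : ∀ y, P.amp t y * star (P.amp t y) = ((‖P.amp t y‖ ^ 2 : ℝ) : ℂ) := by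
      intro y; push_cast; rw [← Complex.mul_conj']; rfl
    simp only [h2]
    rw [P.norm_amp_x0, Finset.sum_congr rfl fun i hi => by
      rw [P.norm_amp_e (Finset.mem_range.1 hi), hχ, selected_e r (Finset.mem_range.1 hi) ht]]
    rw [hχ, selected_x0, hU, residual, smul_sub, sub_eq_add_neg, Finset.smul_sum,
        ← Finset.sum_neg_distrib]
    congr 1
    refine Finset.sum_congr rfl fun i _ => ?_
    rw [neg_smul, smul_neg, smul_smul, smul_smul, smul_smul]
    congr 2
    push_cast
    ring
  · intro G τ q m
    obtain ⟨L, hL, hLΦ⟩ := (acts_cquery (U := U) (F := F) (tg := tg) hv).seq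
      (Acts.seqs (List.range t) (fun i => P.slotProg i tg) _ fun i hi =>
        acts_slotProg i hv (hω i (List.mem_range.1 hi)))
    have hlin := (Lin.gate (σ := accessSem A _ U F) (fuel := F) P.idxE (P.lcuGate t)).seq
      (hL.seq (Lin.gate P.idxE (star (P.lcuGate t))))
    have hsz := hlin G v τ q m
    rw [Par.lcu, hsz]
    congr 2
    · simp only [LinearMap.comp_apply]
      change applyOp P.idxE (star M) (L (applyOp P.idxE M v)) = _
      have h1 : applyOp P.idxE M v =
          ∑ y, P.amp t y • fill tg.emb (ket (zeroBits n)) (fill P.idxE (ket y) v) := by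
        conv_lhs => rw [← hidx0]
        rw [applyOp_fill_self, fill_eq_sum]
        refine Finset.sum_congr rfl fun y _ => ?_
        have h2 : fill tg.emb (ket (zeroBits n)) (fill P.idxE (ket y) v) =
            fill P.idxE (ket y) v := fill_ket_zero _ _ (hv0.fill fun b hb j => by
          rw [← hb j, extend_apply_of_ne _ _ _ fun a => hdisj a j])
        rw [mulVec_ket, hM, P.lcuGate_apply ht, h2]
      rw [h1, map_sum]
      simp only [map_smul, hLΦ]
      change applyOpₗ P.idxE (star M) _ = _
      rw [map_sum]
      simp only [map_smul]
      change ∑ y, P.amp t y • applyOp P.idxE (star M) (fill tg.emb (χ y) _) = _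
      have h2 : ∀ y, P.amp t y • applyOp P.idxE (star M)
          (fill tg.emb (χ y) (fill P.idxE (ket y) v)) =
          ∑ y', fill P.idxE (ket y') (fill tg.emb ((P.amp t y * (star M) y' y) • χ y) v) := by
        intro y
        rw [fill_comm _ _ (fun j a => (hdisj a j).symm), applyOp_fill_self, fill_eq_sum,
          Finset.smul_sum]
        refine Finset.sum_congr rfl fun y' _ => ?_
        rw [mulVec_ket, smul_smul, fill_smul_left, fill_smul_right]
      simp only [h2]
      rw [Finset.sum_comm]
      refine Finset.sum_congr rfl fun y' _ => ?_
      rw [fill_sum_left, fill_sum_right]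

/-! ### Attempts to prepare the residual state -/

lemma Par.z_ctl : (.z : P.W n κ).IsCtl := trivial

lemma Par.idx_ne_z (a : Fin (P.m + 1)) (b : Fin 1) : (P.idxE a : P.W n κ) ≠ wire1 .z b := by
  intro h; injection h

open Classical in
/-- Flips the failure wire if the index register is zero. -/
def Par.zGate : Prog (Access n κ (P.W n κ)) (P.W n κ) :=
  .gate (joint P.idxE (wire1 .z) P.idx_ne_z)
    (mux finSumFinEquiv fun x => if x = zeroBits _ then notU else 1)

/-- One attempt to prepare the residual state on a target, with the failure wire set before: after
a success the failure wire is cleared, after a failure the target and the index are reset. -/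
def Par.attempt (t : ℕ) (tg : P.Target n κ) : Prog (Access n κ (P.W n κ)) (P.W n κ) :=
  .seq (P.lcu t tg) (.seq (measAll ((List.finRange (P.m + 1)).map P.idxE)) (.seq P.zGate
    (.branch .z (.seq (resetAll ((List.finRange n).map tg.emb))
      (resetAll ((List.finRange (P.m + 1)).map P.idxE))) .skip)))

/-- The unnormalised vector that a successful attempt leaves on the target: the residual vector,
divided by the normalisation of the linear combination. -/
def Par.succVec (P : Par) (ψ : Vec n) (r : P.W n κ → Bool) (t : ℕ) : Vec n :=
  ((1 / P.Lam t : ℝ) : ℂ) • residual P ψ r t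

/-- An attempt succeeds with probability `‖succVec‖²` and then leaves the residual state on the
target and clears the failure wire; otherwise it restores everything. -/
lemma le_wp_attempt (ψ : Vec n)
    (hU : (U : Matrix (Bits n) (Bits n) ℂ) *ᵥ ket (zeroBits n) = ψ)
    {r : P.W n A.wire → Bool} (hv : SuppOn v (Agrees r)) (hr : ∀ a, r (P.idxE a) = false)
    (hz : r .z = true)
    (hv0 : SuppOn v fun b => ∀ j, b (tg.emb j) = false) {t : ℕ} (ht : t ≤ 2 ^ P.m)
    (hω : ∀ i < t, ‖slotOmega r i‖ = 1) (G : Post (P.W n A.wire)) (τ q m : ℕ) :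
    G ⟨fill tg.emb (P.succVec ψ r t) (applyOp (wire1 .z) (notU : Matrix (Bits 1) (Bits 1) ℂ) v),
        τ + (P.attempt t tg).size, q + 1, m⟩ +
      (1 - nsq (P.succVec ψ r t)) * G ⟨v, τ + (P.attempt t tg).size, q + 1, m⟩ ≤
      wp (accessSem A _ U F) F (P.attempt t tg) G ⟨v, τ, q, m⟩ := by
  obtain ⟨ξ, hξ1, hξ0, hwp⟩ := wp_lcu (U := U) (F := F) ψ hU hv hr hv0 ht hω
  have hdisj : ∀ a j, P.idxE a ≠ tg.emb j := fun a j => tg.ne (P.idxE_ctl a) j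
  conv_rhs => rw [Par.attempt, wp_seq, hwp, wp_seq]
  set T1 := τ + (P.lcu t tg : Prog (Access n A.wire (P.W n A.wire)) (P.W n A.wire)).size with hT1
  set f := ∑ y, fill P.idxE (ket y) (fill tg.emb (ξ y) v) with hf
  refine le_trans ?_ (sum_projReg_le_wp_measAll _ F P.idxE _ (List.finRange (P.m + 1)) f
    (zeroBits _) T1 (q + 1) m fun j hj => absurd (List.mem_finRange j) hj)
  have hproj : ∀ y, projReg P.idxE y f = fill P.idxE (ket y) (fill tg.emb (ξ y) v) := by
    intro y
    funext b
    simp only [projReg, hf, Finset.sum_apply, fill_apply P.idxE, ket_apply]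
    split_ifs with h
    · rw [Finset.sum_eq_single y]
      · rw [if_pos h]
      · intro y' _ hy'
        rw [if_neg, zero_mul]
        rw [h]; exact Ne.symm hy'
      · simp
    · simp
  simp only [hproj, List.length_finRange]
  set T2 := T1 + (3 * (P.m + 1) + 1) with hT2
  have hsz : τ + (P.attempt t tg : Prog (Access n A.wire (P.W n A.wire)) (P.W n A.wire)).size =
      T2 + 4 ^ (P.m + 1 + 1) + (1 + ((6 * n + 1) + (6 * (P.m + 1) + 1)) + 1) := by
    simp only [Par.attempt, Prog.size, size_measAll, size_resetAll, Par.zGate, List.length_map,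
      List.length_finRange, hT2, hT1]
    omega
  rw [hsz]
  have hagree : ∀ y, SuppOn (fill P.idxE (ket y) (fill tg.emb (ξ y) v))
      (Agrees (withIdx r y)) := fun y => suppOn_fill_idx (suppOn_fill_tgt tg (ξ y) hv) y
  have hgate : ∀ y (G' : Post (P.W n A.wire)), wp (accessSem A _ U F) F P.zGate G'
      ⟨fill P.idxE (ket y) (fill tg.emb (ξ y) v), T2, q + 1, m⟩ =
      G' ⟨applyOp (wire1 .z) ((if y = zeroBits _ then notU else 1 : Matrix.unitaryGroup _ ℂ) :
        Matrix (Bits 1) (Bits 1) ℂ) (fill P.idxE (ket y) (fill tg.emb (ξ y) v)),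
        T2 + 4 ^ (P.m + 1 + 1), q + 1, m⟩ := by
    intro y G'
    rw [Par.zGate, wp_gate, applyOp_mux_joint _ _ _ _ (withIdx r y)]
    · simp only [withIdx_idx]
    · exact (hagree y).mono fun b hb a => hb _ (P.idxE_ctl a)
  simp only [wp_seq, hgate]
  rw [← Finset.add_sum_erase _ _ (Finset.mem_univ (zeroBits (P.m + 1)))]
  refine add_le_add ?_ ?_
  · rw [if_pos rfl, applyOp_fill_disjoint, applyOp_fill_disjoint, hξ0]
    · rw [fill_comm _ _ hdisj]
      set v1 := applyOp (wire1 .z) (notU : Matrix (Bits 1) (Bits 1) ℂ) v with hv1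
      have h1 : fill P.idxE (ket (zeroBits _)) v1 = v1 := fill_ket_zero _ _ (by
        intro b hb a
        rw [hv1, applyOp_notU] at hb
        have := hv _ hb _ (P.idxE_ctl a)
        rw [hr, Function.update_of_ne] at this
        · exact this
        · intro h; injection h)
      have h2 : SuppOn v1 fun b => b .z = false := by
        intro b hb
        rw [hv1, applyOp_notU] at hb
        have := hv _ hb .z trivial
        rw [hz, Function.update_self] at this
        simpa using this
      rw [h1, wp_branch_false _ _ _ _ _ _ _ _ (h2.fill_disjoint fun j => (tg.ne Par.z_ctl j).symm),
        wp_skip]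
      exact G.anti _ (by omega) le_rfl le_rfl
    · intro i j; exact tg.ne Par.z_ctl j
    · intro i j h; injection h
  · have hn : 1 - nsq (P.succVec ψ r t) = ∑ y ∈ Finset.univ.erase (zeroBits _), nsq (ξ y) := by
      rw [← hξ1, ← Finset.add_sum_erase _ _ (Finset.mem_univ (zeroBits (P.m + 1))), hξ0,
        Par.succVec]
      ring
    rw [hn, Finset.sum_mul]
    refine Finset.sum_le_sum fun y hy => ?_
    rw [if_neg (Finset.ne_of_mem_erase hy), Submonoid.coe_one, applyOp_one,
      wp_branch_true _ _ _ _ _ _ _ _ ((hagree y).mono fun b hb => by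
        rw [hb .z trivial, withIdx_of_ne _ _ fun a h => by injection h]; exact hz), wp_seq,
      fill_comm _ _ hdisj]
    refine le_trans ?_ (nsq_mul_le_wp_resetAll _ F tg.emb _ (List.finRange n) (ξ y) _ _ _ _ ?_
      fun j hj => absurd (List.mem_finRange j) hj)
    · refine mul_le_mul_of_nonneg_left ?_ (nsq_nonneg _)
      refine le_trans ?_ (nsq_mul_le_wp_resetAll _ F P.idxE _ (List.finRange (P.m + 1)) (ket y) v
        _ _ _ ?_ fun j hj => absurd (List.mem_finRange j) hj)
      · rw [nsq_ket, one_mul]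
        refine G.anti _ ?_ le_rfl le_rfl
        simp only [List.length_finRange]; omega
      · exact hv.mono fun b hb a => by rw [hb _ (P.idxE_ctl a), hr]
    · exact hv0.fill fun b hb j => by
        rw [← hb j, extend_apply_of_ne _ _ _ fun a => hdisj a j]

end Lcu

/-! ### Classical gates and the classical registers -/

section Classical

variable {E ι : Type} {k a : ℕ}

lemma applyOp_permU_ket [Fintype ι] (w : Fin k ↪ ι) (σ : Equiv.Perm (Bits k)) (b : ι → Bool) :
    applyOp w (permU σ : Matrix (Bits k) (Bits k) ℂ) (ket b) =
      ket (Function.extend w (σ fun j => b (w j)) b) := by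
  funext b'
  rw [applyOp_permU, ket_apply, ket_apply]
  have : Function.extend w (σ.symm fun j => b' (w j)) b' = b ↔
      b' = Function.extend w (σ fun j => b (w j)) b := by
    constructor
    · rintro rfl
      rw [extend_comp, extend_extend, Equiv.apply_symm_apply, extend_self]
    · rintro rfl
      rw [extend_comp, extend_extend, Equiv.symm_apply_apply, extend_self]
  simp only [this]

/-- Addition of `y` in `𝔽₂^k`. -/
def xorPerm (y : Bits k) : Equiv.Perm (Bits k) :=
  Function.Involutive.toPerm (fun b j => xor (b j) (y j)) (fun b => by funext j; simp)

lemma notU_eq : notU = permU (xorPerm fun _ => true) := by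
  rw [notU]
  congr 1
  ext b j
  simp [xorPerm]
  rfl

/-- The classical gate that adds `f` of the control wires to the target wires. -/
def cxor (c : Fin a ↪ ι) (t : Fin k ↪ ι) (h : ∀ i j, c i ≠ t j) (f : Bits a → Bits k) :
    Prog E ι :=
  .gate (joint c t h) (mux finSumFinEquiv fun x => permU (xorPerm (f x)))

lemma wp_cxor_ket [Fintype ι] (σ : Sem E ι) (F : ℕ) (c : Fin a ↪ ι) (t : Fin k ↪ ι)
    (h : ∀ i j, c i ≠ t j) (f : Bits a → Bits k) (G : Post ι) (b : ι → Bool) (τ q m : ℕ) :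
    wp σ F (cxor c t h f) G ⟨ket b, τ, q, m⟩ =
      G ⟨ket (Function.extend t (fun j => xor (b (t j)) (f (fun i => b (c i)) j)) b),
        τ + 4 ^ (a + k), q, m⟩ := by
  rw [cxor, wp_gate, applyOp_mux_joint _ _ _ _ b, applyOp_permU_ket]
  · rfl
  · intro b' hb' i
    rw [ket_apply] at hb'
    split_ifs at hb' with h1
    · rw [h1]
    · simp at hb'

lemma suppOn_ket [Fintype ι] (b : ι → Bool) : SuppOn (ket b) fun b' => b' = b := by
  intro b' hb'
  rw [ket_apply] at hb'
  split_ifs at hb' with h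
  · exact h
  · simp at hb'

end Classical

/-- The contents of the classical registers. Between attempts and calls the state of the algorithm
is a basis vector `ket R.bits` with the other registers zero, so that the analysis can follow the
branches as classical data. -/
structure Reg (P : Par) (n : ℕ) where
  desc : Fin (P.K + 1) → StabDesc n
  ph : Fin (P.K + 1) → Bits 4
  acc : Fin (P.K + 1) → Bool
  cnt : Fin (P.K + 1) → Bits P.cb
  wt : Bits (P.h + 1)
  grd : Bool
  z : Bool

section Reg

variable {P : Par} {n : ℕ} {κ : Type}

/-- The assignment of all wires in which the other wires are `0`. -/
def Reg.bits (R : Reg P n) : P.W n κ → Bool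
  | .sub _ => false
  | .idx _ => false
  | .tgt _ => false
  | .z => R.z
  | .desc i l => R.desc i l
  | .ph i j => R.ph i j
  | .acc i => R.acc i
  | .cnt i j => R.cnt i j
  | .wt j => R.wt j
  | .grd => R.grd

variable (R : Reg P n)

variable [DecidableEq κ]

lemma Reg.update_z (x : Bool) :
    Function.update (R.bits : P.W n κ → Bool) .z x = Reg.bits { R with z := x } := by
  funext i; cases i <;> simp [Reg.bits]

lemma Reg.update_grd (x : Bool) :
    Function.update (R.bits : P.W n κ → Bool) .grd x = Reg.bits { R with grd := x } := by
  funext i; cases i <;> simp [Reg.bits]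

lemma Reg.update_acc (i : Fin (P.K + 1)) (x : Bool) :
    Function.update (R.bits : P.W n κ → Bool) (.acc i) x =
      Reg.bits { R with acc := Function.update R.acc i x } := by
  funext j
  cases j <;> simp [Reg.bits, Function.update_apply]

lemma Reg.update_desc (i : Fin (P.K + 1)) (l : Fin (gateSeq n).length) (x : Bool) :
    Function.update (R.bits : P.W n κ → Bool) (.desc i l) x =
      Reg.bits { R with desc := Function.update R.desc i (Function.update (R.desc i) l x) } := by
  funext j
  cases j with
  | desc i' l' =>
    by_cases h : i' = i
    · subst h
      by_cases h' : l' = l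
      · subst h'; simp [Reg.bits]
      · simp [Reg.bits, h']
    · simp [Reg.bits, h]
  | _ => simp [Reg.bits]

lemma Reg.extend_cnt (t : ℕ) (y : Bits P.cb) :
    Function.extend (P.cntE t) y (R.bits : P.W n κ → Bool) =
      Reg.bits { R with cnt := Function.update R.cnt (P.s t) y } := by
  funext j
  by_cases h : ∃ a, P.cntE t a = j
  · obtain ⟨a, rfl⟩ := h
    rw [(P.cntE t).injective.extend_apply]
    change y a = Function.update R.cnt (P.s t) y (P.s t) a
    rw [Function.update_self]
  · rw [extend_apply_of_ne _ _ _ fun a ha => h ⟨a, ha⟩]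
    cases j with
    | cnt i a =>
      have : i ≠ P.s t := by rintro rfl; exact h ⟨a, rfl⟩
      simp [Reg.bits, this]
    | _ => simp [Reg.bits]

lemma Reg.extend_ph (t : ℕ) (y : Bits 4) :
    Function.extend (P.phE t) y (R.bits : P.W n κ → Bool) =
      Reg.bits { R with ph := Function.update R.ph (P.s t) y } := by
  funext j
  by_cases h : ∃ a, P.phE t a = j
  · obtain ⟨a, rfl⟩ := h
    rw [(P.phE t).injective.extend_apply]
    change y a = Function.update R.ph (P.s t) y (P.s t) a
    rw [Function.update_self]
  · rw [extend_apply_of_ne _ _ _ fun a ha => h ⟨a, ha⟩]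
    cases j with
    | ph i a =>
      have : i ≠ P.s t := by rintro rfl; exact h ⟨a, rfl⟩
      simp [Reg.bits, this]
    | _ => simp [Reg.bits]

lemma Reg.extend_desc (t : ℕ) (y : StabDesc n) :
    Function.extend (P.descE t) y (R.bits : P.W n κ → Bool) =
      Reg.bits { R with desc := Function.update R.desc (P.s t) y } := by
  funext j
  by_cases h : ∃ a, P.descE t a = j
  · obtain ⟨a, rfl⟩ := h
    rw [(P.descE t).injective.extend_apply]
    change y a = Function.update R.desc (P.s t) y (P.s t) a
    rw [Function.update_self]
  · rw [extend_apply_of_ne _ _ _ fun a ha => h ⟨a, ha⟩]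
    cases j with
    | desc i a =>
      have : i ≠ P.s t := by rintro rfl; exact h ⟨a, rfl⟩
      simp [Reg.bits, this]
    | _ => simp [Reg.bits]

lemma Reg.extend_wt (y : Bits (P.h + 1)) :
    Function.extend P.wtE y (R.bits : P.W n κ → Bool) = Reg.bits { R with wt := y } := by
  funext j
  by_cases h : ∃ a, P.wtE a = j
  · obtain ⟨a, rfl⟩ := h
    rw [P.wtE.injective.extend_apply]
    rfl
  · rw [extend_apply_of_ne _ _ _ fun a ha => h ⟨a, ha⟩]
    cases j with
    | wt a => exact absurd ⟨a, rfl⟩ h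
    | _ => simp [Reg.bits]

lemma applyOp_notU_z [Fintype κ] :
    applyOp (wire1 .z) (notU : Matrix (Bits 1) (Bits 1) ℂ) (ket (R.bits : P.W n κ → Bool)) =
      ket (Reg.bits { R with z := !R.z }) := by
  conv_rhs => rw [← Reg.update_z]
  rw [notU_eq, applyOp_permU_ket, extend_wire1]
  congr 2
  exact Bool.xor_true _

end Reg

/-! ### Norm estimation -/

/-- Exponential moments of a Bernoulli variable. -/
lemma bernoulli_mgf_le {p s : ℝ} (hp : 0 ≤ p) (hp1 : p ≤ 1) (hs : |s| ≤ 1) :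
    1 - p + p * Real.exp s ≤ Real.exp (p * s + s ^ 2) := by
  have h1 : Real.exp s ≤ 1 + s + s ^ 2 := by
    have := Real.abs_exp_sub_one_sub_id_le hs
    have := (abs_le.1 this).2
    linarith
  calc 1 - p + p * Real.exp s ≤ (p * s + s ^ 2) + 1 := by nlinarith [sq_nonneg s]
    _ ≤ Real.exp (p * s + s ^ 2) := Real.add_one_le_exp _

/-- Hoeffding's inequality, for functionals of a counter that is incremented with probability `p`
in each of `M` steps: `val j x` is the value with `j` steps left and counter `x`. -/
lemma hoeffding_counter (M : ℕ) {p e Y : ℝ} (hp : 0 ≤ p) (hp1 : p ≤ 1) (he : 0 ≤ e) (he1 : e ≤ 1)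
    (hY : 0 ≤ Y) (val : ℕ → ℕ → ℝ) (h0 : ∀ x, 0 ≤ val 0 x)
    (hgood : ∀ x ≤ M, |(x : ℝ) - M * p| ≤ e * M → Y ≤ val 0 x)
    (hstep : ∀ j x, j + 1 + x ≤ M → p * val j (x + 1) + (1 - p) * val j x ≤ val (j + 1) x) :
    (1 - 2 * Real.exp (-(e ^ 2 * M / 4))) * Y ≤ val M 0 := by
  -- The exponent `s` minimises `s² - s e`, the exponent per step of the two exponential moments.
  set s := e / 2 with hs
  set A := 1 - p + p * Real.exp s with hA
  set B := 1 - p + p * Real.exp (-s) with hB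
  have hs1 : |s| ≤ 1 := by rw [abs_of_nonneg (by positivity)]; linarith
  have key : ∀ j x, j + x ≤ M →
      (1 - (A ^ j * Real.exp (s * (x - M * p - e * M)) +
        B ^ j * Real.exp (-s * (x - M * p + e * M)))) * Y ≤ val j x := by
    intro j
    induction j with
    | zero =>
      intro x hx
      by_cases hg : |(x : ℝ) - M * p| ≤ e * M
      · refine le_trans ?_ (hgood x (by omega) hg)
        have h1 := Real.exp_pos (s * (x - M * p - e * M))
        have h2 := Real.exp_pos (-s * (x - M * p + e * M))
        simp only [pow_zero, one_mul]
        nlinarith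
      · refine le_trans ?_ (h0 x)
        have h1 := Real.exp_pos (s * (x - M * p - e * M))
        have h2 := Real.exp_pos (-s * (x - M * p + e * M))
        refine mul_nonpos_of_nonpos_of_nonneg ?_ hY
        simp only [pow_zero, one_mul]
        have hs0 : 0 ≤ s := by positivity
        rw [abs_le, not_and_or, not_le, not_le] at hg
        rcases hg with hg | hg
        · have : 1 ≤ Real.exp (-s * (x - M * p + e * M)) :=
            Real.one_le_exp (by nlinarith)
          linarith
        · have : 1 ≤ Real.exp (s * (x - M * p - e * M)) :=
            Real.one_le_exp (by nlinarith)
          linarith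
    | succ j ih =>
      intro x hx
      refine le_trans (le_of_eq ?_)
          ((add_le_add (mul_le_mul_of_nonneg_left (ih (x + 1) (by omega)) hp)
        (mul_le_mul_of_nonneg_left (ih x (by omega)) (sub_nonneg.2 hp1))).trans
          (hstep j x (by omega)))
      have e1 : Real.exp (s * ((x + 1 : ℕ) - M * p - e * M)) =
          Real.exp s * Real.exp (s * (x - M * p - e * M)) := by
        rw [← Real.exp_add]; congr 1; push_cast; ring
      have e2 : Real.exp (-s * ((x + 1 : ℕ) - M * p + e * M)) =
          Real.exp (-s) * Real.exp (-s * (x - M * p + e * M)) := by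
        rw [← Real.exp_add]; congr 1; push_cast; ring
      rw [e1, e2, pow_succ, pow_succ]
      simp only [hA, hB]
      ring
  refine le_trans ?_ (key M 0 (by omega))
  refine mul_le_mul_of_nonneg_right ?_ hY
  have hexp : ∀ q : ℝ, 0 ≤ q → q ≤ Real.exp (p * s + s ^ 2) →
      q ^ M * Real.exp (s * (0 - M * p - e * M)) ≤ Real.exp (-(e ^ 2 * M / 4)) := by
    intro q hq0 hq
    calc q ^ M * Real.exp (s * (0 - M * p - e * M)) ≤
        Real.exp (p * s + s ^ 2) ^ M * Real.exp (s * (0 - M * p - e * M)) := by gcongr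
      _ = Real.exp (-(e ^ 2 * M / 4)) := by
        rw [← Real.exp_nat_mul, ← Real.exp_add]; congr 1; rw [hs]; ring
  have hexp' : ∀ q : ℝ, 0 ≤ q → q ≤ Real.exp (p * -s + (-s) ^ 2) →
      q ^ M * Real.exp (-s * (0 - M * p + e * M)) ≤ Real.exp (-(e ^ 2 * M / 4)) := by
    intro q hq0 hq
    calc q ^ M * Real.exp (-s * (0 - M * p + e * M)) ≤
        Real.exp (p * -s + (-s) ^ 2) ^ M * Real.exp (-s * (0 - M * p + e * M)) := by gcongr
      _ = Real.exp (-(e ^ 2 * M / 4)) := by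
        rw [← Real.exp_nat_mul, ← Real.exp_add]; congr 1; rw [hs]; ring
  have h1 := hexp A (by rw [hA]; have := Real.exp_pos s; nlinarith) (bernoulli_mgf_le hp hp1 hs1)
  have h2 := hexp' B (by rw [hB]; have := Real.exp_pos (-s); nlinarith)
    (bernoulli_mgf_le hp hp1 (by rwa [abs_neg]))
  simp only [Nat.cast_zero]
  linarith

section Estimate

variable {n S : ℕ} {A : BaseAlg n S} {P : Par} {U : Matrix.unitaryGroup (Bits n) ℂ} {F : ℕ}
  {κ : Type}

variable (P n κ) in
/-- The programs of the decomposition algorithm. -/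
abbrev Par.Pg : Type := Prog (Access n κ (P.W n κ)) (P.W n κ)

/-- The work register for norm estimation. -/
def Par.workT : P.Target n κ := ⟨P.tgtE, fun _ h => h⟩

/-- One attempt to prepare the residual state, counted in the register `cnt t` if it succeeds. -/
def Par.trial (t : ℕ) : P.Pg n κ :=
  .seq (.gate (wire1 .z) notU) (.seq (P.attempt t P.workT)
    (.branch .z (.gate (wire1 .z) notU)
      (.seq (resetAll ((List.finRange n).map P.tgtE)) (.gate (P.cntE t) (permU (incPerm P.cb))))))

/-- The residual vector that the registers describe. -/
def Reg.res (R : Reg P n) (ψ : Vec n) (t : ℕ) : Vec n :=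
  ψ - ∑ i ∈ Finset.range t,
    (((1 / 2 : ℝ) ^ P.h : ℝ) : ℂ) • omegaOf (R.ph (P.s i)) • (R.desc (P.s i)).state

lemma residual_bits (R : Reg P n) (ψ : Vec n) (t : ℕ) :
    residual P ψ (R.bits : P.W n κ → Bool) t = R.res ψ t := rfl

/-- The success probability of an attempt. -/
def Reg.prob (R : Reg P n) (ψ : Vec n) (t : ℕ) : ℝ := nsq (R.res ψ t) / P.Lam t ^ 2

lemma nsq_succVec (R : Reg P n) (ψ : Vec n) (t : ℕ) :
    nsq (P.succVec ψ (R.bits : P.W n κ → Bool) t) = R.prob ψ t := by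
  rw [Par.succVec, nsq_smul, residual_bits, Complex.norm_real, Reg.prob, Real.norm_eq_abs, sq_abs]
  ring

/-- The registers after the counter `cnt t` has been set to `y`. -/
def Reg.setCnt (R : Reg P n) (t : ℕ) (y : Bits P.cb) : Reg P n :=
  { R with cnt := Function.update R.cnt (P.s t) y }

/-- The phases in the first `t` slots are units. -/
def Reg.Units (R : Reg P n) (t : ℕ) : Prop := ∀ i < t, ‖omegaOf (R.ph (P.s i))‖ = 1

lemma suppOn_ket_bits [Fintype κ] [DecidableEq κ] (R : Reg P n) :
    SuppOn (ket (R.bits : P.W n κ → Bool)) (Agrees R.bits) :=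
  (suppOn_ket _).mono fun b hb i _ => by rw [hb]

lemma Reg.prob_le_one (A : BaseAlg n S) (R : Reg P n) (ψ : Vec n)
    (hU : (U : Matrix (Bits n) (Bits n) ℂ) *ᵥ ket (zeroBits n) = ψ) {t : ℕ} (ht : t ≤ 2 ^ P.m)
    (hω : R.Units t) : R.prob ψ t ≤ 1 := by
  have hω1 : ∀ i < t, ‖slotOmega (R.bits : P.W n A.wire → Bool) i‖ = 1 := hω
  have hw : SuppOn (ket (R.bits : P.W n A.wire → Bool))
      fun b => ∀ j, b ((P.workT : P.Target n A.wire).emb j) = false :=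
    (suppOn_ket _).mono fun b hb j => by rw [hb]; rfl
  obtain ⟨ξ, h1, h0, -⟩ := wp_lcu (A := A) (F := 0) (tg := P.workT) ψ hU
    (suppOn_ket_bits R) (fun a => rfl) hw ht hω1
  rw [← nsq_succVec (κ := A.wire), Par.succVec, ← h0, ← h1]
  exact Finset.single_le_sum (fun y _ => nsq_nonneg (ξ y)) (Finset.mem_univ _)

/-- A trial increments the counter with the success probability of an attempt. Both outcomes leave
the quantum registers clean, so that the state is again a basis vector. -/
lemma le_wp_trial (ψ : Vec n) (hU : (U : Matrix (Bits n) (Bits n) ℂ) *ᵥ ket (zeroBits n) = ψ)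
    (R : Reg P n) (hz : R.z = false) {t : ℕ} (ht : t ≤ 2 ^ P.m) (hω : R.Units t)
    (G : Post (P.W n A.wire)) (τ q m : ℕ) :
    R.prob ψ t * G ⟨ket (R.setCnt t (incPerm P.cb (R.cnt (P.s t)))).bits,
        τ + (P.trial t : P.Pg n A.wire).size, q + 1, m⟩ +
      (1 - R.prob ψ t) * G ⟨ket R.bits, τ + (P.trial t : P.Pg n A.wire).size, q + 1, m⟩ ≤
      wp (accessSem A _ U F) F (P.trial t) G ⟨ket R.bits, τ, q, m⟩ := by
  have hzz : ({ R with z := !true } : Reg P n) = R := by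
    cases R; simp only [Bool.not_true] at hz ⊢; rw [hz]
  conv_rhs => rw [Par.trial, wp_seq, wp_gate, applyOp_notU_z, hz, wp_seq]
  simp only [Bool.not_false]
  set R1 : Reg P n := { R with z := true } with hR1
  have hR1' : ({ R1 with z := !R1.z } : Reg P n) = R := hzz
  have hprob : R1.prob ψ t = R.prob ψ t := rfl
  have hω1 : ∀ i < t, ‖slotOmega (R1.bits : P.W n A.wire → Bool) i‖ = 1 := hω
  have hw : SuppOn (ket (R1.bits : P.W n A.wire → Bool))
      fun b => ∀ j, b ((P.workT : P.Target n A.wire).emb j) = false :=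
    (suppOn_ket _).mono fun b hb j => by rw [hb]; rfl
  refine le_trans ?_ (le_wp_attempt (F := F) (tg := P.workT) ψ hU (suppOn_ket_bits R1)
    (fun a => rfl) rfl hw ht hω1 _ _ _ _)
  rw [applyOp_notU_z, nsq_succVec, hR1', hprob]
  have hsz : (P.trial t : P.Pg n A.wire).size =
      4 + ((P.attempt t P.workT : P.Pg n A.wire).size +
        (1 + 4 + (6 * n + 1 + 4 ^ P.cb))) := by
    simp [Par.trial, Prog.size, size_resetAll]
  refine add_le_add ?_ (mul_le_mul_of_nonneg_left ?_ ?_)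
  · rw [wp_branch_false, wp_seq]
    · have hr := nsq_mul_le_wp_resetAll (accessSem A _ U F) F P.tgtE
        (wp (accessSem A _ U F) F (.gate (P.cntE t) (permU (incPerm P.cb))) G) (List.finRange n)
        (P.succVec ψ (R1.bits : P.W n A.wire → Bool) t) (ket R.bits)
        (τ + 4 ^ 1 + (P.attempt t P.workT : P.Pg n A.wire).size + 1) (q + 1) m
        ((suppOn_ket _).mono fun b hb j => by rw [hb]; rfl)
        fun j hj => absurd (List.mem_finRange j) hj
      refine le_trans ?_ hr
      rw [nsq_succVec, hprob, wp_gate, applyOp_permU_ket, Reg.extend_cnt]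
      refine mul_le_mul_of_nonneg_left (G.anti _ ?_ le_rfl le_rfl) ?_
      · rw [hsz, List.length_finRange]
        generalize 4 ^ P.cb = c
        omega
      · exact div_nonneg (nsq_nonneg _) (sq_nonneg _)
    · exact ((suppOn_ket (R.bits : P.W n A.wire → Bool)).mono fun b hb => by
        rw [hb]; exact hz).fill_disjoint (i := .z) (r := false)
          fun j => ((P.workT : P.Target n A.wire).ne Par.z_ctl j).symm
  · rw [wp_branch_true, wp_gate, applyOp_notU_z, hR1']
    · refine G.anti _ ?_ le_rfl le_rfl
      rw [hsz]
      generalize 4 ^ P.cb = c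
      omega
    · exact (suppOn_ket (R1.bits : P.W n A.wire → Bool)).mono fun b hb => by rw [hb]; rfl
  · exact sub_nonneg.2 (R.prob_le_one A ψ hU ht hω)

lemma Reg.setCnt_setCnt (R : Reg P n) (t : ℕ) (y y' : Bits P.cb) :
    (R.setCnt t y).setCnt t y' = R.setCnt t y' := by
  simp [Reg.setCnt]

lemma Reg.setCnt_self (R : Reg P n) (t : ℕ) : R.setCnt t (R.cnt (P.s t)) = R := by
  simp [Reg.setCnt]

/-- Estimation of the squared norm of the residual vector by `M` attempts. -/
def Par.est (M t : ℕ) : P.Pg n κ := .seqs (List.replicate M (P.trial t))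

lemma Par.size_est (M t : ℕ) : (P.est M t : P.Pg n κ).size =
    M * (P.trial t : P.Pg n κ).size + 1 := by
  simp [Par.est, Prog.size_seqs]

/-- After an estimation the counter is within `e * M` of its mean, up to the failure probability
from Hoeffding's inequality. -/
lemma le_wp_est (ψ : Vec n) (hU : (U : Matrix (Bits n) (Bits n) ℂ) *ᵥ ket (zeroBits n) = ψ)
    (R : Reg P n) (hz : R.z = false) {t : ℕ} (ht : t ≤ 2 ^ P.m) (hω : R.Units t)
    (hc : R.cnt (P.s t) = zeroBits P.cb) (M : ℕ) {e Y : ℝ} (he : 0 ≤ e) (he1 : e ≤ 1) (hY : 0 ≤ Y)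
    (G : Post (P.W n A.wire)) (τ q m : ℕ)
    (hG : ∀ x ≤ M, |(x : ℝ) - M * R.prob ψ t| ≤ e * M →
      Y ≤ G ⟨ket (R.setCnt t (enc P.cb x)).bits, τ + (P.est M t : P.Pg n A.wire).size, q + M, m⟩) :
    (1 - 2 * Real.exp (-(e ^ 2 * M / 4))) * Y ≤
      wp (accessSem A _ U F) F (P.est M t) G ⟨ket R.bits, τ, q, m⟩ := by
  have hp0 : 0 ≤ R.prob ψ t := div_nonneg (nsq_nonneg _) (sq_nonneg _)
  have hR0 : R = R.setCnt t (enc P.cb 0) := by rw [enc_zero, ← hc, Reg.setCnt_self]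
  set sz := (P.trial t : P.Pg n A.wire).size with hsz
  have key := hoeffding_counter M hp0 (R.prob_le_one A ψ hU ht hω) he he1 hY
    (fun j x => wp (accessSem A _ U F) F (.seqs (List.replicate j (P.trial t))) G
      ⟨ket (R.setCnt t (enc P.cb x)).bits, τ + (M - j) * sz, q + (M - j), m⟩)
    (fun x => Post.nonneg _ _) ?_ ?_
  · simp only [Nat.sub_self, zero_mul, add_zero] at key
    rwa [← hR0] at key
  · intro x hx hxp
    refine (hG x hx hxp).trans (le_of_eq ?_)
    simp only [List.replicate_zero, Prog.seqs, wp_skip, Par.size_est, Nat.sub_zero, ← hsz,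
      add_assoc]
  · intro j x hjx
    have h := le_wp_trial (F := F) ψ hU (R.setCnt t (enc P.cb x)) hz ht hω
      (wp (accessSem A _ U F) F (.seqs (List.replicate j (P.trial t))) G)
      (τ + (M - (j + 1)) * sz) (q + (M - (j + 1))) m
    rw [← wp_seq] at h
    have e1 : (R.setCnt t (enc P.cb x)).setCnt t
        (incPerm P.cb ((R.setCnt t (enc P.cb x)).cnt (P.s t))) = R.setCnt t (enc P.cb (x + 1)) := by
      rw [Reg.setCnt_setCnt, ← incPerm_enc]
      simp [Reg.setCnt]
    have e2 : τ + (M - (j + 1)) * sz + sz = τ + (M - j) * sz := by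
      rw [add_assoc, ← Nat.succ_mul]
      congr 2; omega
    have e3 : q + (M - (j + 1)) + 1 = q + (M - j) := by omega
    rw [e1, ← hsz, e2, e3] at h
    exact h

end Estimate

/-! ### Loops and subroutine calls -/

section Loop

variable {E κ ι : Type}

/-- The sum of a postcondition over all branches of a loop with at most `k` tests. -/
def wpLoop (σ : Sem E ι) (F : ℕ) (i : ι) (p : Prog E ι) (G : Post ι) (k : ℕ) : Post ι where
  val c := ((loopRun i (p.run (Function.Embedding.refl ι) σ.run F) k c).map G).sum
  nonneg' c := List.sum_nonneg (by
    intro x hx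
    obtain ⟨c', -, rfl⟩ := List.mem_map.1 hx
    exact G.nonneg c')
  smul' z c := by
    rw [loopRun_act _ _ _ _ _ _ (Prog.run_act _ σ F p z 0 0 0), List.map_map,
      ← List.sum_map_mul_left]
    congr 1
    exact List.map_congr_left fun c' _ => G.smul' z c'
  anti' t q m c := by
    rw [loopRun_act _ _ _ _ _ _ (Prog.run_act _ σ F p 1 t q m), List.map_map]
    exact List.sum_le_sum fun c' _ => G.anti' t q m c'

variable (σ : Sem E ι) (F : ℕ)

lemma wp_loop (i : ι) (p : Prog E ι) (G : Post ι) (c : Conf ι) :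
    wp σ F (.loop i p) G c = wpLoop σ F i p G F c := rfl

lemma wpLoop_succ (i : ι) (p : Prog E ι) (G : Post ι) (k : ℕ) (v : State ι) (t q m : ℕ) :
    wpLoop σ F i p G (k + 1) ⟨v, t, q, m⟩ = G ⟨projWire i false v, t + 1, q, m⟩ +
      wp σ F p (wpLoop σ F i p G k) ⟨projWire i true v, t + 1, q, m⟩ := by
  simp only [wpLoop, loopRun, List.map_cons, List.sum_cons, sum_map_flatMap]
  rfl

lemma wpLoop_succ_false {i : ι} (p : Prog E ι) (G : Post ι) (k : ℕ) {v : State ι} (t q m : ℕ)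
    (h : SuppOn v fun b => b i = false) :
    wpLoop σ F i p G (k + 1) ⟨v, t, q, m⟩ = G ⟨v, t + 1, q, m⟩ := by
  rw [wpLoop_succ, projWire_of_suppOn h, projWire_of_suppOn_ne h (by simp), Post.zero, add_zero]

lemma wpLoop_succ_true {i : ι} (p : Prog E ι) (G : Post ι) (k : ℕ) {v : State ι} (t q m : ℕ)
    (h : SuppOn v fun b => b i = true) :
    wpLoop σ F i p G (k + 1) ⟨v, t, q, m⟩ =
      wp σ F p (wpLoop σ F i p G k) ⟨v, t + 1, q, m⟩ := by
  rw [wpLoop_succ, projWire_of_suppOn h, projWire_of_suppOn_ne h (by simp), Post.zero, zero_add]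

lemma loopRun_sublist (i : ι) {body body' : Conf ι → List (Conf ι)}
    (h : ∀ c, (body c).Sublist (body' c)) {k k' : ℕ} (hk : k ≤ k') (c : Conf ι) :
    (loopRun i body k c).Sublist (loopRun i body' k' c) := by
  induction k generalizing k' c with
  | zero => exact List.nil_sublist _
  | succ k ih =>
    obtain ⟨k', rfl⟩ := Nat.exists_eq_add_of_le' (show 1 ≤ k' by omega)
    simp only [loopRun]
    refine List.Sublist.cons_cons _ (((h _).flatMap _).trans
      (List.Sublist.flatMap_right _ fun a _ => ?_))
    exact ih (by omega) a

/-- More fuel only adds branches. -/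
lemma Prog.run_sublist (f : κ ↪ ι) (sem : E → Conf ι → List (Conf ι)) {F F' : ℕ} (h : F ≤ F')
    (p : Prog E κ) (c : Conf ι) : (p.run f sem F c).Sublist (p.run f sem F' c) := by
  induction p generalizing c with
  | skip => exact List.Sublist.refl _
  | gate => exact List.Sublist.refl _
  | ext => exact List.Sublist.refl _
  | seq p q ihp ihq =>
    exact ((ihp c).flatMap _).trans (List.Sublist.flatMap_right _ fun a _ => ihq a)
  | branch i p q ihp ihq => exact (ihp _).append (ihq _)
  | loop i p ih => exact loopRun_sublist _ ih h c

/-- A branch of a subroutine on the register `w`, as a branch of the whole computation. -/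
def Conf.embed (w : κ ↪ ι) (v : State ι) (t q m : ℕ) (c : Conf κ) : Conf ι :=
  ⟨fill w c.state v, c.time + t, c.queries + q, c.calls + m⟩

lemma Conf.measure_embed (w : κ ↪ ι) (v : State ι) (t q m : ℕ) (i : κ) (r : Bool) (c : Conf κ) :
    (c.embed w v t q m).measure (w i) r = (c.measure i r).embed w v t q m := by
  simp only [Conf.measure, Conf.embed, Conf.mk.injEq, and_true]
  exact ⟨projWire_fill i r w c.state v, by omega⟩

lemma loopRun_embed (w : κ ↪ ι) (v : State ι) (t q m : ℕ) (i : κ)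
    {body : Conf ι → List (Conf ι)} {body' : Conf κ → List (Conf κ)}
    (h : ∀ c, body (c.embed w v t q m) = (body' c).map (Conf.embed w v t q m)) (k : ℕ)
    (c : Conf κ) : loopRun (w i) body k (c.embed w v t q m) =
      (loopRun i body' k c).map (Conf.embed w v t q m) := by
  induction k generalizing c with
  | zero => rfl
  | succ k ih =>
    simp only [loopRun, Conf.measure_embed, h, List.map_cons, List.flatMap_map, List.map_flatMap,
      ih]

/-- A program on a register does not affect the other wires. -/
lemma Prog.run_embed (w : κ ↪ ι) (v : State ι) (t q m F : ℕ) (p : Prog Empty κ) (c : Conf κ) :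
    p.run w (fun e => e.elim) F (c.embed w v t q m) =
      (p.run (Function.Embedding.refl κ) (fun e => e.elim) F c).map (Conf.embed w v t q m) := by
  induction p generalizing c with
  | skip => simp [Prog.run, Conf.embed]; omega
  | gate l M =>
    simp only [Prog.run, Conf.embed, applyOp_fill, List.map_cons, List.map_nil, List.cons.injEq,
      Conf.mk.injEq, and_true]
    exact ⟨rfl, by omega⟩
  | ext e => exact e.elim
  | seq p q ihp ihq => simp only [Prog.run, ihp, List.flatMap_map, List.map_flatMap, ihq]
  | branch i p q ihp ihq =>
    simp only [Prog.run, Conf.measure_embed, ihp, ihq, List.map_append]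
    rfl
  | loop i p ih =>
    simp only [Prog.run]
    exact loopRun_embed w v t q m i ih F c

/-- The wires on which the gates of a program act. -/
def Prog.wires : Prog E κ → List κ
  | .skip => []
  | .gate w _ => List.ofFn w
  | .ext _ => []
  | .seq p q => p.wires ++ q.wires
  | .branch _ p q => p.wires ++ q.wires
  | .loop _ p => p.wires

lemma Prog.length_wires_le (p : Prog E κ) : p.wires.length ≤ p.size := by
  induction p with
  | skip => simp [Prog.wires]
  | @gate k w M =>
    simp only [Prog.wires, List.length_ofFn, Prog.size]
    exact (Nat.lt_pow_self (by norm_num)).le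
  | ext => simp [Prog.wires]
  | seq p q ihp ihq => simp only [Prog.wires, List.length_append, Prog.size]; omega
  | branch i p q ihp ihq => simp only [Prog.wires, List.length_append, Prog.size]; omega
  | loop i p ih => simp only [Prog.wires, Prog.size]; omega

/-- The wires outside of `l` are `0`, and the branch has made no query and no call. -/
def Conf.Clean (l : List κ) (c : Conf κ) : Prop :=
  (∀ j, j ∉ l → SuppOn c.state fun b => b j = false) ∧ c.queries = 0 ∧ c.calls = 0

lemma Conf.Clean.measure {l : List κ} {c : Conf κ} (h : c.Clean l) (i : κ) (r : Bool) :
    (c.measure i r).Clean l :=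
  ⟨fun j hj b hb => h.1 j hj b fun h0 => hb (by simp [Conf.measure, h0]), h.2⟩

lemma loopRun_clean {l : List κ} {i : κ} {body : Conf κ → List (Conf κ)}
    (h : ∀ c : Conf κ, c.Clean l → ∀ c' ∈ body c, c'.Clean l) (k : ℕ) (c : Conf κ)
    (hc : c.Clean l) : ∀ c' ∈ loopRun i body k c, c'.Clean l := by
  induction k generalizing c with
  | zero => intro c' hc'; simp [loopRun] at hc'
  | succ k ih =>
    intro c' hc'
    rw [loopRun, List.mem_cons, List.mem_flatMap] at hc'
    rcases hc' with rfl | ⟨c1, h1, h2⟩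
    · exact hc.measure i _
    · exact ih c1 (h _ (hc.measure i _) c1 h1) c' h2

/-- Wires that a program without external instructions does not mention stay `0`. After a call of
the subroutine it therefore suffices to reset the wires in `BaseAlg.touched`: the input and the
wires that its program mentions, whatever the total number of its wires. -/
lemma Prog.run_clean (F : ℕ) (p : Prog Empty κ) {l : List κ} (hl : p.wires ⊆ l) (c : Conf κ)
    (hc : c.Clean l) : ∀ c' ∈ p.run (Function.Embedding.refl κ) (fun e => e.elim) F c,
      c'.Clean l := by
  induction p generalizing c with
  | skip =>
    intro c' hc'
    rw [Prog.run, List.mem_singleton] at hc'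
    rw [hc']; exact hc
  | gate w M =>
    intro c' hc'
    rw [Prog.run, List.mem_singleton] at hc'
    rw [hc']
    refine ⟨fun j hj => (hc.1 j hj).applyOp_disjoint fun a ha => hj (hl ?_), hc.2⟩
    rw [Prog.wires, List.mem_ofFn]
    exact ⟨a, ha⟩
  | ext e => exact e.elim
  | seq p q ihp ihq =>
    rw [Prog.wires, List.append_subset] at hl
    intro c' hc'
    rw [Prog.run, List.mem_flatMap] at hc'
    obtain ⟨c1, h1, h2⟩ := hc'
    exact ihq hl.2 c1 (ihp hl.1 c hc c1 h1) c' h2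
  | branch i p q ihp ihq =>
    rw [Prog.wires, List.append_subset] at hl
    intro c' hc'
    rw [Prog.run, List.mem_append] at hc'
    rcases hc' with h | h
    · exact ihp hl.1 _ (hc.measure _ _) c' h
    · exact ihq hl.2 _ (hc.measure _ _) c' h
  | loop i p ih => exact loopRun_clean (fun c hc => ih hl c hc) F c hc

end Loop

section Fill

variable {κ κ' ι : Type}

lemma fill_trans (l : κ' ↪ κ) (w : κ ↪ ι) (u : State κ') (s : State κ) (v : State ι) :
    fill (l.trans w) u (fill w s v) = fill w (fill l u s) v := by
  funext b
  simp only [fill]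
  have h1 : (fun j => Function.extend (l.trans w) (fun _ => false) b (w j)) =
      Function.extend l (fun _ => false) fun j => b (w j) := by
    funext j
    by_cases h : ∃ i, l i = j
    · obtain ⟨i, rfl⟩ := h
      rw [l.injective.extend_apply]
      exact (l.trans w).injective.extend_apply _ b i
    · rw [Function.extend_apply' _ _ _ h, Function.extend_apply']
      rintro ⟨i, hi⟩
      exact h ⟨i, w.injective hi⟩
  have h2 : Function.extend w (fun _ => false) (Function.extend (l.trans w) (fun _ => false) b) =
      Function.extend w (fun _ => false) b := by
    funext i
    by_cases h : ∃ j, w j = i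
    · obtain ⟨j, rfl⟩ := h
      rw [w.injective.extend_apply, w.injective.extend_apply]
    · rw [Function.extend_apply' _ _ _ h, Function.extend_apply' _ _ _ h,
        Function.extend_apply']
      rintro ⟨j, hj⟩
      exact h ⟨l j, hj⟩
  rw [h1, h2, mul_assoc]
  rfl

lemma fill_ket_ket [Fintype κ] [Fintype ι] (w : κ ↪ ι) (y : κ → Bool) (r : ι → Bool)
    (hr : ∀ j, r (w j) = false) : fill w (ket y) (ket r) = ket (Function.extend w y r) := by
  funext b
  rw [fill, ket_apply, ket_apply, ket_apply]
  have h : b = Function.extend w y r ↔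
      (fun j => b (w j)) = y ∧ Function.extend w (fun _ => false) b = r := by
    constructor
    · rintro rfl
      refine ⟨extend_comp _ _ _, ?_⟩
      rw [extend_extend]
      have : (fun _ : κ => false) = fun j => r (w j) := by funext j; rw [hr]
      rw [this, extend_self]
    · rintro ⟨h1, h2⟩
      rw [← h2, extend_extend, ← h1, extend_self]
  simp only [h]
  by_cases h1 : (fun j => b (w j)) = y <;> simp [h1]

end Fill

/-! ### Preparation of the copies -/

/-- The analysis of a loop that stops with probability `p` in each round: `f a` is the value of
stopping and `V a j` the value of continuing, after a total of `a` rounds and with `j` tests left.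
If stopping is worth `Y` up to a loss that grows like `(1 + p / 2) ^ a`, then so is the loop. -/
lemma loop_value {p Y Z : ℝ} (hp : 0 ≤ p) (hY : 0 ≤ Y) (hZ : 1 ≤ Z) (B : ℕ)
    (f : ℕ → ℝ) (V : ℕ → ℕ → ℝ) (hV : ∀ a j, 0 ≤ V a j) (hp1 : p ≤ 1)
    (hstep : ∀ a j, p * f (a + 1) + (1 - p) * V (a + 1) (j + 1) ≤ V a (j + 2))
    (hf : ∀ a, (1 - Z * ((1 + p / 2) ^ a / (1 + p / 2) ^ B)) * Y ≤ f a) (j a : ℕ)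
    (h : B + 1 ≤ a + j) :
    (1 - 2 * Z * ((1 + p / 2) ^ a / (1 + p / 2) ^ B)) * Y ≤ V a j := by
  have hx : 1 ≤ 1 + p / 2 := by linarith
  have htriv : ∀ a j, B ≤ a → (1 - 2 * Z * ((1 + p / 2) ^ a / (1 + p / 2) ^ B)) * Y ≤ V a j := by
    intro a j ha
    refine le_trans (mul_nonpos_of_nonpos_of_nonneg ?_ hY) (hV a j)
    have : 1 ≤ (1 + p / 2) ^ a / (1 + p / 2) ^ B :=
      (one_le_div (by positivity)).2 (pow_le_pow_right₀ hx ha)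
    nlinarith
  induction j using Nat.strong_induction_on generalizing a with
  | _ j ih =>
    match j with
    | 0 => exact htriv a 0 (by omega)
    | 1 => exact htriv a 1 (by omega)
    | j + 2 =>
      refine le_trans ?_ ((add_le_add (mul_le_mul_of_nonneg_left (hf (a + 1)) hp)
        (mul_le_mul_of_nonneg_left (ih (j + 1) (by omega) (a + 1) (by omega))
          (sub_nonneg.2 hp1))).trans (hstep a j))
      have hw : 0 ≤ (1 + p / 2) ^ a / (1 + p / 2) ^ B := by positivity
      rw [pow_succ, mul_div_right_comm]
      generalize (1 + p / 2) ^ a / (1 + p / 2) ^ B = w at hw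
      have h2 : 0 ≤ Z * w * p ^ 2 * Y := by positivity
      nlinarith

section Copies

variable {n S : ℕ} {A : BaseAlg n S} {P : Par} {U : Matrix.unitaryGroup (Bits n) ℂ} {F : ℕ}

/-- The wires of the `c`-th copy. -/
def BaseAlg.inpE (A : BaseAlg n S) (c : Fin S) : Fin n ↪ A.wire :=
  ⟨fun j => A.inp (c, j), fun a b h => by simpa using A.inp.injective h⟩

/-- The wires of the `c`-th copy for the subroutine, as a target. -/
def Par.copyT (P : Par) (A : BaseAlg n S) (c : Fin S) : P.Target n A.wire :=
  ⟨(A.inpE c).trans P.subE, fun _ h => h⟩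

/-- Attempts to prepare the `c`-th copy of the residual state, until one succeeds. -/
def Par.copy (P : Par) (A : BaseAlg n S) (t : ℕ) (c : Fin S) : P.Pg n A.wire :=
  .seq (.gate (wire1 .z) notU) (.loop .z (P.attempt t (P.copyT A c)))

lemma Par.size_attempt_eq {κ κ' : Type} (t : ℕ) (tg : P.Target n κ) (tg' : P.Target n κ') :
    (P.attempt t tg).size = (P.attempt t tg').size := by
  simp [Par.attempt, Par.lcu, Prog.size, Prog.size_seqs, size_measAll, size_resetAll, Par.zGate,
    Function.comp_def, Par.slotProg, Par.slotGate, Par.phaseGate]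

/-- The normalised residual state. -/
def Reg.unit (R : Reg P n) (ψ : Vec n) (t : ℕ) : Vec n :=
  ((1 / Real.sqrt (nsq (R.res ψ t)) : ℝ) : ℂ) • R.res ψ t

lemma Reg.unit_isState (R : Reg P n) (ψ : Vec n) (t : ℕ) (h : 0 < nsq (R.res ψ t)) :
    IsState (R.unit ψ t) := by
  change nsq (R.unit ψ t) = 1
  rw [Reg.unit, nsq_smul, Complex.norm_real, Real.norm_eq_abs, sq_abs, div_pow, Real.sq_sqrt h.le]
  field_simp

lemma Reg.succVec_eq {κ : Type} (R : Reg P n) (ψ : Vec n) (t : ℕ) (h : 0 < nsq (R.res ψ t)) :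
    P.succVec ψ (R.bits : P.W n κ → Bool) t =
      ((Real.sqrt (R.prob ψ t) : ℝ) : ℂ) • R.unit ψ t := by
  have h1 := Real.sqrt_pos.2 h
  rw [Par.succVec, residual_bits, Reg.unit, smul_smul, ← Complex.ofReal_mul, Reg.prob,
    Real.sqrt_div h.le, Real.sqrt_sq (P.Lam_pos t).le]
  congr 2
  have := P.Lam_pos t
  field_simp

lemma suppOn_fill_sub (R : Reg P n) (s : State A.wire) :
    SuppOn (fill P.subE s (ket (R.bits : P.W n A.wire → Bool))) (Agrees R.bits) := by
  refine (suppOn_ket_bits R).fill fun b hb i hi => ?_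
  rw [← hb i hi, extend_apply_of_ne]
  rintro j rfl
  exact hi

/-- The registers with the failure wire set. -/
def Reg.raise (R : Reg P n) : Reg P n := { R with z := true }

lemma Reg.raise_flip (R : Reg P n) (hz : R.z = false) :
    ({ R.raise with z := !R.raise.z } : Reg P n) = R := by
  cases R; simp only at hz; simp [Reg.raise, hz]

lemma applyOp_notU_fill_sub (R : Reg P n) (s : State A.wire) :
    applyOp (wire1 .z) (notU : Matrix (Bits 1) (Bits 1) ℂ)
      (fill P.subE s (ket (R.bits : P.W n A.wire → Bool))) =
      fill P.subE s (ket (Reg.bits { R with z := !R.z })) := by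
  rw [applyOp_fill_disjoint, applyOp_notU_z]
  intro i j h; injection h

/-- One attempt to prepare the `c`-th copy, while other copies are present already. -/
lemma le_wp_attempt_copy (ψ : Vec n)
    (hU : (U : Matrix (Bits n) (Bits n) ℂ) *ᵥ ket (zeroBits n) = ψ)
    (R : Reg P n) (hz : R.z = false) {t : ℕ} (ht : t ≤ 2 ^ P.m) (hω : R.Units t)
    (hr : 0 < nsq (R.res ψ t)) (c : Fin S) (s : State A.wire)
    (hs : ∀ j, SuppOn s fun b => b (A.inp (c, j)) = false) (G : Post (P.W n A.wire)) (τ q m : ℕ) :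
    R.prob ψ t * G ⟨fill P.subE (fill (A.inpE c) (R.unit ψ t) s) (ket R.bits),
        τ + (P.attempt t (P.copyT A c)).size, q + 1, m⟩ +
      (1 - R.prob ψ t) * G ⟨fill P.subE s (ket R.raise.bits),
        τ + (P.attempt t (P.copyT A c)).size, q + 1, m⟩ ≤
      wp (accessSem A _ U F) F (P.attempt t (P.copyT A c)) G
        ⟨fill P.subE s (ket R.raise.bits), τ, q, m⟩ := by
  have hp0 : 0 ≤ R.prob ψ t := div_nonneg (nsq_nonneg _) (sq_nonneg _)
  have hω1 : ∀ i < t, ‖slotOmega (R.raise.bits : P.W n A.wire → Bool) i‖ = 1 := hω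
  have hv0 : SuppOn (fill P.subE s (ket (R.raise.bits : P.W n A.wire → Bool)))
      fun b => ∀ j, b ((P.copyT A c).emb j) = false :=
    fun b hb j => hs j _ (left_ne_zero_of_mul hb)
  have h1 := le_wp_attempt (F := F) ψ hU (suppOn_fill_sub R.raise s) (fun a => rfl) rfl hv0 ht hω1
    G τ q m
  have h2 : P.succVec ψ (R.raise.bits : P.W n A.wire → Bool) t =
      ((Real.sqrt (R.prob ψ t) : ℝ) : ℂ) • R.unit ψ t := R.raise.succVec_eq ψ t hr
  have h3 : fill (P.copyT A c).emb (R.unit ψ t) (fill P.subE s (ket R.bits)) =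
      fill P.subE (fill (A.inpE c) (R.unit ψ t) s) (ket R.bits) := fill_trans _ _ _ _ _
  have h4 : nsq (((Real.sqrt (R.prob ψ t) : ℝ) : ℂ) • R.unit ψ t) = R.prob ψ t := by
    rw [← h2, nsq_succVec]; rfl
  rw [applyOp_notU_fill_sub, R.raise_flip hz, h2, h4, fill_smul_left, Post.smul,
    Complex.norm_real, Real.norm_eq_abs, sq_abs, Real.sq_sqrt hp0, h3] at h1
  exact h1

/-- The register of the subroutine, filled with copies of `u`. -/
def BaseAlg.copies (A : BaseAlg n S) (u : Vec n) (L : List (Fin S)) (s : State A.wire) :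
    State A.wire := L.foldl (fun s c => fill (A.inpE c) u s) s

/-- Preparation of the copies with a budget of `B` attempts in total, `a` of which are spent. The
loss is the exponential Markov bound for the number of attempts: each success contributes a factor
of at most `2` to the expectation of `(1 + p / 2) ^ (number of attempts)`. -/
lemma le_wp_copies (ψ : Vec n) (hU : (U : Matrix (Bits n) (Bits n) ℂ) *ᵥ ket (zeroBits n) = ψ)
    (R : Reg P n) (hz : R.z = false) {t : ℕ} (ht : t ≤ 2 ^ P.m) (hω : R.Units t)
    (hr : 0 < nsq (R.res ψ t)) {B κ : ℕ} (hF : B + 1 ≤ F)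
    (hκ : κ = (P.attempt t P.workT : P.Pg n A.wire).size + 1) (L : List (Fin S)) (hL : L.Nodup)
    (s : State A.wire) (hs : ∀ c ∈ L, ∀ j, SuppOn s fun b => b (A.inp (c, j)) = false) {Y : ℝ}
    (hY : 0 ≤ Y) (G : Post (P.W n A.wire)) (τ q m : ℕ)
    (hG : ∀ a ≤ B, Y ≤ G ⟨fill P.subE (A.copies (R.unit ψ t) L s) (ket R.bits),
      τ + 5 * L.length + 1 + a * κ, q + a, m⟩) (a : ℕ) :
    (1 - 2 ^ L.length * ((1 + R.prob ψ t / 2) ^ a / (1 + R.prob ψ t / 2) ^ B)) * Y ≤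
      wp (accessSem A _ U F) F (.seqs (L.map (P.copy A t))) G
        ⟨fill P.subE s (ket R.bits), τ + a * κ, q + a, m⟩ := by
  have hp0 : 0 ≤ R.prob ψ t := div_nonneg (nsq_nonneg _) (sq_nonneg _)
  have hp1 := R.prob_le_one A ψ hU ht hω
  induction L generalizing s τ a with
  | nil =>
    simp only [List.map_nil, Prog.seqs, wp_skip, List.length_nil, pow_zero, one_mul]
    have hx : 1 ≤ 1 + R.prob ψ t / 2 := by linarith
    by_cases ha : a ≤ B
    · have hw : 0 ≤ (1 + R.prob ψ t / 2) ^ a / (1 + R.prob ψ t / 2) ^ B := by positivity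
      have h1 := hG a ha
      simp only [BaseAlg.copies, List.foldl_nil, List.length_nil, mul_zero, add_zero] at h1
      rw [add_right_comm]
      nlinarith
    · refine le_trans (mul_nonpos_of_nonpos_of_nonneg ?_ hY) (Post.nonneg _ _)
      rw [sub_nonpos, one_le_div (by positivity)]
      exact pow_le_pow_right₀ hx (by omega)
  | cons c L ih =>
    rw [List.nodup_cons] at hL
    have hz1 : ({ R with z := !R.z } : Reg P n) = R.raise := by rw [hz]; rfl
    have hsupp : ∀ (R : Reg P n) s, SuppOn (fill P.subE s (ket (R.bits : P.W n A.wire → Bool)))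
        fun b => b .z = R.z := fun R s => (suppOn_fill_sub R s).mono fun b hb => hb .z trivial
    rw [List.map_cons, Prog.seqs, wp_seq, Par.copy, wp_seq, wp_gate, applyOp_notU_fill_sub, hz1,
      wp_loop]
    set G' := wp (accessSem A _ U F) F (.seqs (L.map (P.copy A t))) G with hG'
    have hsz : (P.attempt t (P.copyT A c)).size + 1 = κ := by
      rw [hκ, P.size_attempt_eq t (P.copyT A c) (P.workT : P.Target n A.wire)]
    have key := loop_value (Z := 2 ^ L.length) hp0 hY (one_le_pow₀ (by norm_num)) B
      (fun a => G' ⟨fill P.subE (fill (A.inpE c) (R.unit ψ t) s) (ket R.bits),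
        τ + 5 + a * κ, q + a, m⟩)
      (fun a j => wpLoop (accessSem A _ U F) F .z (P.attempt t (P.copyT A c)) G' j
        ⟨fill P.subE s (ket R.raise.bits), τ + 4 + a * κ, q + a, m⟩)
      (fun a j => Post.nonneg _ _) hp1 ?_ ?_ F a (by omega)
    · rw [List.length_cons, pow_succ', add_right_comm]
      exact key
    · intro a j
      have h1 := le_wp_attempt_copy (F := F) ψ hU R hz ht hω hr c s (hs c (by simp))
        (wpLoop (accessSem A _ U F) F .z (P.attempt t (P.copyT A c)) G' (j + 1))
        (τ + 4 + a * κ + 1) (q + a) m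
      have e1 : τ + 4 + a * κ + 1 + (P.attempt t (P.copyT A c)).size = τ + 4 + (a + 1) * κ := by
        rw [← hsz]; ring
      have e2 : τ + 4 + (a + 1) * κ + 1 = τ + 5 + (a + 1) * κ := by ring
      rw [e1, wpLoop_succ_false _ _ _ _ _ _ _ _ ((hsupp R _).mono fun b hb => hb.trans hz),
        e2] at h1
      exact h1.trans (le_of_eq (wpLoop_succ_true _ _ _ _ _ _ _ _ (hsupp R.raise s)).symm)
    · intro a
      refine ih hL.2 _ ?_ (τ + 5) ?_ a
      · intro c' hc' j
        refine (hs c' (by simp [hc']) j).fill_disjoint fun j' h => ?_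
        have : (c, j') = (c', j) := A.inp.injective h
        rw [Prod.mk.injEq] at this
        exact hL.1 (this.1 ▸ hc')
      · intro a ha
        refine (hG a ha).trans (le_of_eq ?_)
        rw [List.length_cons, BaseAlg.copies, List.foldl_cons]
        congr 2
        ring

lemma copies_apply (u : Vec n) (L : List (Fin S)) (hL : L.Nodup) (s : State A.wire)
    (b : A.wire → Bool) : A.copies u L s b =
      (L.map fun c => u fun j => b (A.inp (c, j))).prod *
        open Classical in s fun i => if ∃ c ∈ L, ∃ j, A.inp (c, j) = i then false else b i := by
  classical
  induction L generalizing s with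
  | nil => simp [BaseAlg.copies]
  | cons c L ih =>
    rw [List.nodup_cons] at hL
    have := ih hL.2 (fill (A.inpE c) u s)
    rw [BaseAlg.copies, List.foldl_cons]
    rw [BaseAlg.copies] at this
    rw [this, List.map_cons, List.prod_cons, fill]
    have h1 : (fun j => (fun i => if ∃ c ∈ L, ∃ j, A.inp (c, j) = i then false else b i)
        (A.inpE c j)) = fun j => b (A.inp (c, j)) := by
      funext j
      change (if _ then _ else _) = _
      rw [if_neg]
      · rfl
      · rintro ⟨c', hc', j', h⟩
        have : (c', j') = (c, j) := A.inp.injective h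
        rw [Prod.mk.injEq] at this
        exact hL.1 (this.1 ▸ hc')
    have h2 : Function.extend (A.inpE c) (fun _ => false)
        (fun i => if ∃ c ∈ L, ∃ j, A.inp (c, j) = i then false else b i) =
        fun i => if ∃ c' ∈ c :: L, ∃ j, A.inp (c', j) = i then false else b i := by
      funext i
      by_cases h : ∃ j, A.inpE c j = i
      · obtain ⟨j, rfl⟩ := h
        rw [(A.inpE c).injective.extend_apply, if_pos]
        exact ⟨c, by simp, j, rfl⟩
      · rw [extend_apply_of_ne _ _ _ fun j hj => h ⟨j, hj⟩]
        have h' : ¬ ∃ j, A.inp (c, j) = i := h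
        simp [h']
    rw [h1, h2]
    ring

/-- The copies of the residual state are the input of the subroutine. -/
lemma copies_finRange (u : Vec n) :
    A.copies u (List.finRange S) (ket fun _ => false) = (A.start u).state := by
  classical
  funext b
  rw [copies_apply _ _ (List.nodup_finRange S), BaseAlg.start, ket_apply]
  have h : ((fun i => if ∃ c ∈ List.finRange S, ∃ j, A.inp (c, j) = i then false else b i) =
      fun _ => false) ↔ ∀ i, i ∉ Set.range A.inp → b i = false := by
    rw [funext_iff]
    refine forall_congr' fun i => ?_
    by_cases hi : i ∈ Set.range A.inp
    · obtain ⟨⟨c, j⟩, hcj⟩ := id hi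
      rw [if_pos ⟨c, List.mem_finRange c, j, hcj⟩]
      simp [hi]
    · rw [if_neg]
      · simp [hi]
      · rintro ⟨c, -, j, hcj⟩
        exact hi ⟨_, hcj⟩
  simp only [h]
  rw [← List.ofFn_eq_map, List.prod_ofFn]
  split_ifs <;> simp

end Copies

/-! ### Generation of a candidate -/

section Gen

variable {n S : ℕ} {A : BaseAlg n S} {P : Par} {U : Matrix.unitaryGroup (Bits n) ℂ} {F : ℕ}

/-- The wires of the subroutine that are ever changed. -/
def BaseAlg.touched (A : BaseAlg n S) : List A.wire :=
  List.ofFn (fun i : Fin (S * n) => A.inp (finProdFinEquiv.symm i)) ++ A.prog.wires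

lemma BaseAlg.length_touched_le (A : BaseAlg n S) : A.touched.length ≤ S * n + A.prog.size := by
  have := A.prog.length_wires_le
  simp only [touched, List.length_append, List.length_ofFn]
  omega

lemma BaseAlg.clean_of_mem_run (A : BaseAlg n S) (u : Vec n) (F : ℕ) :
    ∀ c ∈ A.prog.run (Function.Embedding.refl _) (fun e => e.elim) F (A.start u),
      c.Clean A.touched := by
  refine A.prog.run_clean F (List.subset_append_right _ _) _ ⟨fun j hj b hb => ?_, rfl, rfl⟩
  simp only [List.mem_append, not_or, List.mem_ofFn] at hj
  simp only [BaseAlg.start] at hb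
  split_ifs at hb with h
  · refine h j ?_
    rintro ⟨x, hx⟩
    exact hj.1 ⟨finProdFinEquiv x, by rw [Equiv.symm_apply_apply, hx]⟩
  · exact absurd rfl hb

lemma projReg_fill {κ ι : Type} [Fintype κ] [DecidableEq κ] (w : κ ↪ ι) (y : κ → Bool)
    (u : State κ) (v : State ι) : projReg w y (fill w u v) = u y • fill w (ket y) v := by
  funext b
  simp only [projReg, fill, ket_apply, Pi.smul_apply, smul_eq_mul]
  split_ifs with h
  · rw [h, one_mul]
  · simp

/-- The gate that adds an output wire of the subroutine to the description in slot `t`. -/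
def Par.copyOut (P : Par) (A : BaseAlg n S) (t : ℕ) (l : Fin (gateSeq n).length) :
    P.Pg n A.wire :=
  cxor (wire1 (.sub (A.out l))) (wire1 (.desc (P.s t) l)) (fun i j h => by injection h) id

/-- The registers after the description in slot `t` has been set to `d`. -/
def Reg.setDesc (R : Reg P n) (t : ℕ) (d : StabDesc n) : Reg P n :=
  { R with desc := Function.update R.desc (P.s t) d }

lemma wp_copyOut (R : Reg P n) (t : ℕ) (y : A.wire → Bool) (L : List (Fin (gateSeq n).length))
    (hL : L.Nodup) (hR : ∀ l ∈ L, R.desc (P.s t) l = false) (G : Post (P.W n A.wire))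
    (τ q m : ℕ) :
    wp (accessSem A _ U F) F (.seqs (L.map (P.copyOut A t))) G
        ⟨fill P.subE (ket y) (ket R.bits), τ, q, m⟩ =
      G ⟨fill P.subE (ket y) (ket (Reg.bits (R.setDesc t
        fun l => if l ∈ L then y (A.out l) else R.desc (P.s t) l))),
        τ + 16 * L.length + 1, q, m⟩ := by
  induction L generalizing R τ with
  | nil => simp [Prog.seqs, wp_skip, Reg.setDesc]
  | cons l L ih =>
    rw [List.nodup_cons] at hL
    rw [List.map_cons, Prog.seqs, wp_seq, fill_ket_ket _ _ _ fun j => rfl, Par.copyOut, wp_cxor_ket]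
    set R' := R.setDesc t (Function.update (R.desc (P.s t)) l (y (A.out l))) with hR'
    have e1 : Function.extend (wire1 (.desc (P.s t) l) : Fin 1 ↪ P.W n A.wire)
        (fun j => xor (Function.extend P.subE y R.bits
          ((wire1 (.desc (P.s t) l) : Fin 1 ↪ P.W n A.wire) j))
          (id (fun i => Function.extend P.subE y R.bits
            ((wire1 (.sub (A.out l)) : Fin 1 ↪ P.W n A.wire) i)) j))
        (Function.extend P.subE y R.bits) = Function.extend P.subE y R'.bits := by
      rw [← extend_comm P.subE _ (by intro i j h; injection h), extend_wire1]
      congr 1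
      have h1 : Function.extend P.subE y R.bits
          ((wire1 (.desc (P.s t) l) : Fin 1 ↪ P.W n A.wire) 0) = false := by
        rw [extend_apply_of_ne _ _ _ (by intro j h; injection h)]
        exact hR l (by simp)
      have h2 : Function.extend P.subE y (R.bits : P.W n A.wire → Bool)
          ((wire1 (.sub (A.out l)) : Fin 1 ↪ P.W n A.wire) 0) = y (A.out l) :=
        (P.subE : A.wire ↪ P.W n A.wire).injective.extend_apply _ _ (A.out l)
      rw [id, h1, h2, Bool.false_xor, Reg.update_desc]
      rfl
    rw [e1, ← fill_ket_ket _ _ _ fun j => rfl, ih R' hL.2]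
    · have e2 : (R'.setDesc t fun l' => if l' ∈ L then y (A.out l') else R'.desc (P.s t) l') =
          R.setDesc t fun l' => if l' ∈ l :: L then y (A.out l') else R.desc (P.s t) l' := by
        simp only [hR', Reg.setDesc, Function.update_self, Function.update_idem]
        congr 2
        funext l'
        by_cases h : l' = l
        · subst h; simp
        · simp [h]
      rw [e2]
      congr 2
      rw [List.length_cons]; ring
    · intro l' hl'
      have : l' ≠ l := by rintro rfl; exact hL.1 hl'
      simp only [hR', Reg.setDesc, Function.update_self, Function.update_of_ne this]
      exact hR l' (by simp [hl'])

/-- A call of the subroutine, whose output is stored in slot `t`. -/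
def Par.callOut (P : Par) (A : BaseAlg n S) (t : ℕ) : P.Pg n A.wire :=
  .seq (.ext (.call P.subE)) (.seq (measAll (A.touched.map P.subE))
    (.seq (.seqs ((List.finRange _).map (P.copyOut A t))) (resetAll (A.touched.map P.subE))))

/-- The costs of a call, in addition to the steps of the subroutine. -/
def BaseAlg.overhead (A : BaseAlg n S) : ℕ :=
  1 + (3 * A.touched.length + 1) + (16 * (gateSeq n).length + 1) + (6 * A.touched.length + 1)

/-- A call yields a good description with probability at least `ρ`, and some description otherwise.
The wires of the subroutine are measured before they are reset, so that no correlation with them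
remains. -/
lemma le_wp_callOut (u : Vec n) {T : ℕ} (hT : A.prob u T (fun _ => True) = 1) (hF : T ≤ F)
    (R : Reg P n) (t : ℕ) (hR : ∀ l, R.desc (P.s t) l = false) {good : StabDesc n → Prop}
    {ρ x y : ℝ} (hρ : ρ ≤ A.prob u T good) (hxy : x ≤ y)
    (G : Post (P.W n A.wire)) (τ q m : ℕ)
    (hx : ∀ d, x ≤ G ⟨ket (R.setDesc t d).bits, τ + (T + A.overhead), q, m + 1⟩)
    (hy : ∀ d, good d → y ≤ G ⟨ket (R.setDesc t d).bits, τ + (T + A.overhead), q, m + 1⟩) :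
    ρ * y + (1 - ρ) * x ≤ wp (accessSem A _ U F) F (P.callOut A t) G
      ⟨fill P.subE (A.start u).state (ket R.bits), τ, q, m⟩ := by
  classical
  set runs := A.prog.run (Function.Embedding.refl _) (fun e => e.elim) with hruns
  set G1 := wp (accessSem A _ U F) F (.seq (measAll (A.touched.map P.subE))
    (.seq (.seqs ((List.finRange _).map (P.copyOut A t))) (resetAll (A.touched.map P.subE)))) G
    with hG1
  have hcall : wp (accessSem A _ U F) F (P.callOut A t) G
      ⟨fill P.subE (A.start u).state (ket R.bits), τ, q, m⟩ =
      ((runs F (A.start u)).map fun c =>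
        G1 (c.embed P.subE (ket R.bits) (τ + 1) q (m + 1))).sum := by
    rw [Par.callOut, wp_seq]
    have h := Prog.run_embed P.subE (ket (R.bits : P.W n A.wire → Bool)) (τ + 1) q (m + 1) F A.prog
      (A.start u)
    have h0 : (A.start u).embed P.subE (ket (R.bits : P.W n A.wire → Bool)) (τ + 1) q (m + 1) =
        ⟨fill P.subE (A.start u).state (ket R.bits), τ + 1, q, m + 1⟩ := by
      simp [Conf.embed, BaseAlg.start]
    rw [h0] at h
    change (((A.prog.run P.subE (fun e => e.elim) F _).map _).sum) = _
    rw [h, List.map_map]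
    rfl
  have hout : ∀ c ∈ runs T (A.start u), c.time ≤ T →
      ∑ b, ‖c.state b‖ ^ 2 * G ⟨ket (R.setDesc t fun l => b (A.out l)).bits,
        τ + (T + A.overhead), q, m + 1⟩ ≤ G1 (c.embed P.subE (ket R.bits) (τ + 1) q (m + 1)) := by
    intro c hc hcT
    obtain ⟨hsupp, hq0, hm0⟩ := A.clean_of_mem_run u T c hc
    rw [hG1, Conf.embed, hq0, hm0, zero_add, zero_add, wp_seq]
    refine le_trans ?_ (sum_projReg_le_wp_measAll _ F P.subE _ A.touched _ (fun _ => false) _ _ _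
      fun j hj b hb => hsupp j hj _ (left_ne_zero_of_mul hb))
    refine Finset.sum_le_sum fun b _ => ?_
    rw [projReg_fill, Post.smul]
    by_cases hb : c.state b = 0
    · simp [hb]
    -- after the measurement the wires of the subroutine are in the basis state `b`
    refine mul_le_mul_of_nonneg_left ?_ (sq_nonneg _)
    have hres := nsq_mul_le_wp_resetAll (accessSem A _ U F) F P.subE G A.touched (ket b)
      (ket (R.setDesc t fun l => b (A.out l)).bits)
      (c.time + (τ + 1) + (3 * A.touched.length + 1) +
          16 * (List.finRange (gateSeq n).length).length
        + 1) q (m + 1)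
      ((suppOn_ket _).mono fun b hb j => by rw [hb]; rfl)
      fun j hj => (suppOn_ket b).mono fun b' hb' => by rw [hb']; exact hsupp j hj b hb
    rw [wp_seq, wp_copyOut R t b _ (List.nodup_finRange _) fun l _ => hR l]
    simp only [List.mem_finRange, if_true]
    refine le_trans ?_ hres
    rw [nsq_ket, one_mul]
    refine G.anti _ ?_ le_rfl le_rfl
    rw [BaseAlg.overhead, List.length_finRange]
    omega
  have hprob : ∀ g : StabDesc n → Prop, A.prob u T g = ((runs T (A.start u)).map fun c =>
      if c.time ≤ T then ∑ b, if g (fun l => b (A.out l)) then ‖c.state b‖ ^ 2 else 0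
      else 0).sum := by
    intro g
    refine congrArg List.sum (List.map_congr_left fun c _ => ?_)
    by_cases h : c.time ≤ T <;> simp [h]
  have hsplit : x * A.prob u T (fun _ => True) + (y - x) * A.prob u T good ≤
      ((runs T (A.start u)).map fun c =>
        G1 (c.embed P.subE (ket R.bits) (τ + 1) q (m + 1))).sum := by
    rw [hprob, hprob, ← List.sum_map_mul_left, ← List.sum_map_mul_left, ← List.sum_map_add]
    refine List.sum_le_sum fun c hc => ?_
    by_cases hcT : c.time ≤ T
    · refine le_trans ?_ (hout c hc hcT)
      simp only [if_pos hcT, if_true, Finset.mul_sum, ← Finset.sum_add_distrib]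
      refine Finset.sum_le_sum fun b _ => ?_
      split_ifs with hg
      · have := mul_le_mul_of_nonneg_left (hy _ hg) (sq_nonneg ‖c.state b‖)
        linarith
      · have := mul_le_mul_of_nonneg_left (hx fun l => b (A.out l)) (sq_nonneg ‖c.state b‖)
        linarith
    · simp only [if_neg hcT, mul_zero, add_zero]
      exact G1.nonneg _
  rw [hcall]
  refine le_trans ?_ (hsplit.trans (List.Sublist.sum_le_sum
    ((Prog.run_sublist _ _ hF A.prog (A.start u)).map _) ?_))
  · rw [hT]
    nlinarith
  · intro r hr
    obtain ⟨c, -, rfl⟩ := List.mem_map.1 hr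
    exact G1.nonneg _

/-- Generation of a candidate in slot `t`: copies of the residual state are prepared, and the
subroutine is called. -/
def Par.gen (P : Par) (A : BaseAlg n S) (t : ℕ) : P.Pg n A.wire :=
  .seq (.seqs ((List.finRange S).map (P.copy A t))) (P.callOut A t)

/-- The costs of the generation of a candidate with at most `B` attempts. -/
def Par.genTime (P : Par) (A : BaseAlg n S) (t B T : ℕ) : ℕ :=
  5 * S + 1 + B * ((P.attempt t P.workT : P.Pg n A.wire).size + 1) + (T + A.overhead)

/-- With its copies prepared, the subroutine receives exactly the residual state. -/
lemma le_wp_gen (ψ : Vec n) (hU : (U : Matrix (Bits n) (Bits n) ℂ) *ᵥ ket (zeroBits n) = ψ)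
    (R : Reg P n) (hz : R.z = false) {t : ℕ} (ht : t ≤ 2 ^ P.m) (hω : R.Units t)
    (hr : 0 < nsq (R.res ψ t)) {B T : ℕ} (hB : B + 1 ≤ F)
    (hT : A.prob (R.unit ψ t) T (fun _ => True) = 1) (hF : T ≤ F)
    (hR : ∀ l, R.desc (P.s t) l = false) {good : StabDesc n → Prop}
    {ρ x y : ℝ} (hρ : ρ ≤ A.prob (R.unit ψ t) T good) (hρ0 : 0 ≤ ρ) (hρ1 : ρ ≤ 1) (hx0 : 0 ≤ x)
    (hxy : x ≤ y) (G : Post (P.W n A.wire)) (τ q m : ℕ)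
    (hx : ∀ d, x ≤ G ⟨ket (R.setDesc t d).bits, τ + P.genTime A t B T, q + B, m + 1⟩)
    (hy : ∀ d, good d → y ≤ G ⟨ket (R.setDesc t d).bits, τ + P.genTime A t B T, q + B, m + 1⟩) :
    (1 - 2 ^ S / (1 + R.prob ψ t / 2) ^ B) * (ρ * y + (1 - ρ) * x) ≤
      wp (accessSem A _ U F) F (P.gen A t) G ⟨ket R.bits, τ, q, m⟩ := by
  have hY : 0 ≤ ρ * y + (1 - ρ) * x := by
    have := hx0.trans hxy
    have : 0 ≤ 1 - ρ := by linarith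
    positivity
  have h0 : fill P.subE (ket fun _ => false) (ket (R.bits : P.W n A.wire → Bool)) =
      ket R.bits := fill_ket_zero _ _ ((suppOn_ket _).mono fun b hb j => by rw [hb]; rfl)
  have key := le_wp_copies ψ hU R hz ht hω hr hB rfl (List.finRange S) (List.nodup_finRange S)
    (ket fun _ => false) (fun c _ j => (suppOn_ket _).mono fun b hb => by rw [hb]) hY
    (wp (accessSem A _ U F) F (P.callOut A t) G) τ q m ?_ 0
  · rw [h0, List.length_finRange, pow_zero, mul_one_div, zero_mul, add_zero, add_zero] at key
    rw [Par.gen, wp_seq]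
    exact key
  · intro a ha
    rw [copies_finRange]
    have hmono : ∀ d, G ⟨ket (R.setDesc t d).bits, τ + P.genTime A t B T, q + B, m + 1⟩ ≤
        G ⟨ket (R.setDesc t d).bits, τ + 5 * (List.finRange S).length + 1 +
          a * ((P.attempt t P.workT : P.Pg n A.wire).size + 1) + (T + A.overhead),
          q + a, m + 1⟩ := by
      intro d
      refine G.anti _ ?_ (by omega) le_rfl
      have := Nat.mul_le_mul_right ((P.attempt t P.workT : P.Pg n A.wire).size + 1) ha
      rw [Par.genTime, List.length_finRange]
      omega
    exact le_wp_callOut _ hT hF R t hR hρ hxy G _ _ _ (fun d => (hx d).trans (hmono d))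
      fun d hd => (hy d hd).trans (hmono d)

end Gen

/-! ### Testing a candidate -/

section Classical

variable {E ι : Type} [Fintype ι] {k : ℕ}

lemma le_wp_reset (σ : Sem E ι) (F : ℕ) (w : Fin k ↪ ι) (r : ι → Bool) (hr : ∀ j, r (w j) = false)
    (y : Bits k) (G : Post ι) (τ q m : ℕ) : G ⟨ket r, τ + (6 * k + 1), q, m⟩ ≤
      wp σ F (resetAll ((List.finRange k).map w)) G ⟨ket (Function.extend w y r), τ, q, m⟩ := by
  have h := nsq_mul_le_wp_resetAll σ F w G (List.finRange k) (ket y) (ket r) τ q m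
    ((suppOn_ket r).mono fun b hb j => by rw [hb]; exact hr j)
    fun j hj => absurd (List.mem_finRange j) hj
  rwa [nsq_ket, one_mul, List.length_finRange, fill_ket_ket _ _ _ hr] at h

end Classical

section Test

variable {n S : ℕ} {A : BaseAlg n S} {P : Par} {U : Matrix.unitaryGroup (Bits n) ℂ} {F : ℕ}
  {κ : Type}

/-- The registers after the phase in slot `t` has been set to `p`. -/
def Reg.setPh (R : Reg P n) (t : ℕ) (p : Bits 4) : Reg P n :=
  { R with ph := Function.update R.ph (P.s t) p }

/-- The registers after the presence of the term in slot `t` has been set to `x`. -/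
def Reg.setAcc (R : Reg P n) (t : ℕ) (x : Bool) : Reg P n :=
  { R with acc := Function.update R.acc (P.s t) x }

/-- The digits of the phases `1`, `-1`, `i`, `-i`. -/
def phases : List (Bits 4) :=
  [![false, true, false, false], ![true, true, false, false],
    ![false, false, false, true], ![false, false, true, true]]

/-- The estimate of the squared norm of the `t`-th residual vector that a value of the counter
represents. -/
def Par.estVal (P : Par) (M t : ℕ) (y : Bits P.cb) : ℝ := P.Lam t ^ 2 * dec P.cb y / M

/-- The estimates indicate that the `t`-th term should be accepted. -/
def Par.Improves (P : Par) (M t : ℕ) (y y' : Bits P.cb) : Prop :=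
  P.estVal M (t + 1) y' ≤ P.estVal M t y - ((1 / 2 : ℝ) ^ P.h) ^ 2 / 2

open Classical in
/-- The gate that accepts the `t`-th term if the estimates say so. The wires of the two counters
are distinct whenever `t < K`; the other case does not occur. -/
def Par.cmp (M t : ℕ) : P.Pg n κ :=
  if h : ∀ i j, (P.cntE t i : P.W n κ) ≠ P.cntE (t + 1) j then
    cxor (joint (P.cntE t) (P.cntE (t + 1)) h) (wire1 (.acc (P.s t)))
      (fun i j hij => by
        obtain ⟨i, rfl⟩ := finSumFinEquiv.surjective i
        rcases i with i | i
        · rw [joint_inl] at hij; injection hij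
        · rw [joint_inr] at hij; injection hij)
      fun y _ => decide (P.Improves M t (fun i => y (finSumFinEquiv (.inl i)))
        fun i => y (finSumFinEquiv (.inr i)))
  else .skip

lemma Par.size_cmp_le (M t : ℕ) : (P.cmp M t : P.Pg n κ).size ≤ 4 ^ (P.cb + P.cb + 1) := by
  rw [Par.cmp]
  split_ifs
  · exact le_rfl
  · exact Nat.one_le_pow _ _ (by norm_num)

open Classical in
lemma wp_cmp (R : Reg P n) (M : ℕ) {t : ℕ} (ht : t < P.K) (hR : R.acc (P.s t) = false)
    (G : Post (P.W n A.wire)) (τ q m : ℕ) :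
    wp (accessSem A _ U F) F (P.cmp M t) G ⟨ket R.bits, τ, q, m⟩ =
      G ⟨ket (R.setAcc t (decide
        (P.Improves M t (R.cnt (P.s t)) (R.cnt (P.s (t + 1)))))).bits,
        τ + 4 ^ (P.cb + P.cb + 1), q, m⟩ := by
  have h : ∀ i j, (P.cntE t i : P.W n A.wire) ≠ P.cntE (t + 1) j := by
    intro i j hij
    have h1 : P.s t = P.s (t + 1) := by injection hij
    have := P.s_inj (by omega) (by omega) h1
    omega
  rw [Par.cmp, dif_pos h, wp_cxor_ket, extend_wire1, Reg.update_acc]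
  simp only [joint_inl, joint_inr]
  have h2 : (R.bits : P.W n A.wire → Bool) ((wire1 (.acc (P.s t)) : Fin 1 ↪ P.W n A.wire) 0) =
      false := hR
  rw [h2, Bool.false_xor]
  rfl

/-- The program that tries the phase `p` for the candidate in slot `t`, unless a term has been
accepted already. -/
def Par.test (M t : ℕ) (p : Bits 4) : P.Pg n κ :=
  .branch (.acc (P.s t)) .skip (.seq (.gate (P.phE t) (permU (xorPerm p)))
    (.seq (P.est M (t + 1)) (.seq (P.cmp M t) (.branch (.acc (P.s t)) .skip
      (.seq (resetAll ((List.finRange P.cb).map (P.cntE (t + 1))))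
        (.gate (P.phE t) (permU (xorPerm p))))))))

variable (P n) in
/-- The costs of a test. -/
def Par.testTime (M t : ℕ) : ℕ :=
  1 + 1 + (4 ^ 4 + (M * (P.trial t : P.Pg n Empty).size + 1 + (4 ^ (P.cb + P.cb + 1) +
    (1 + 1 + (6 * P.cb + 1 + 4 ^ 4)))))

lemma Par.size_trial_eq {κ κ' : Type} (t : ℕ) :
    (P.trial t : P.Pg n κ).size = (P.trial t : P.Pg n κ').size := by
  simp only [Par.trial, Prog.size, size_resetAll, List.length_finRange, List.length_map]
  rw [P.size_attempt_eq t P.workT (P.workT : P.Target n κ')]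

lemma Par.size_test_le (M t : ℕ) (p : Bits 4) :
    (P.test M t p : P.Pg n κ).size ≤ P.testTime n M (t + 1) := by
  have h := P.size_cmp_le (n := n) (κ := κ) M t
  simp only [Par.test, Prog.size, size_resetAll, List.length_finRange, List.length_map,
    Par.size_est, Par.testTime]
  rw [P.size_trial_eq (κ' := Empty)]
  omega

lemma suppOn_acc (R : Reg P n) (t : ℕ) (x : Bool) (h : R.acc (P.s t) = x) :
    SuppOn (ket (R.bits : P.W n A.wire → Bool)) fun b => b (.acc (P.s t)) = x :=
  (suppOn_ket _).mono fun b hb => by rw [hb]; exact h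

lemma wp_phase (R : Reg P n) (t : ℕ) (p y : Bits 4)
    (G : Post (P.W n A.wire)) (τ q m : ℕ) :
    wp (accessSem A _ U F) F (.gate (P.phE t) (permU (xorPerm p))) G
        ⟨ket (R.setPh t y).bits, τ, q, m⟩ =
      G ⟨ket (R.setPh t fun j => xor (y j) (p j)).bits, τ + 4 ^ 4, q, m⟩ := by
  rw [wp_gate, applyOp_permU_ket, Reg.extend_ph]
  have : (fun j => (R.setPh t y).bits (P.phE t j : P.W n A.wire)) = y := by
    funext j
    change Function.update R.ph (P.s t) y (P.s t) j = y j
    rw [Function.update_self]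
  rw [this]
  simp only [Reg.setPh, Function.update_idem]
  rfl

lemma Reg.setPh_self (R : Reg P n) (t : ℕ) : R.setPh t (R.ph (P.s t)) = R := by
  simp [Reg.setPh]

/-- A test with accurate estimates accepts the candidate with the phase `p`, or restores the
registers. -/
lemma le_wp_test (ψ : Vec n) (hU : (U : Matrix (Bits n) (Bits n) ℂ) *ᵥ ket (zeroBits n) = ψ)
    (R : Reg P n) (hz : R.z = false) {t : ℕ} (ht : t + 1 ≤ 2 ^ P.m) (htK : t < P.K)
    (hacc : R.acc (P.s t) = false) (hph : R.ph (P.s t) = fun _ => false)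
    (hcnt : R.cnt (P.s (t + 1)) = zeroBits P.cb) (p : Bits 4) (hω : (R.setPh t p).Units (t + 1))
    (M : ℕ) {e Y : ℝ} (he : 0 ≤ e) (he1 : e ≤ 1) (hY : 0 ≤ Y) (G : Post (P.W n A.wire))
    (τ q m : ℕ)
    (hG : ∀ x ≤ M, |(x : ℝ) - M * (R.setPh t p).prob ψ (t + 1)| ≤ e * M →
      P.Improves M t (R.cnt (P.s t)) (enc P.cb x) →
      Y ≤ G ⟨ket (((R.setPh t p).setCnt (t + 1) (enc P.cb x)).setAcc t true).bits,
        τ + P.testTime n M (t + 1), q + M, m⟩)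
    (hG' : ∀ x ≤ M, |(x : ℝ) - M * (R.setPh t p).prob ψ (t + 1)| ≤ e * M →
      ¬ P.Improves M t (R.cnt (P.s t)) (enc P.cb x) →
      Y ≤ G ⟨ket R.bits, τ + P.testTime n M (t + 1), q + M, m⟩) :
    (1 - 2 * Real.exp (-(e ^ 2 * M / 4))) * Y ≤
      wp (accessSem A _ U F) F (P.test M t p) G ⟨ket R.bits, τ, q, m⟩ := by
  classical
  have hs : P.s t ≠ P.s (t + 1) := fun h => by
    have := P.s_inj (by omega) (by omega) h
    omega
  rw [Par.test, wp_branch_false _ _ _ _ _ _ _ _ (suppOn_acc R t false hacc), wp_seq]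
  conv_rhs => rw [← R.setPh_self t]
  rw [wp_phase R t p _, hph]
  simp only [Bool.false_xor]
  rw [wp_seq]
  refine le_wp_est ψ hU (R.setPh t p) hz ht hω hcnt M he he1 hY _ _ _ _ fun x hx hxp => ?_
  set R1 := (R.setPh t p).setCnt (t + 1) (enc P.cb x) with hR1
  have hc1 : R1.cnt (P.s t) = R.cnt (P.s t) := Function.update_of_ne hs _ _
  have hc2 : R1.cnt (P.s (t + 1)) = enc P.cb x := Function.update_self _ _ _
  rw [wp_seq, wp_cmp R1 M htK hacc, hc1, hc2, Par.size_est, P.size_trial_eq (κ' := Empty)]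
  by_cases himp : P.Improves M t (R.cnt (P.s t)) (enc P.cb x)
  · rw [decide_eq_true himp, wp_branch_true _ _ _ _ _ _ _ _ (suppOn_acc (R1.setAcc t true) t true
      (Function.update_self _ _ _)), wp_skip]
    refine (hG x hx hxp himp).trans (G.anti _ ?_ le_rfl le_rfl)
    rw [Par.testTime]
    omega
  · have hR1' : R1.setAcc t false = R1 := by
      rw [Reg.setAcc, ← hacc]
      change { R1 with acc := Function.update R1.acc (P.s t) (R1.acc (P.s t)) } = R1
      rw [Function.update_eq_self]
    rw [decide_eq_false himp, hR1', wp_branch_false _ _ _ _ _ _ _ _ (suppOn_acc R1 t false hacc),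
      wp_seq]
    have h1 := le_wp_reset (accessSem A (P.W n A.wire) U F) F (P.cntE (t + 1)) (R.setPh t p).bits
      (fun j => congrFun hcnt j) (enc P.cb x)
      (wp (accessSem A _ U F) F (.gate (P.phE t) (permU (xorPerm p))) G)
      (τ + 1 + 4 ^ 4 + (M * (P.trial (t + 1) : P.Pg n Empty).size + 1) + 4 ^ (P.cb + P.cb + 1) + 1)
      (q + M) m
    rw [Reg.extend_cnt] at h1
    refine le_trans ?_ h1
    rw [wp_phase R t p _]
    simp only [Bool.xor_self]
    rw [← hph, R.setPh_self t]
    refine (hG' x hx hxp himp).trans (G.anti _ ?_ le_rfl le_rfl)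
    rw [Par.testTime]
    omega

end Test

/-! ### One step of the decomposition -/

lemma wp_seq_eq {E ι : Type} (σ : Sem E ι) (F : ℕ) (p q : Prog E ι) (G : Post ι) :
    wp σ F (.seq p q) G = wp σ F p (wp σ F q G) := by
  have h : ∀ G' G'' : Post ι, G'.val = G''.val → G' = G'' := by
    rintro ⟨⟩ ⟨⟩ h; congr
  exact h _ _ (funext fun c => wp_seq σ F p q G c)

lemma norm_omegaOf {p : Bits 4} (hp : p ∈ phases) : ‖omegaOf p‖ = 1 := by
  have h : ∀ z : ℂ, z.re * z.re + z.im * z.im = 1 → ‖z‖ = 1 := fun z hz => by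
    rw [← Complex.normSq_apply, Complex.normSq_eq_norm_sq] at hz
    nlinarith [norm_nonneg z]
  apply h
  simp only [phases, List.mem_cons, List.not_mem_nil, or_false] at hp
  rcases hp with rfl | rfl | rfl | rfl <;> simp [omegaOf]

/-- One of the four phases is within `45` degrees of a given number. -/
lemma exists_phase (z : ℂ) :
    ∃ p ∈ phases, ‖z‖ / Real.sqrt 2 ≤ (star (omegaOf p) * z).re := by
  have h2 : (0 : ℝ) < Real.sqrt 2 := by positivity
  have key : ∀ a : ℝ, 0 ≤ a → z.re ^ 2 + z.im ^ 2 ≤ 2 * a ^ 2 → ‖z‖ / Real.sqrt 2 ≤ a := by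
    intro a ha h
    rw [div_le_iff₀ h2]
    refine abs_le_of_sq_le_sq' ?_ (by positivity) |>.2
    rw [mul_pow, Real.sq_sqrt (by norm_num), ← Complex.normSq_eq_norm_sq, Complex.normSq_apply]
    linarith
  have hm : ∀ p ∈ phases, (star (omegaOf p) * z).re =
      (omegaOf p).re * z.re + (omegaOf p).im * z.im := by
    intro p _; simp
  rcases le_total |z.im| |z.re| with h | h
  · have hsq := sq_le_sq.2 h
    rcases le_total 0 z.re with h0 | h0
    · refine ⟨![false, true, false, false], by simp [phases], ?_⟩
      rw [hm _ (by simp [phases])]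
      exact key _ (by simp [omegaOf, h0]) (by simp [omegaOf]; linarith)
    · refine ⟨![true, true, false, false], by simp [phases], ?_⟩
      rw [hm _ (by simp [phases])]
      exact key _ (by simp [omegaOf, h0]) (by simp [omegaOf]; linarith)
  · have hsq := sq_le_sq.2 h
    rcases le_total 0 z.im with h0 | h0
    · refine ⟨![false, false, false, true], by simp [phases], ?_⟩
      rw [hm _ (by simp [phases])]
      exact key _ (by simp [omegaOf, h0]) (by simp [omegaOf]; linarith)
    · refine ⟨![false, false, true, true], by simp [phases], ?_⟩
      rw [hm _ (by simp [phases])]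
      exact key _ (by simp [omegaOf, h0]) (by simp [omegaOf]; linarith)

lemma nsq_sub_smul {n : ℕ} (r φ : Vec n) (hφ : nsq φ = 1) (c : ℝ) {ω : ℂ} (hω : ‖ω‖ = 1) :
    nsq (r - (c : ℂ) • ω • φ) = nsq r - 2 * c * (star ω * overlap φ r).re + c ^ 2 := by
  have h1 : ∀ b, ‖(r - (c : ℂ) • ω • φ) b‖ ^ 2 =
      ‖r b‖ ^ 2 - 2 * c * (star ω * (star (φ b) * r b)).re + c ^ 2 * ‖φ b‖ ^ 2 := by
    intro b
    simp only [Pi.sub_apply, Pi.smul_apply, smul_eq_mul]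
    have h2 : ‖ω‖ ^ 2 = 1 := by rw [hω]; norm_num
    rw [← Complex.normSq_eq_norm_sq, Complex.normSq_apply] at h2
    simp only [← Complex.normSq_eq_norm_sq, Complex.normSq_apply, Complex.sub_re, Complex.sub_im,
      Complex.mul_re, Complex.mul_im, Complex.ofReal_re, Complex.ofReal_im, Complex.star_def,
      Complex.conj_re, Complex.conj_im]
    linear_combination (c ^ 2 * ((φ b).re ^ 2 + (φ b).im ^ 2)) * h2
  simp only [nsq, h1, Finset.sum_add_distrib, Finset.sum_sub_distrib, ← Finset.mul_sum]
  have h3 : (star ω * overlap φ r).re = ∑ b, (star ω * (star (φ b) * r b)).re := by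
    rw [overlap, dotProduct, Finset.mul_sum, Complex.re_sum]
    rfl
  rw [show ∑ b, ‖φ b‖ ^ 2 = 1 from hφ, mul_one, h3]

section Step

variable {n S : ℕ} {A : BaseAlg n S} {P : Par} {U : Matrix.unitaryGroup (Bits n) ℂ} {F : ℕ}
  {κ : Type}

/-- The absolute value of the coefficients. -/
def Par.c (P : Par) : ℝ := (1 / 2 : ℝ) ^ P.h

lemma Par.c_pos (P : Par) : 0 < P.c := by rw [Par.c]; positivity

/-- The parameters suffice for accuracy `ε` and fidelity `η` of the candidates: norm estimates
from `M` attempts, if accurate up to `e`, give the squared norms up to `c² / 8`. -/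
structure Par.Valid (P : Par) (M : ℕ) (e ε η : ℝ) : Prop where
  one_le_h : 1 ≤ P.h
  M_pos : 0 < M
  M_lt : M < 2 ^ P.cb
  K_eq : P.K = 4 * 4 ^ P.h
  K_lt : P.K ≤ 2 ^ P.m
  e_pos : 0 ≤ e
  e_le : e ≤ 1
  acc : P.Lam P.K ^ 2 * e ≤ P.c ^ 2 / 8
  η_pos : 0 < η
  η_le : η ≤ ε
  ε_lt : ε < 1
  c_le : P.c ^ 2 ≤ η * ε / 8

lemma Par.Valid.K_mul {M : ℕ} {e ε η : ℝ} (h : P.Valid M e ε η) : P.K * (P.c ^ 2 / 4) = 1 := by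
  rw [h.K_eq, Par.c, ← pow_mul, mul_comm P.h 2, pow_mul]
  push_cast
  rw [show (1 / 2 : ℝ) ^ 2 = 1 / 4 by norm_num, one_div, inv_pow]
  field_simp

/-- The value `x` of the `t`-th counter gives an accurate norm estimate. -/
def Reg.Close (R : Reg P n) (ψ : Vec n) (M : ℕ) (e : ℝ) (t x : ℕ) : Prop :=
  |(x : ℝ) - M * R.prob ψ t| ≤ e * M

/-- An accurate counter gives the squared norm of the residual vector up to `c² / 8`. -/
lemma Par.Valid.abs_estVal_sub_le {M : ℕ} {e ε η : ℝ} (h : P.Valid M e ε η) (R : Reg P n)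
    (ψ : Vec n) {t x : ℕ} (ht : t ≤ P.K) (hx : x ≤ M) (hc : R.Close ψ M e t x) :
    |P.estVal M t (enc P.cb x) - nsq (R.res ψ t)| ≤ P.c ^ 2 / 8 := by
  have hM : (0 : ℝ) < M := by exact_mod_cast h.M_pos
  have hL := P.Lam_pos t
  have hLK : P.Lam t ≤ P.Lam P.K := by
    simp only [Par.Lam]
    have : (t : ℝ) ≤ P.K := by exact_mod_cast ht
    gcongr
  have h1 : P.estVal M t (enc P.cb x) - nsq (R.res ψ t) =
      P.Lam t ^ 2 / M * (x - M * R.prob ψ t) := by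
    rw [Par.estVal, dec_enc (hx.trans_lt h.M_lt), Reg.prob]
    field_simp
  rw [h1, abs_mul, abs_of_pos (by positivity)]
  calc P.Lam t ^ 2 / M * |(x : ℝ) - M * R.prob ψ t|
      ≤ P.Lam t ^ 2 / M * (e * M) := by gcongr; exact hc
    _ = P.Lam t ^ 2 * e := by field_simp
    _ ≤ P.Lam P.K ^ 2 * e := by have := h.e_pos; gcongr
    _ ≤ P.c ^ 2 / 8 := h.acc

/-- The registers describe the first `t` terms of a decomposition, and an accurate estimate of the
squared norm of the residual vector; the other registers are zero. -/
structure Reg.Inv (R : Reg P n) (ψ : Vec n) (M : ℕ) (e : ℝ) (t : ℕ) : Prop where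
  z : R.z = false
  grd : R.grd = false
  wt : R.wt = fun _ => false
  used : ∀ i < t, R.acc (P.s i) = true
  phase : ∀ i < t, R.ph (P.s i) ∈ phases
  acc : ∀ i, t ≤ i → i ≤ P.K → R.acc (P.s i) = false
  ph : ∀ i, t ≤ i → i ≤ P.K → R.ph (P.s i) = fun _ => false
  desc : ∀ i, t ≤ i → i ≤ P.K → R.desc (P.s i) = fun _ => false
  cnt : ∀ i, t < i → i ≤ P.K → R.cnt (P.s i) = zeroBits P.cb
  est : ∃ x ≤ M, R.cnt (P.s t) = enc P.cb x ∧ R.Close ψ M e t x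
  dec : nsq (R.res ψ t) ≤ 1 - t * (P.c ^ 2 / 4)

lemma Reg.Inv.units {R : Reg P n} {ψ : Vec n} {M : ℕ} {e : ℝ} {t : ℕ} (h : R.Inv ψ M e t) :
    R.Units t := fun i hi => norm_omegaOf (h.phase i hi)

lemma Par.s_ne (P : Par) {i j : ℕ} (hi : i ≤ P.K) (hj : j ≤ P.K) (h : i ≠ j) : P.s i ≠ P.s j :=
  fun h' => h (P.s_inj hi hj h')

lemma Reg.res_succ (R : Reg P n) (ψ : Vec n) {t : ℕ} (ht : t ≤ P.K) (d : StabDesc n) (p : Bits 4) :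
    ((R.setDesc t d).setPh t p).res ψ (t + 1) =
      R.res ψ t - (P.c : ℂ) • omegaOf p • d.state := by
  rw [Reg.res, Finset.sum_range_succ, ← sub_sub]
  congr 1
  · simp only [Reg.res]
    congr 1
    refine Finset.sum_congr rfl fun i hi => ?_
    have hi := Finset.mem_range.1 hi
    simp only [Reg.setDesc, Reg.setPh,
      Function.update_of_ne (P.s_ne (by omega) ht hi.ne : P.s i ≠ P.s t)]
  · simp only [Reg.setDesc, Reg.setPh, Function.update_self]
    rfl

/-- The phase `p` turns the candidate `d` into a term that must be accepted. -/
def Reg.Forced (R : Reg P n) (ψ : Vec n) (t : ℕ) (d : StabDesc n) (p : Bits 4) : Prop :=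
  nsq (((R.setDesc t d).setPh t p).res ψ (t + 1)) ≤ nsq (R.res ψ t) - P.c ^ 2

/-- A term that lowers the squared norm by `c²` passes a test with accurate estimates. -/
lemma Par.Valid.improves {M : ℕ} {e ε η : ℝ} (h : P.Valid M e ε η) {R : Reg P n} {ψ : Vec n}
    {t x : ℕ} (hR : R.Inv ψ M e t) (ht : t < P.K) {d : StabDesc n} {p : Bits 4} (hx : x ≤ M)
    (hc : ((R.setDesc t d).setPh t p).Close ψ M e (t + 1) x) (hf : R.Forced ψ t d p) :
    P.Improves M t (R.cnt (P.s t)) (enc P.cb x) := by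
  obtain ⟨x0, hx0, hcnt, hc0⟩ := hR.est
  have h0 := abs_le.1 (h.abs_estVal_sub_le R ψ ht.le hx0 hc0)
  have h1 := abs_le.1 (h.abs_estVal_sub_le _ ψ ht hx hc)
  rw [Reg.Forced] at hf
  have := P.c_pos
  rw [Par.Improves, hcnt]
  change _ ≤ _ - P.c ^ 2 / 2
  nlinarith [h0.1, h1.2]

/-- A term that passes a test with accurate estimates lowers the squared norm by at least `c² / 4`:
the test demands an estimated decrease of `c² / 2`, and each of the two estimates is within `c² /
8`. Hence there are at most `4 / c²` terms, whatever the subroutine outputs. -/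
lemma Par.Valid.inv_succ {M : ℕ} {e ε η : ℝ} (h : P.Valid M e ε η) {R : Reg P n} {ψ : Vec n}
    {t x : ℕ} (hR : R.Inv ψ M e t) (ht : t < P.K) {d : StabDesc n} {p : Bits 4} (hp : p ∈ phases)
    (hx : x ≤ M) (hc : ((R.setDesc t d).setPh t p).Close ψ M e (t + 1) x)
    (hi : P.Improves M t (R.cnt (P.s t)) (enc P.cb x)) :
    Reg.Inv ((((R.setDesc t d).setPh t p).setCnt (t + 1) (enc P.cb x)).setAcc t true)
      ψ M e (t + 1) := by
  have hne : ∀ i, i ≤ P.K → i ≠ t → P.s i ≠ P.s t := fun i hi h => P.s_ne hi ht.le h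
  refine ⟨hR.z, hR.grd, hR.wt, ?_, ?_, ?_, ?_, ?_, ?_, ⟨x, hx, Function.update_self _ _ _, hc⟩, ?_⟩
  · intro i hi
    by_cases h1 : i = t
    · subst h1; exact Function.update_self _ _ _
    · exact (Function.update_of_ne (hne i (by omega) h1) _ _).trans (hR.used i (by omega))
  · intro i hi
    by_cases h1 : i = t
    · subst h1
      change Function.update R.ph (P.s i) p (P.s i) ∈ phases
      rw [Function.update_self]; exact hp
    · change Function.update R.ph (P.s t) p (P.s i) ∈ phases
      rw [Function.update_of_ne (hne i (by omega) h1)]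
      exact hR.phase i (by omega)
  · intro i h1 h2
    exact (Function.update_of_ne (hne i h2 (by omega)) _ _).trans (hR.acc i (by omega) h2)
  · intro i h1 h2
    exact (Function.update_of_ne (hne i h2 (by omega)) _ _).trans (hR.ph i (by omega) h2)
  · intro i h1 h2
    exact (Function.update_of_ne (hne i h2 (by omega)) _ _).trans (hR.desc i (by omega) h2)
  · intro i h1 h2
    exact (Function.update_of_ne (P.s_ne h2 ht (by omega)) _ _).trans (hR.cnt i (by omega) h2)
  · obtain ⟨x0, hx0, hcnt, hc0⟩ := hR.est
    have h0 := abs_le.1 (h.abs_estVal_sub_le R ψ ht.le hx0 hc0)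
    have h1 := abs_le.1 (h.abs_estVal_sub_le _ ψ ht hx hc)
    have h2 := hR.dec
    rw [Par.Improves, hcnt] at hi
    change _ ≤ _ - P.c ^ 2 / 2 at hi
    change nsq (((R.setDesc t d).setPh t p).res ψ (t + 1)) ≤ _
    push_cast
    nlinarith [h0.2, h1.1]

lemma wp_tests_of_acc (R : Reg P n) (M t : ℕ) (hR : R.acc (P.s t) = true) (L : List (Bits 4))
    (G : Post (P.W n A.wire)) (τ q m : ℕ) :
    wp (accessSem A _ U F) F (.seqs (L.map (P.test M t))) G ⟨ket R.bits, τ, q, m⟩ =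
      G ⟨ket R.bits, τ + 2 * L.length + 1, q, m⟩ := by
  induction L generalizing τ with
  | nil => simp [Prog.seqs, wp_skip]
  | cons p L ih =>
    rw [List.map_cons, Prog.seqs, wp_seq, Par.test,
      wp_branch_true _ _ _ _ _ _ _ _ (suppOn_acc R t true hR), wp_skip, ih, List.length_cons]
    congr 2
    ring

/-- The probability bound for the failure of a norm estimate. -/
def estErr (M : ℕ) (e : ℝ) : ℝ := 2 * Real.exp (-(e ^ 2 * M / 4))

/-- The tests of a candidate with several phases, where acceptance is worth `y` and rejection `x`;
rejection need not be worth `v` if one of the phases is bound to be accepted. -/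
lemma le_wp_tests (ψ : Vec n) (hU : (U : Matrix (Bits n) (Bits n) ℂ) *ᵥ ket (zeroBits n) = ψ)
    {M : ℕ} {e ε η : ℝ} (h : P.Valid M e ε η) (herr : estErr M e ≤ 1) {R : Reg P n} {t : ℕ}
    (hR : R.Inv ψ M e t) (ht : t < P.K) (d : StabDesc n) (L : List (Bits 4))
    (hL : ∀ p ∈ L, p ∈ phases) {x y v : ℝ} (hv : 0 ≤ v) (hvy : v ≤ y)
    (hvx : v ≤ x ∨ ∃ p ∈ L, R.Forced ψ t d p) (G : Post (P.W n A.wire)) (τ q m : ℕ)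
    (hy : ∀ R' : Reg P n, R'.Inv ψ M e (t + 1) → y ≤ G ⟨ket R'.bits,
      τ + (L.length * P.testTime n M (t + 1) + 1), q + L.length * M, m⟩)
    (hx : x ≤ G ⟨ket (R.setDesc t d).bits,
      τ + (L.length * P.testTime n M (t + 1) + 1), q + L.length * M, m⟩) :
    (1 - estErr M e) ^ L.length * v ≤ wp (accessSem A _ U F) F (.seqs (L.map (P.test M t))) G
      ⟨ket (R.setDesc t d).bits, τ, q, m⟩ := by
  have hs : P.s (t + 1) ≠ P.s t := P.s_ne ht ht.le (by omega)
  induction L generalizing τ q with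
  | nil =>
    simp only [List.not_mem_nil, false_and, exists_false, or_false] at hvx
    simp only [List.map_nil, Prog.seqs, wp_skip, List.length_nil, pow_zero, one_mul]
    refine hvx.trans (hx.trans (G.anti _ ?_ ?_ le_rfl)) <;> simp
  | cons p L ih =>
    rw [List.map_cons, Prog.seqs, wp_seq, List.length_cons, pow_succ', mul_assoc]
    have h1 : 0 ≤ (1 - estErr M e) ^ L.length := pow_nonneg (sub_nonneg.2 herr) _
    have h2 : (1 - estErr M e) ^ L.length ≤ 1 := by
      refine pow_le_one₀ (sub_nonneg.2 herr) ?_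
      have : 0 ≤ estErr M e := by rw [estErr]; positivity
      linarith
    have hω : ((R.setDesc t d).setPh t p).Units (t + 1) := by
      intro i hi
      change ‖omegaOf (Function.update R.ph (P.s t) p (P.s i))‖ = 1
      by_cases h3 : i = t
      · subst h3
        rw [Function.update_self]; exact norm_omegaOf (hL p (by simp))
      · rw [Function.update_of_ne (P.s_ne (by omega) ht.le h3)]
        exact hR.units i (by omega)
    have htt : 2 ≤ P.testTime n M (t + 1) := by
      rw [Par.testTime]
      generalize 4 ^ (P.cb + P.cb + 1) = a
      omega
    refine le_wp_test ψ hU (R.setDesc t d) hR.z (ht.trans_le h.K_lt) ht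
      (hR.acc t le_rfl ht.le) (hR.ph t le_rfl ht.le) (hR.cnt _ (by omega) ht) p hω M h.e_pos h.e_le
      (by positivity) _ τ q m ?_ ?_
    · intro x' hx' hc hi
      rw [wp_tests_of_acc _ _ _ (Function.update_self _ _ _)]
      refine le_trans ?_ ((hy _ (h.inv_succ hR ht (hL p (by simp)) hx' hc hi)).trans
        (G.anti _ ?_ ?_ le_rfl))
      · nlinarith
      · rw [List.length_cons]; nlinarith
      · rw [List.length_cons]; nlinarith
    · intro x' hx' hc hi
      refine ih (fun p hp => hL p (by simp [hp])) ?_ _ _ ?_ ?_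
      · rcases hvx with hvx | ⟨p', hp', hf⟩
        · exact Or.inl hvx
        · rw [List.mem_cons] at hp'
          rcases hp' with rfl | hp'
          · exact absurd (h.improves hR ht hx' hc hf) hi
          · exact Or.inr ⟨p', hp', hf⟩
      · intro R' hR'
        refine (hy R' hR').trans (G.anti _ ?_ ?_ le_rfl) <;> rw [List.length_cons] <;> nlinarith
      · refine hx.trans (G.anti _ ?_ ?_ le_rfl) <;> rw [List.length_cons] <;> nlinarith

/-- A candidate of large fidelity with the residual state is accepted with one of the phases. -/
lemma Par.Valid.exists_forced {M : ℕ} {e ε η : ℝ} (h : P.Valid M e ε η) (R : Reg P n)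
    (ψ : Vec n) {t : ℕ} (ht : t < P.K) (hr : ε / 2 ≤ nsq (R.res ψ t)) {d : StabDesc n}
    (hd : η ≤ ‖overlap d.state (R.unit ψ t)‖ ^ 2) : ∃ p ∈ phases, R.Forced ψ t d p := by
  have hη := h.η_pos
  have hε : 0 < ε := hη.trans_le h.η_le
  have hr0 : 0 < nsq (R.res ψ t) := by linarith
  obtain ⟨p, hp, hpz⟩ := exists_phase (overlap d.state (R.res ψ t))
  refine ⟨p, hp, ?_⟩
  rw [Reg.Forced, R.res_succ ψ ht.le, nsq_sub_smul _ _ d.nsq_state _ (norm_omegaOf hp)]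
  have hov : ‖overlap d.state (R.unit ψ t)‖ ^ 2 =
      ‖overlap d.state (R.res ψ t)‖ ^ 2 / nsq (R.res ψ t) := by
    rw [Reg.unit, overlap_smul_right, norm_mul, mul_pow, Complex.norm_real, Real.norm_eq_abs,
      sq_abs, div_pow, Real.sq_sqrt hr0.le]
    ring
  rw [hov, le_div_iff₀ hr0] at hd
  set z := overlap d.state (R.res ψ t)
  have h1 : P.c ≤ ‖z‖ / Real.sqrt 2 := by
    rw [le_div_iff₀ (by positivity)]
    refine abs_le_of_sq_le_sq' ?_ (norm_nonneg z) |>.2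
    rw [mul_pow, Real.sq_sqrt (by norm_num)]
    have := h.c_le
    nlinarith
  have := P.c_pos
  nlinarith

/-- The generation and the tests of a candidate for slot `t`, unless there is a term already. -/
def Par.trySlot (P : Par) (A : BaseAlg n S) (M t : ℕ) : P.Pg n A.wire :=
  .branch (.acc (P.s t)) .skip (.seq (P.gen A t) (.seq (.seqs (phases.map (P.test M t)))
    (.branch (.acc (P.s t)) .skip (resetAll ((List.finRange _).map (P.descE t))))))

/-- The costs of a try. -/
def Par.tryTime (P : Par) (A : BaseAlg n S) (M t B T : ℕ) : ℕ :=
  1 + (P.genTime A t B T + (4 * P.testTime n M (t + 1) + 1 + (1 + (6 * (gateSeq n).length + 1))))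

/-- The success probability of a try, relative to the success probability of the subroutine. -/
def Reg.tryProb (R : Reg P n) (ψ : Vec n) (S M B : ℕ) (e : ℝ) (t : ℕ) : ℝ :=
  (1 - 2 ^ S / (1 + R.prob ψ t / 2) ^ B) * (1 - estErr M e) ^ 4

/-- A try fills slot `t` with probability about `ρ`, and restores the registers otherwise, if the
squared norm of the residual vector is at least `ε / 2`. -/
lemma le_wp_trySlot (ψ : Vec n) (hU : (U : Matrix (Bits n) (Bits n) ℂ) *ᵥ ket (zeroBits n) = ψ)
    {M B T : ℕ} {e ε η : ℝ} (h : P.Valid M e ε η) (herr : estErr M e ≤ 1) (hB : B + 1 ≤ F)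
    (hF : T ≤ F) (hA : ∀ u : Vec n, IsState u → A.prob u T (fun _ => True) = 1) {R : Reg P n}
    {t : ℕ} (hR : R.Inv ψ M e t) (ht : t < P.K) (hr : ε / 2 ≤ nsq (R.res ψ t)) {ρ x y : ℝ}
    (hρ : ρ ≤ A.prob (R.unit ψ t) T fun d => η ≤ ‖overlap d.state (R.unit ψ t)‖ ^ 2)
    (hρ0 : 0 ≤ ρ) (hρ1 : ρ ≤ 1) (hx0 : 0 ≤ x) (hxy : x ≤ y) (G : Post (P.W n A.wire)) (τ q m : ℕ)
    (hy : ∀ R' : Reg P n, R'.Inv ψ M e (t + 1) → y ≤ G ⟨ket R'.bits,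
      τ + P.tryTime A M t B T, q + (B + 4 * M), m + 1⟩)
    (hx : x ≤ G ⟨ket R.bits, τ + P.tryTime A M t B T, q + (B + 4 * M), m + 1⟩) :
    R.tryProb ψ S M B e t * (ρ * y + (1 - ρ) * x) ≤
      wp (accessSem A _ U F) F (P.trySlot A M t) G ⟨ket R.bits, τ, q, m⟩ := by
  have hε : 0 < ε := h.η_pos.trans_le h.η_le
  have hr0 : 0 < nsq (R.res ψ t) := by linarith
  have h4 : 0 ≤ (1 - estErr M e) ^ 4 := pow_nonneg (sub_nonneg.2 herr) _
  have hd0 : R.desc (P.s t) = fun _ => false := hR.desc t le_rfl ht.le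
  set G2 := wp (accessSem A _ U F) F (.branch (.acc (P.s t)) .skip
    (resetAll ((List.finRange _).map (P.descE t)))) G with hG2
  have hy2 : ∀ (τ q : ℕ) (R' : Reg P n), R'.Inv ψ M e (t + 1) →
      G ⟨ket R'.bits, τ + (1 + (6 * (gateSeq n).length + 1)), q, m + 1⟩ ≤
        G2 ⟨ket R'.bits, τ, q, m + 1⟩ := by
    intro τ q R' hR'
    rw [hG2, wp_branch_true _ _ _ _ _ _ _ _ (suppOn_acc R' t true (hR'.used t (by omega))), wp_skip]
    exact G.anti _ (by omega) le_rfl le_rfl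
  have hx2 : ∀ (τ q : ℕ) (d : StabDesc n),
      G ⟨ket R.bits, τ + (1 + (6 * (gateSeq n).length + 1)), q, m + 1⟩ ≤
        G2 ⟨ket (R.setDesc t d).bits, τ, q, m + 1⟩ := by
    intro τ q d
    rw [hG2, wp_branch_false _ _ _ _ _ _ _ _
      (suppOn_acc (R.setDesc t d) t false (hR.acc t le_rfl ht.le))]
    have h1 := le_wp_reset (accessSem A (P.W n A.wire) U F) F (P.descE t) R.bits
      (fun j => congrFun hd0 j) d G (τ + 1) q (m + 1)
    rw [Reg.extend_desc] at h1
    rwa [← add_assoc]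
  have hgen := le_wp_gen ψ hU R hR.z (ht.le.trans h.K_lt) hR.units hr0 hB
    (hA _ (R.unit_isState ψ t hr0)) hF (fun l => congrFun hd0 l) hρ hρ0 hρ1
    (mul_nonneg h4 hx0) (mul_le_mul_of_nonneg_left hxy h4)
    (wp (accessSem A _ U F) F (.seqs (phases.map (P.test M t))) G2) (τ + 1) q m ?_ ?_
  · rw [Par.trySlot, wp_branch_false _ _ _ _ _ _ _ _ (suppOn_acc R t false (hR.acc t le_rfl ht.le)),
      wp_seq]
    simp only [Reg.tryProb]
    refine le_trans (le_of_eq ?_) (hgen.trans (le_of_eq ?_))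
    · ring
    · rw [wp_seq_eq]
  all_goals
    have hlen : phases.length = 4 := rfl
    have hy' : ∀ R' : Reg P n, R'.Inv ψ M e (t + 1) → y ≤ G2 ⟨ket R'.bits,
        τ + 1 + P.genTime A t B T + (phases.length * P.testTime n M (t + 1) + 1),
        q + B + phases.length * M, m + 1⟩ := fun R' hR' =>
      ((hy R' hR').trans (G.anti _ (by rw [Par.tryTime, hlen]; omega) (by rw [hlen]; omega)
        le_rfl)).trans (hy2 _ _ R' hR')
    have hx' : ∀ d, x ≤ G2 ⟨ket (R.setDesc t d).bits,
        τ + 1 + P.genTime A t B T + (phases.length * P.testTime n M (t + 1) + 1),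
        q + B + phases.length * M, m + 1⟩ := fun d =>
      (hx.trans (G.anti _ (by rw [Par.tryTime, hlen]; omega) (by rw [hlen]; omega)
        le_rfl)).trans (hx2 _ _ d)
  · intro d
    exact le_wp_tests ψ hU h herr hR ht d phases (fun p hp => hp) hx0 hxy (Or.inl le_rfl) G2 _ _ _
      hy' (hx' d)
  · intro d hd
    exact le_wp_tests ψ hU h herr hR ht d phases (fun p hp => hp) (hx0.trans hxy) le_rfl
      (Or.inr (h.exists_forced R ψ ht hr hd)) G2 _ _ _ hy' (hx' d)

end Step

/-! ### The decomposition algorithm -/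

/-- Fixed-point numbers with `h` digits approximate the numbers in `[0, 1]`. -/
lemma exists_fixedPoint (h : ℕ) {s : ℝ} (h0 : 0 ≤ s) (h1 : s ≤ 1) :
    ∃ b : Bits (h + 1), |fixedPoint b - s| ≤ (1 / 2 : ℝ) ^ h := by
  suffices H : ∃ b : Bits (h + 1), fixedPoint b ≤ s ∧ s ≤ fixedPoint b + (1 / 2 : ℝ) ^ h by
    obtain ⟨b, hb, hb'⟩ := H
    exact ⟨b, abs_le.2 ⟨by linarith, by have : (0 : ℝ) ≤ (1 / 2) ^ h := by positivity
                                        linarith⟩⟩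
  induction h with
  | zero =>
    refine ⟨fun _ => false, ?_, ?_⟩ <;> simp [fixedPoint] <;> linarith
  | succ h ih =>
    obtain ⟨b, hb, hb'⟩ := ih
    have key : ∀ x : Bool, fixedPoint (Fin.snoc b x : Bits (h + 1 + 1)) =
        fixedPoint b + if x then (1 / 2 : ℝ) ^ (h + 1) else 0 := by
      intro x
      rw [fixedPoint, Fin.sum_univ_castSucc]
      congr 1
      · refine Finset.sum_congr rfl fun j _ => ?_
        simp only [Fin.snoc_castSucc, Fin.val_castSucc]
        have : (j.castSucc = 0) ↔ j = 0 := Fin.castSucc_eq_zero_iff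
        simp only [this]
      · have : (Fin.last (h + 1)) ≠ 0 := Fin.last_pos.ne'
        simp [Fin.snoc_last, this]
    have hpow : (1 / 2 : ℝ) ^ h = 2 * (1 / 2 : ℝ) ^ (h + 1) := by rw [pow_succ]; ring
    by_cases hs : fixedPoint b + (1 / 2 : ℝ) ^ (h + 1) ≤ s
    · refine ⟨Fin.snoc b true, ?_, ?_⟩ <;> rw [key] <;> simp only [if_true] <;> linarith
    · refine ⟨Fin.snoc b false, ?_, ?_⟩ <;> rw [key] <;>
        simp only [Bool.false_eq_true, if_false] <;> linarith

/-- The digits of a number in `[0, 1]`, and zero outside of this interval. -/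
def digits (h : ℕ) (s : ℝ) : Bits (h + 1) :=
  open Classical in if hs : 0 ≤ s ∧ s ≤ 1 then (exists_fixedPoint h hs.1 hs.2).choose else
    fun _ => false

lemma abs_fixedPoint_digits_sub_le (h : ℕ) {s : ℝ} (h0 : 0 ≤ s) (h1 : s ≤ 1) :
    |fixedPoint (digits h s) - s| ≤ (1 / 2 : ℝ) ^ h := by
  rw [digits, dif_pos ⟨h0, h1⟩]
  exact (exists_fixedPoint h h0 h1).choose_spec

section Stage

variable {n S : ℕ} {A : BaseAlg n S} {P : Par} {U : Matrix.unitaryGroup (Bits n) ℂ} {F : ℕ}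
  {κ : Type}

lemma BaseAlg.prob_nonneg (A : BaseAlg n S) (u : Vec n) (T : ℕ) (good : StabDesc n → Prop) :
    0 ≤ A.prob u T good := by
  refine List.sum_nonneg fun x hx => ?_
  obtain ⟨c, -, rfl⟩ := List.mem_map.1 hx
  dsimp only
  split_ifs
  · exact Finset.sum_nonneg fun b _ => by split_ifs <;> positivity
  · exact le_rfl

lemma wp_tries_of_acc (R : Reg P n) (M t : ℕ) (hR : R.acc (P.s t) = true) (N : ℕ)
    (G : Post (P.W n A.wire)) (τ q m : ℕ) :
    wp (accessSem A _ U F) F (.seqs (List.replicate N (P.trySlot A M t))) G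
      ⟨ket R.bits, τ, q, m⟩ = G ⟨ket R.bits, τ + 2 * N + 1, q, m⟩ := by
  induction N generalizing τ with
  | zero => simp [Prog.seqs, wp_skip]
  | succ N ih =>
    rw [List.replicate_succ, Prog.seqs, wp_seq, Par.trySlot,
      wp_branch_true _ _ _ _ _ _ _ _ (suppOn_acc R t true hR), wp_skip]
    rw [Par.trySlot] at ih
    rw [ih]
    congr 2
    ring

/-- `N` tries fail to fill slot `t` with probability about `(1 - ρ) ^ N`. -/
lemma le_wp_tries (ψ : Vec n) (hU : (U : Matrix (Bits n) (Bits n) ℂ) *ᵥ ket (zeroBits n) = ψ)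
    {M B T : ℕ} {e ε η : ℝ} (h : P.Valid M e ε η) (herr : estErr M e ≤ 1) (hB : B + 1 ≤ F)
    (hF : T ≤ F) (hA : ∀ u : Vec n, IsState u → A.prob u T (fun _ => True) = 1) {R : Reg P n}
    {t : ℕ} (hR : R.Inv ψ M e t) (ht : t < P.K) (hr : ε / 2 ≤ nsq (R.res ψ t)) {r : ℝ}
    (hr0 : 0 ≤ r) (hr1 : r ≤ 1) (hrp : r ≤ R.tryProb ψ S M B e t) {ρ x y : ℝ}
    (hρ : ρ ≤ A.prob (R.unit ψ t) T fun d => η ≤ ‖overlap d.state (R.unit ψ t)‖ ^ 2)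
    (hρ0 : 0 ≤ ρ) (hρ1 : ρ ≤ 1) (hx0 : 0 ≤ x) (hxy : x ≤ y) {TT : ℕ}
    (hTT : P.tryTime A M t B T ≤ TT) (N : ℕ) (G : Post (P.W n A.wire)) (τ q m : ℕ)
    (hy : ∀ R' : Reg P n, R'.Inv ψ M e (t + 1) → y ≤ G ⟨ket R'.bits,
      τ + (N * TT + 1), q + N * (B + 4 * M), m + N⟩)
    (hx : x ≤ G ⟨ket R.bits, τ + (N * TT + 1), q + N * (B + 4 * M), m + N⟩) :
    r ^ N * ((1 - (1 - ρ) ^ N) * y + (1 - ρ) ^ N * x) ≤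
      wp (accessSem A _ U F) F (.seqs (List.replicate N (P.trySlot A M t))) G
        ⟨ket R.bits, τ, q, m⟩ := by
  have hTT2 : 2 ≤ TT := le_trans (by rw [Par.tryTime]; omega) hTT
  induction N generalizing τ q m with
  | zero =>
    simp only [List.replicate_zero, Prog.seqs, wp_skip, pow_zero, one_mul, sub_self, zero_mul,
      zero_add]
    refine hx.trans (G.anti _ ?_ ?_ ?_) <;> simp
  | succ N ih =>
    rw [List.replicate_succ, Prog.seqs, wp_seq]
    have hrN0 : 0 ≤ r ^ N := pow_nonneg hr0 N
    have hrN1 : r ^ N ≤ 1 := pow_le_one₀ hr0 hr1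
    have hq0 : 0 ≤ (1 - ρ) ^ N := pow_nonneg (by linarith) N
    have hq1 : (1 - ρ) ^ N ≤ 1 := pow_le_one₀ (by linarith) (by linarith)
    have hy0 : 0 ≤ y := hx0.trans hxy
    set X := r ^ N * ((1 - (1 - ρ) ^ N) * y + (1 - ρ) ^ N * x) with hX
    have hX0 : 0 ≤ X := by
      have : 0 ≤ 1 - (1 - ρ) ^ N := by linarith
      positivity
    have hXy : X ≤ r ^ N * y := by
      rw [hX]
      refine mul_le_mul_of_nonneg_left ?_ hrN0
      nlinarith
    have key := le_wp_trySlot ψ hU h herr hB hF hA hR ht hr hρ hρ0 hρ1 hX0 hXy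
      (wp (accessSem A _ U F) F (.seqs (List.replicate N (P.trySlot A M t))) G) τ q m ?_ ?_
    · refine le_trans ?_ key
      have h1 : 0 ≤ ρ * (r ^ N * y) + (1 - ρ) * X := by
        have : 0 ≤ 1 - ρ := by linarith
        positivity
      refine le_trans (le_of_eq ?_) (mul_le_mul_of_nonneg_right hrp h1)
      rw [hX, pow_succ, pow_succ]
      ring
    · intro R' hR'
      rw [wp_tries_of_acc R' M t (hR'.used t (by omega))]
      refine le_trans ?_ ((hy R' hR').trans (G.anti _ ?_ ?_ ?_))
      · nlinarith
      · nlinarith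
      · rw [Nat.succ_mul N]; omega
      · omega
    · refine ih _ _ _ (fun R' hR' => (hy R' hR').trans (G.anti _ ?_ ?_ ?_))
        (hx.trans (G.anti _ ?_ ?_ ?_))
      all_goals first | omega | (rw [Nat.succ_mul N]; omega)

/-- The registers after the final weight has been set to `y`. -/
def Reg.setWt (R : Reg P n) (y : Bits (P.h + 1)) : Reg P n := { R with wt := y }

/-- The digits of the weight that a value of the counter represents. -/
def Par.wtOf (P : Par) (M t : ℕ) (y : Bits P.cb) : Bits (P.h + 1) :=
  digits P.h (min 1 (Real.sqrt (P.estVal M t y)))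

/-- The output of the weight of the residual state. -/
def Par.finish (M t : ℕ) : P.Pg n κ :=
  cxor (P.cntE t) P.wtE (fun i j h => by injection h) (P.wtOf M t)

open Classical in
/-- The comparison of the estimated squared norm of the residual vector with `3 ε / 4`. -/
def Par.guard (M t : ℕ) (ε : ℝ) : P.Pg n κ :=
  cxor (P.cntE t) (wire1 .grd) (fun i j h => by injection h)
    fun y _ => decide (3 * ε / 4 ≤ P.estVal M t y)

/-- At most `j` further terms are split off, starting with slot `t`. -/
def Par.stage (P : Par) (A : BaseAlg n S) (M N : ℕ) (ε : ℝ) : ℕ → ℕ → P.Pg n A.wire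
  | 0, t => P.finish M t
  | j + 1, t => .seq (P.guard M t ε) (.branch .grd (.seq (.gate (wire1 .grd) notU)
      (.seq (.seqs (List.replicate N (P.trySlot A M t)))
        (.branch (.acc (P.s t)) (P.stage A M N ε j (t + 1)) (P.finish M t)))) (P.finish M t))

lemma wp_finish (R : Reg P n) (M t : ℕ) (hR : R.wt = fun _ => false) (G : Post (P.W n A.wire))
    (τ q m : ℕ) :
    wp (accessSem A _ U F) F (P.finish M t) G ⟨ket R.bits, τ, q, m⟩ =
      G ⟨ket (R.setWt (P.wtOf M t (R.cnt (P.s t)))).bits, τ + 4 ^ (P.cb + (P.h + 1)), q, m⟩ := by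
  rw [Par.finish, wp_cxor_ket, Reg.extend_wt]
  have h1 : ∀ j, (R.bits : P.W n A.wire → Bool) (P.wtE j) = false := fun j => congrFun hR j
  simp only [h1, Bool.false_xor]
  rfl

/-- The registers after the comparison wire has been set to `x`. -/
def Reg.setGrd (R : Reg P n) (x : Bool) : Reg P n := { R with grd := x }

open Classical in
lemma wp_guard (R : Reg P n) (M t : ℕ) (ε : ℝ) (hR : R.grd = false) (G : Post (P.W n A.wire))
    (τ q m : ℕ) :
    wp (accessSem A _ U F) F (P.guard M t ε) G ⟨ket R.bits, τ, q, m⟩ =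
      G ⟨ket (R.setGrd (decide (3 * ε / 4 ≤ P.estVal M t (R.cnt (P.s t))))).bits,
        τ + 4 ^ (P.cb + 1), q, m⟩ := by
  rw [Par.guard, wp_cxor_ket, extend_wire1, Reg.update_grd]
  have h2 : (R.bits : P.W n A.wire → Bool) ((wire1 .grd : Fin 1 ↪ P.W n A.wire) 0) =
      false := hR
  rw [h2, Bool.false_xor]
  rfl

lemma wp_clear_grd (R : Reg P n) (hR : R.grd = false) (G : Post (P.W n A.wire)) (τ q m : ℕ) :
    wp (accessSem A _ U F) F (.gate (wire1 .grd) notU) G ⟨ket (R.setGrd true).bits, τ, q, m⟩ =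
      G ⟨ket R.bits, τ + 4 ^ 1, q, m⟩ := by
  rw [wp_gate, notU_eq, applyOp_permU_ket, extend_wire1, Reg.update_grd]
  congr 3
  cases R
  simp only at hR
  subst hR
  rfl

/-- The residual state is accepted as a final result. -/
def Reg.Fine (R : Reg P n) (ψ : Vec n) (ε : ℝ) (t : ℕ) : Prop :=
  nsq (R.res ψ t) * stabFidelity (R.unit ψ t) < ε

lemma Reg.fine_of_lt (R : Reg P n) (ψ : Vec n) {ε : ℝ} (hε : 0 < ε) {t : ℕ}
    (h : nsq (R.res ψ t) < ε) : R.Fine ψ ε t := by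
  rw [Reg.Fine]
  rcases (nsq_nonneg (R.res ψ t)).eq_or_lt with h0 | h0
  · rw [← h0, zero_mul]; exact hε
  · have := stabFidelity_le_one (R.unit_isState ψ t h0)
    nlinarith

variable (P n) in
/-- The costs of a stage. -/
def Par.stageTime (N TT : ℕ) : ℕ := 4 ^ (P.cb + 1) + 1 + 4 ^ 1 + (N * TT + 1) + 1

/-- From stage `t` on, the algorithm reaches a residual state that may be accepted, with probability
`r ^ N * (1 - δ ^ N)` per remaining slot. It stops when the estimated squared norm is small, when
`N` tries fail to fill the slot, or when all slots are filled; in the last case the residual vector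
is zero. -/
lemma le_wp_stage (ψ : Vec n) (hU : (U : Matrix (Bits n) (Bits n) ℂ) *ᵥ ket (zeroBits n) = ψ)
    {M B T N TT : ℕ} {e ε η δ : ℝ} (h : P.Valid M e ε η) (herr : estErr M e ≤ 1) (hB : B + 1 ≤ F)
    (hF : T ≤ F) (hA : ∀ u : Vec n, IsState u → A.prob u T (fun _ => True) = 1)
    (hδ0 : 0 < δ) (hδ1 : δ < 1) (hS : A.Succeeds T (ε ^ 6) η δ) {r : ℝ}
    (hr0 : 0 ≤ r) (hr1 : r ≤ 1) (hrp : ∀ (R : Reg P n) (t : ℕ), t < P.K →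
      ε / 2 ≤ nsq (R.res ψ t) → r ≤ R.tryProb ψ S M B e t)
    (hTT : ∀ t < P.K, P.tryTime A M t B T ≤ TT) (G : Post (P.W n A.wire)) (j t : ℕ)
    (hj : t + j = P.K) (R : Reg P n) (hR : R.Inv ψ M e t) (τ q m : ℕ)
    (hG : ∀ (R : Reg P n) (t : ℕ), t ≤ P.K → R.Inv ψ M e t → R.Fine ψ ε t →
      1 ≤ G ⟨ket (R.setWt (P.wtOf M t (R.cnt (P.s t)))).bits,
        τ + (j * P.stageTime N TT + 4 ^ (P.cb + (P.h + 1))), q + j * (N * (B + 4 * M)),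
        m + j * N⟩) :
    (r ^ N * (1 - δ ^ N)) ^ j ≤
      wp (accessSem A _ U F) F (P.stage A M N ε j t) G ⟨ket R.bits, τ, q, m⟩ := by
  have hε : 0 < ε := h.η_pos.trans_le h.η_le
  have hδN : δ ^ N ≤ 1 := pow_le_one₀ hδ0.le hδ1.le
  have hδN0 : 0 < δ ^ N := pow_pos hδ0 N
  have hrN0 : 0 ≤ r ^ N := pow_nonneg hr0 N
  have hrN1 : r ^ N ≤ 1 := pow_le_one₀ hr0 hr1
  have hw0 : 0 ≤ r ^ N * (1 - δ ^ N) := mul_nonneg hrN0 (by linarith)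
  have hw1 : r ^ N * (1 - δ ^ N) ≤ 1 := by nlinarith
  induction j generalizing t R τ q m with
  | zero =>
    obtain rfl : t = P.K := by omega
    rw [pow_zero, Par.stage, wp_finish R M P.K hR.wt]
    refine (hG R P.K le_rfl hR (R.fine_of_lt ψ hε ?_)).trans (G.anti _ ?_ ?_ ?_)
    -- all `K = 4 / c²` slots are filled, so that the residual vector has norm zero
    · have := hR.dec
      rw [h.K_mul] at this
      linarith
    all_goals simp
  | succ j ih =>
    have htK : t < P.K := by omega
    obtain ⟨x0, hx0, hcnt, hc0⟩ := hR.est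
    have hest := abs_le.1 (h.abs_estVal_sub_le R ψ htK.le hx0 hc0)
    rw [← hcnt] at hest
    have hc := h.c_le
    have hcε : P.c ^ 2 ≤ ε / 8 := by
      have := h.η_le
      have := h.ε_lt
      have := h.η_pos
      nlinarith
    have hfin : ∀ τ' q' m', R.Fine ψ ε t →
        τ' ≤ τ + (j + 1) * P.stageTime N TT → q' ≤ q + (j + 1) * (N * (B + 4 * M)) →
        m' ≤ m + (j + 1) * N →
        1 ≤ wp (accessSem A _ U F) F (P.finish M t) G ⟨ket R.bits, τ', q', m'⟩ := by
      intro τ' q' m' hf h1 h2 h3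
      rw [wp_finish R M t hR.wt]
      exact (hG R t htK.le hR hf).trans (G.anti _ (by omega) h2 h3)
    rw [Par.stage, wp_seq, wp_guard R M t ε hR.grd]
    by_cases hg : 3 * ε / 4 ≤ P.estVal M t (R.cnt (P.s t))
    · have hgw : SuppOn (ket ((R.setGrd true).bits : P.W n A.wire → Bool))
          fun b => b .grd = true := (suppOn_ket _).mono fun b hb => by rw [hb]; rfl
      rw [decide_eq_true hg, wp_branch_true _ _ _ _ _ _ _ _ hgw, wp_seq,
        wp_clear_grd R hR.grd, wp_seq]
      have hres : ε / 2 ≤ nsq (R.res ψ t) := by linarith [hest.2]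
      have hres0 : 0 < nsq (R.res ψ t) := by linarith
      set W := (r ^ N * (1 - δ ^ N)) ^ j with hW
      have hW0 : 0 ≤ W := pow_nonneg hw0 j
      have hW1 : W ≤ 1 := pow_le_one₀ hw0 hw1
      have hsucc : ∀ R' : Reg P n, R'.Inv ψ M e (t + 1) →
          W ≤ wp (accessSem A _ U F) F (.branch (.acc (P.s t)) (P.stage A M N ε j (t + 1))
            (P.finish M t)) G ⟨ket R'.bits, τ + 4 ^ (P.cb + 1) + 1 + 4 ^ 1 + (N * TT + 1),
              q + N * (B + 4 * M), m + N⟩ := by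
        intro R' hR'
        rw [wp_branch_true _ _ _ _ _ _ _ _ (suppOn_acc R' t true (hR'.used t (by omega)))]
        refine ih (t + 1) (by omega) R' hR' _ _ _ fun R2 t2 ht2 hR2 hf2 =>
          (hG R2 t2 ht2 hR2 hf2).trans (G.anti _ ?_ ?_ ?_)
        · rw [Nat.succ_mul j]
          simp only [Par.stageTime]
          omega
        · rw [Nat.succ_mul j]; omega
        · rw [Nat.succ_mul j]; omega
      have hsame : R.Fine ψ ε t →
          W ≤ wp (accessSem A _ U F) F (.branch (.acc (P.s t)) (P.stage A M N ε j (t + 1))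
            (P.finish M t)) G ⟨ket R.bits, τ + 4 ^ (P.cb + 1) + 1 + 4 ^ 1 + (N * TT + 1),
              q + N * (B + 4 * M), m + N⟩ := by
        intro hf
        rw [wp_branch_false _ _ _ _ _ _ _ _ (suppOn_acc R t false (hR.acc t le_rfl htK.le))]
        refine hW1.trans (hfin _ _ _ hf ?_ ?_ ?_)
        · rw [Nat.succ_mul j]
          simp only [Par.stageTime]
          omega
        · rw [Nat.succ_mul j]; omega
        · rw [Nat.succ_mul j]; omega
      -- If the residual state may be accepted already, the subroutine promises nothing, but neither
      -- outcome of the tries does harm; otherwise the Gowers proxy is large, and the tries have to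
      -- succeed.
      by_cases hf : R.Fine ψ ε t
      · have key := le_wp_tries ψ hU h herr hB hF hA hR htK hres hr0 hr1 (hrp R t htK hres) (ρ := 0)
          (x := W) (y := W) (A.prob_nonneg _ _ _) le_rfl zero_le_one hW0 le_rfl (hTT t htK)
          N _ _ _ _ hsucc (hsame hf)
        refine le_trans ?_ key
        rw [pow_succ]
        have := mul_nonneg hW0 hrN0
        simp only [sub_zero, one_pow]
        nlinarith
      · have hgow : ε ^ 6 ≤ gowersProxy (R.unit ψ t) := by
          rw [Reg.Fine, not_lt] at hf
          refine le_gowersProxy_of_le_stabFidelity _ hε.le ?_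
          have h1 : nsq (R.res ψ t) ≤ 1 := by
            have := hR.dec
            have : 0 ≤ (t : ℝ) * (P.c ^ 2 / 4) := by positivity
            linarith
          have h2 : 0 ≤ stabFidelity (R.unit ψ t) := by
            by_contra h3
            nlinarith
          nlinarith
        have key := le_wp_tries ψ hU h herr hB hF hA hR htK hres hr0 hr1 (hrp R t htK hres)
          (ρ := 1 - δ) (x := 0) (y := W) (hS _ (R.unit_isState ψ t hres0) hgow) (by linarith)
          (by linarith) le_rfl hW0 (hTT t htK) N _ _ _ _ hsucc (Post.nonneg _ _)
        refine le_trans (le_of_eq ?_) key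
        rw [pow_succ, sub_sub_cancel, mul_zero, add_zero]
        ring
    · have hgw : SuppOn (ket ((R.setGrd false).bits : P.W n A.wire → Bool))
          fun b => b .grd = false := (suppOn_ket _).mono fun b hb => by rw [hb]; rfl
      have hRg : R.setGrd false = R := by
        have := hR.grd
        cases R
        simp only at this
        subst this
        rfl
      rw [decide_eq_false hg, wp_branch_false _ _ _ _ _ _ _ _ hgw, hRg]
      -- a residual vector of squared norm below `ε` may be accepted, whatever its stabilizer
      -- fidelity
      have hf : R.Fine ψ ε t := R.fine_of_lt ψ hε (by linarith [hest.1])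
      refine (pow_le_one₀ hw0 hw1).trans (hfin _ _ _ hf ?_ (by omega) (by omega))
      rw [Nat.succ_mul j]
      simp only [Par.stageTime]
      omega

end Stage

/-! ### Correctness of the output -/

/-- The digits of `-2^{-h}`, `0` and `2^{-h}`: the last digit is set if the number is not zero, and
the others are set if it is negative. -/
lemma fixedPoint_sign {h : ℕ} (hh : 1 ≤ h) (x y : Bool) (hxy : x = true → y = true) :
    fixedPoint (fun j : Fin (h + 1) => if j = Fin.last h then y else x) =
      (1 / 2 : ℝ) ^ h * if y then (if x then -1 else 1) else 0 := by
  have hlast : (Fin.last h) ≠ 0 := by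
    intro h0
    have := congrArg Fin.val h0
    simp at this
    omega
  have hgeom : ∀ k : ℕ, ∑ j : Fin k, (1 / 2 : ℝ) ^ ((j : ℕ) + 1) = 1 - (1 / 2) ^ k := by
    intro k
    induction k with
    | zero => simp
    | succ k ih => rw [Fin.sum_univ_castSucc]; simp only [Fin.val_castSucc, Fin.val_last, ih]; ring
  have hsum : ∑ j : Fin h, (if j.castSucc = 0 then (-1 : ℝ) else (1 / 2) ^ (j.castSucc : ℕ)) =
      -2 * (1 / 2) ^ h := by
    obtain ⟨k, rfl⟩ := Nat.exists_eq_add_of_le' hh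
    rw [Fin.sum_univ_succ]
    have : ∀ j : Fin k, (Fin.succ j).castSucc ≠ (0 : Fin (k + 1 + 1)) := fun j h0 => by
      have := congrArg Fin.val h0
      simp at this
    simp only [this, if_false, Fin.castSucc_zero, if_true, Fin.val_castSucc, Fin.val_succ, hgeom]
    ring
  rw [fixedPoint, Fin.sum_univ_castSucc]
  have hne : ∀ j : Fin h, (j.castSucc = Fin.last h) = False := fun j =>
    eq_false (Fin.castSucc_lt_last j).ne
  simp only [hne, if_false, if_true, hlast]
  cases x <;> cases y
  · simp
  · simp
  · simp at hxy
  · simp only [if_true, hsum, Fin.val_last]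
    ring

section Correct

variable {n S : ℕ} {A : BaseAlg n S} {P : Par} {U : Matrix.unitaryGroup (Bits n) ℂ} {F : ℕ}

/-- The decomposition algorithm. -/
abbrev Par.alg (P : Par) (A : BaseAlg n S) (M N : ℕ) (ε : ℝ) : DecompAlg n A.wire where
  wire := P.W n A.wire
  prog := .seq (P.est M 0) (P.stage A M N ε P.K 0)
  terms := P.K
  prec := P.h
  used i := .acc (P.s i)
  re i j := if j = Fin.last P.h then .ph (P.s i) 1 else .ph (P.s i) 0
  im i j := if j = Fin.last P.h then .ph (P.s i) 3 else .ph (P.s i) 2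
  desc i l := .desc (P.s i) l
  weight j := .wt j

/-- The digits of a phase, repeated as in `Par.alg`, represent `c ω`. -/
lemma fixedPoint_phase {h : ℕ} (hh : 1 ≤ h) {p : Bits 4} (hp : p ∈ phases) :
    (⟨fixedPoint fun j : Fin (h + 1) => if j = Fin.last h then p 1 else p 0,
      fixedPoint fun j : Fin (h + 1) => if j = Fin.last h then p 3 else p 2⟩ : ℂ) =
      (((1 / 2 : ℝ) ^ h : ℝ) : ℂ) * omegaOf p := by
  have h1 : (p 0 = true → p 1 = true) ∧ (p 2 = true → p 3 = true) := by
    simp only [phases, List.mem_cons, List.not_mem_nil, or_false] at hp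
    rcases hp with rfl | rfl | rfl | rfl <;> simp
  rw [fixedPoint_sign hh _ _ h1.1, fixedPoint_sign hh _ _ h1.2]
  apply Complex.ext <;>
    simp only [Complex.re_ofReal_mul, Complex.im_ofReal_mul, omegaOf]

/-- Accurate final registers describe a decomposition with the required properties. -/
lemma Par.Valid.isDecomposition {M N : ℕ} {e ε η kmax : ℝ} (h : P.Valid M e ε η)
    (hk : (P.K : ℝ) ≤ kmax) (ψ : Vec n) {R : Reg P n} {t : ℕ} (ht : t ≤ P.K)
    (hR : R.Inv ψ M e t) (hf : R.Fine ψ ε t) :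
    (P.alg A M N ε).IsDecomposition (R.setWt (P.wtOf M t (R.cnt (P.s t)))).bits ψ ε kmax := by
  set R' := R.setWt (P.wtOf M t (R.cnt (P.s t))) with hR'
  have hmem : ∀ i : Fin P.K, i ∈ (P.alg A M N ε).support R'.bits ↔ (i : ℕ) < t := by
    intro i
    have h1 : i ∈ (P.alg A M N ε).support R'.bits ↔ R.acc (P.s i) = true := by
      simp only [DecompAlg.support, Finset.mem_filter, Finset.mem_univ, true_and]
      rfl
    rw [h1]
    by_cases hi : (i : ℕ) < t
    · simp [hR.used i hi, hi]
    · simp [hR.acc i (by omega) i.2.le, hi]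
  have hcoeff : ∀ i : Fin P.K, (i : ℕ) < t →
      (P.alg A M N ε).coeff R'.bits i = (P.c : ℂ) * omegaOf (R.ph (P.s i)) := by
    intro i hi
    rw [Par.c, ← fixedPoint_phase h.one_le_h (hR.phase i hi)]
    have h1 : ∀ j : Fin (P.h + 1), R'.bits ((P.alg A M N ε).re i j) =
        if j = Fin.last P.h then R.ph (P.s i) 1 else R.ph (P.s i) 0 := by
      intro j
      change Reg.bits R' (if j = Fin.last P.h then _ else _) = _
      split_ifs <;> rfl
    have h2 : ∀ j : Fin (P.h + 1), R'.bits ((P.alg A M N ε).im i j) =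
        if j = Fin.last P.h then R.ph (P.s i) 3 else R.ph (P.s i) 2 := by
      intro j
      change Reg.bits R' (if j = Fin.last P.h then _ else _) = _
      split_ifs <;> rfl
    exact congrArg₂ Complex.mk (congrArg fixedPoint (funext h1)) (congrArg fixedPoint (funext h2))
  have hc0 := P.c_pos
  have hε : 0 < ε := h.η_pos.trans_le h.η_le
  have hcle := h.c_le
  have hηle := h.η_le
  have hηpos := h.η_pos
  have hεlt := h.ε_lt
  have hcε : P.c ^ 2 ≤ ε ^ 2 / 8 := by nlinarith
  have hc1 : P.c < 1 := by nlinarith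
  have hdec : nsq (R.res ψ t) ≤ 1 := by
    have := hR.dec
    have : 0 ≤ (t : ℝ) * (P.c ^ 2 / 4) := by positivity
    linarith
  refine ⟨?_, ?_, ?_⟩
  · have : ((P.alg A M N ε).support R'.bits).card ≤ P.K := by
      refine (Finset.card_le_univ _).trans (le_of_eq ?_)
      exact Fintype.card_fin P.K
    have h2 : (((P.alg A M N ε).support R'.bits).card : ℝ) ≤ P.K := by exact_mod_cast this
    exact h2.trans hk
  · intro i hi
    have hi' := (hmem i).1 hi
    refine ⟨StabDesc.isStabilizer _, ?_⟩
    rw [hcoeff i hi', norm_mul, norm_omegaOf (hR.phase i hi'), mul_one, Complex.norm_real,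
      Real.norm_of_nonneg hc0.le]
    exact ⟨hc0, hc1⟩
  · have hsum : ∑ i ∈ (P.alg A M N ε).support R'.bits,
        (P.alg A M N ε).coeff R'.bits i • (P.alg A M N ε).stab R'.bits i =
        ψ - R.res ψ t := by
      rw [Reg.res, sub_sub_cancel]
      have h1 : ∑ i ∈ (P.alg A M N ε).support R'.bits,
          (P.alg A M N ε).coeff R'.bits i • (P.alg A M N ε).stab R'.bits i =
          ∑ i : Fin P.K, if (i : ℕ) < t then
            (P.c : ℂ) • omegaOf (R.ph (P.s i)) • (R.desc (P.s i)).state else 0 := by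
        rw [← Finset.sum_filter]
        refine Finset.sum_congr ?_ fun i hi => ?_
        · ext i
          rw [hmem i]; simp
        · rw [hcoeff i (Finset.mem_filter.1 hi).2, mul_smul]
          rfl
      rw [h1, Fin.sum_univ_eq_sum_range (fun i => if i < t then
        (P.c : ℂ) • omegaOf (R.ph (P.s i)) • (R.desc (P.s i)).state else 0), ← Finset.sum_filter]
      refine Finset.sum_congr ?_ fun i _ => rfl
      ext i
      simp only [Finset.mem_filter, Finset.mem_range]
      omega
    have hw : |(P.alg A M N ε).weightOut R'.bits - Real.sqrt (nsq (R.res ψ t))| ≤ ε := by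
      set s := min 1 (Real.sqrt (P.estVal M t (R.cnt (P.s t)))) with hs
      have h1 : |(P.alg A M N ε).weightOut R'.bits - s| ≤ P.c :=
        abs_fixedPoint_digits_sub_le P.h (le_min zero_le_one (Real.sqrt_nonneg _)) (min_le_left _ _)
      obtain ⟨x, hx, hcnt, hcl⟩ := hR.est
      have h2 := h.abs_estVal_sub_le R ψ ht hx hcl
      rw [← hcnt] at h2
      have h3 : 0 ≤ P.estVal M t (R.cnt (P.s t)) := by rw [Par.estVal]; positivity
      set a := Real.sqrt (P.estVal M t (R.cnt (P.s t))) with ha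
      set b := Real.sqrt (nsq (R.res ψ t)) with hb
      have ha0 : 0 ≤ a := Real.sqrt_nonneg _
      have hb0 : 0 ≤ b := Real.sqrt_nonneg _
      have hb1 : b ≤ 1 := Real.sqrt_le_one.2 hdec
      -- `(a - b)² ≤ |a² - b²|` for nonnegative `a` and `b`, and the right side is at most `c² / 8`
      have h4 : |a - b| ≤ P.c / 2 := by
        refine abs_le_of_sq_le_sq ?_ (by positivity)
        have h5 : (a - b) ^ 2 ≤ |a ^ 2 - b ^ 2| := by
          rw [← sq_abs, show a ^ 2 - b ^ 2 = (a - b) * (a + b) by ring, abs_mul, sq]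
          refine mul_le_mul_of_nonneg_left ?_ (abs_nonneg _)
          rw [abs_of_nonneg (add_nonneg ha0 hb0), abs_le]
          constructor <;> linarith
        rw [Real.sq_sqrt h3, Real.sq_sqrt (nsq_nonneg _)] at h5
        nlinarith
      have h6 : |s - b| ≤ |a - b| := by
        rcases min_choice 1 a with h7 | h7
        · rw [hs, h7, abs_of_nonneg (by linarith)]
          have := min_eq_left_iff.1 h7
          exact le_trans (by linarith) (le_abs_self _)
        · rw [hs, h7]
      have h8 : |(P.alg A M N ε).weightOut R'.bits - b| ≤ P.c + P.c / 2 := by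
        calc |(P.alg A M N ε).weightOut R'.bits - b| =
            |((P.alg A M N ε).weightOut R'.bits - s) + (s - b)| := by ring_nf
          _ ≤ _ := (abs_add_le _ _).trans (add_le_add h1 (h6.trans h4))
      refine h8.trans ?_
      nlinarith
    refine ⟨Real.sqrt (nsq (R.res ψ t)), if nsq (R.res ψ t) = 0 then Pi.single (zeroBits n) 1 else
      R.unit ψ t, Real.sqrt_nonneg _, Real.sqrt_le_one.2 hdec, hw, ?_⟩
    rw [hsum]
    -- If the residual vector is zero, then any state serves as the remainder, with weight zero.
    by_cases h0 : nsq (R.res ψ t) = 0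
    · have hres : R.res ψ t = 0 := by
        funext b
        have := (Finset.sum_eq_zero_iff_of_nonneg fun b _ => sq_nonneg ‖R.res ψ t b‖).1 h0 b
          (Finset.mem_univ b)
        simpa using this
      rw [if_pos h0, h0]
      refine ⟨(zero_state_isStabilizer n).1, ?_, ?_⟩
      · rw [hres]; simp
      · simpa using hε
    · have hpos := lt_of_le_of_ne (nsq_nonneg (R.res ψ t)) (Ne.symm h0)
      have hsq := Real.sqrt_pos.2 hpos
      rw [if_neg h0, Real.sq_sqrt hpos.le]
      refine ⟨R.unit_isState ψ t hpos, ?_, hf⟩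
      rw [Reg.unit, smul_smul, ← Complex.ofReal_mul, mul_one_div_cancel hsq.ne',
        Complex.ofReal_one, one_smul, sub_add_cancel]

open Classical in
/-- The probability of an output with a given property, within given costs. -/
def outPost {ι : Type} [Fintype ι] [DecidableEq ι] (T Q N : ℕ) (good : (ι → Bool) → Prop) :
    Post ι where
  val c := if c.time ≤ T ∧ c.queries ≤ Q ∧ c.calls ≤ N then
    ∑ b, if good b then ‖c.state b‖ ^ 2 else 0 else 0
  nonneg' c := by
    split_ifs
    · exact Finset.sum_nonneg fun b _ => by split_ifs <;> positivity
    · exact le_rfl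
  smul' z c := by
    simp only [Conf.act, add_zero]
    split_ifs
    · rw [Finset.mul_sum]
      refine Finset.sum_congr rfl fun b _ => ?_
      split_ifs
      · simp [mul_pow]
      · simp
    · simp
  anti' t q m c := by
    simp only [Conf.act, one_smul]
    by_cases h : c.time + t ≤ T ∧ c.queries + q ≤ Q ∧ c.calls + m ≤ N
    · rw [if_pos h, if_pos (by omega)]
    · rw [if_neg h]
      split_ifs
      · exact Finset.sum_nonneg fun b _ => by split_ifs <;> positivity
      · exact le_rfl

/-- The registers at the beginning. -/
def Reg.zero (P : Par) (n : ℕ) : Reg P n where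
  desc _ _ := false
  ph _ _ := false
  acc _ := false
  cnt _ := zeroBits _
  wt _ := false
  grd := false
  z := false

/-- The success probability of the decomposition algorithm. -/
lemma le_prob_alg (ψ : Vec n) (hU : (U : Matrix (Bits n) (Bits n) ℂ) *ᵥ ket (zeroBits n) = ψ)
    {M B T N TT : ℕ} {e ε η δ kmax : ℝ} (h : P.Valid M e ε η) (hk : (P.K : ℝ) ≤ kmax)
    (herr : estErr M e ≤ 1) {T' Q' N' : ℕ} (hB : B + 1 ≤ T') (hF : T ≤ T')
    (hA : ∀ u : Vec n, IsState u → A.prob u T (fun _ => True) = 1)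
    (hδ0 : 0 < δ) (hδ1 : δ < 1) (hS : A.Succeeds T (ε ^ 6) η δ) {r : ℝ}
    (hr0 : 0 ≤ r) (hr1 : r ≤ 1) (hrp : ∀ (R : Reg P n) (t : ℕ), t < P.K →
      ε / 2 ≤ nsq (R.res ψ t) → r ≤ R.tryProb ψ S M B e t)
    (hTT : ∀ t < P.K, P.tryTime A M t B T ≤ TT)
    (hT' : (P.est M 0 : P.Pg n A.wire).size +
      (P.K * P.stageTime N TT + 4 ^ (P.cb + (P.h + 1))) ≤ T')
    (hQ' : M + P.K * (N * (B + 4 * M)) ≤ Q') (hN' : P.K * N ≤ N') :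
    (1 - estErr M e) * (r ^ N * (1 - δ ^ N)) ^ P.K ≤
      DecompAlg.prob A (P.alg A M N ε) U T' Q' N'
        (fun b => (P.alg A M N ε).IsDecomposition b ψ ε kmax) := by
  classical
  set good : (P.W n A.wire → Bool) → Prop := fun b =>
    (P.alg A M N ε).IsDecomposition b ψ ε kmax with hgood
  set G := outPost T' Q' N' good with hG
  have hψ : nsq ψ = 1 := by rw [← hU]; exact nsq_column
  have hval : ∀ (R : Reg P n) (τ q m : ℕ), good R.bits → τ ≤ T' → q ≤ Q' → m ≤ N' →
      1 ≤ G ⟨ket R.bits, τ, q, m⟩ := by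
    intro R τ q m hb h1 h2 h3
    simp only [hG, outPost]
    rw [if_pos ⟨h1, h2, h3⟩]
    refine le_trans (le_of_eq ?_) (Finset.single_le_sum (a := R.bits) (fun b _ => ?_)
      (Finset.mem_univ _))
    · rw [if_pos hb, ket_apply, if_pos rfl]; simp
    · split_ifs <;> positivity
  have hw0 : 0 ≤ (r ^ N * (1 - δ ^ N)) ^ P.K := by
    have := pow_le_one₀ (n := N) hδ0.le hδ1.le
    exact pow_nonneg (mul_nonneg (pow_nonneg hr0 N) (by linarith)) _
  have key : (1 - estErr M e) * (r ^ N * (1 - δ ^ N)) ^ P.K ≤ wp (accessSem A _ U T') T'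
      (.seq (P.est M 0) (P.stage A M N ε P.K 0)) G ⟨ket (Reg.zero P n).bits, 0, 0, 0⟩ := by
    rw [wp_seq]
    refine le_wp_est ψ hU (Reg.zero P n) rfl (Nat.zero_le _) (fun i hi => absurd hi (by omega)) rfl
      M h.e_pos h.e_le hw0 _ 0 0 0 fun x hx hxp => ?_
    have hR : Reg.Inv ((Reg.zero P n).setCnt 0 (enc P.cb x)) ψ M e 0 := by
      refine ⟨rfl, rfl, rfl, fun i hi => absurd hi (by omega), fun i hi => absurd hi (by omega),
        fun _ _ _ => rfl, fun _ _ _ => rfl, fun _ _ _ => rfl, fun i h1 h2 => ?_,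
        ⟨x, hx, ?_, hxp⟩, ?_⟩
      · exact Function.update_of_ne (P.s_ne h2 (by omega) (by omega)) _ _
      · exact Function.update_self (P.s 0) _ (Reg.zero P n).cnt
      · simp [Reg.res, hψ]
    refine le_wp_stage ψ hU h herr hB hF hA hδ0 hδ1 hS hr0 hr1 hrp hTT G P.K 0 (by omega) _ hR _ _ _
      fun R t ht hRt hf => hval _ _ _ _ (h.isDecomposition hk ψ ht hRt hf) ?_ ?_ ?_
    · rw [zero_add]; exact hT'
    · rw [zero_add]; exact hQ'
    · rw [zero_add]; exact hN'
  refine key.trans (le_of_eq ?_)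
  have hstart : (P.alg A M N ε).start = ⟨ket (Reg.zero P n).bits, 0, 0, 0⟩ := by
    simp only [DecompAlg.start, Conf.mk.injEq, and_true]
    funext b
    rw [ket_apply]
    have : (∀ i, b i = false) ↔ b = (Reg.zero P n).bits := by
      rw [funext_iff]
      refine forall_congr' fun i => ?_
      have : (Reg.zero P n).bits i = false := by cases i <;> rfl
      rw [this]
    exact if_congr this rfl rfl
  rw [DecompAlg.prob, hstart]
  refine congrArg List.sum (List.map_congr_left fun c _ => ?_)
  by_cases hc : c.time ≤ T' ∧ c.queries ≤ Q' ∧ c.calls ≤ N' <;> simp [hG, outPost, hc, hgood]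

end Correct

/-! ### Cost bounds -/

/-- Constant factors are absorbed by a further power of `V`. -/
lemma le_pow_of_le_mul {V a c k j : ℕ} (hV : 4096 ≤ V) (h : a ≤ c * V ^ k) (hc : c ≤ 4096)
    (hk : k < j) : a ≤ V ^ j :=
  calc a ≤ c * V ^ k := h
    _ ≤ V * V ^ k := Nat.mul_le_mul_right _ (hc.trans hV)
    _ = V ^ (k + 1) := by rw [pow_succ, mul_comm]
    _ ≤ V ^ j := Nat.pow_le_pow_right (by omega) hk

lemma allGates_length (n : ℕ) : (allGates n).length = 2 * n + n ^ 2 := by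
  simp [allGates, List.length_flatMap]
  ring

lemma gateSeq_length (n : ℕ) : (gateSeq n).length = 16 * n ^ 2 * (2 * n + n ^ 2) := by
  rw [gateSeq, List.length_flatten, List.map_replicate, List.sum_replicate, allGates_length,
    smul_eq_mul]

/-- All sizes of registers and numbers of repetitions are bounded by `V`. -/
structure Par.Small (P : Par) (n M N V : ℕ) : Prop where
  base : 4096 ≤ V
  n_le : n ≤ V
  K_le : P.K ≤ V
  N_le : N ≤ V
  M_le : M ≤ V
  cb_le : 2 ^ P.cb ≤ V
  h_le : 2 ^ P.h ≤ V
  m_le : 2 ^ P.m ≤ V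
  len_le : (gateSeq n).length ≤ V

lemma four_pow_le {a V : ℕ} (h : 2 ^ a ≤ V) : 4 ^ a ≤ V ^ 2 := by
  rw [show (4 : ℕ) = 2 ^ 2 by norm_num, ← pow_mul, mul_comm, pow_mul]
  exact Nat.pow_le_pow_left h 2

section Costs

variable {n S : ℕ} {A : BaseAlg n S} {P : Par} {M N V : ℕ} {κ : Type}

/-- The gates on the index register have size `4 ^ O(m)`, which is polynomial as `m` is logarithmic
in the number of terms. -/
lemma Par.Small.slotProg_le (h : P.Small n M N V) (i : ℕ) (tg : P.Target n κ) :
    (P.slotProg i tg : P.Pg n κ).size ≤ V ^ 5 := by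
  have hm := four_pow_le h.m_le
  have h1 : ∀ l, (P.slotGate i l tg : P.Pg n κ).size ≤ 256 * V ^ 2 := by
    intro l
    simp only [Par.slotGate, Prog.size]
    calc 4 ^ (P.m + 1 + 1 + ((gateSeq n).get l).arity) ≤ 4 ^ (P.m + 1 + 1 + 2) :=
          Nat.pow_le_pow_right (by norm_num) (by have := ((gateSeq n).get l).arity_le; omega)
      _ = 256 * 4 ^ P.m := by ring
      _ ≤ 256 * V ^ 2 := by omega
  have h2 : (((List.finRange (gateSeq n).length).map fun l => P.slotGate i l tg).map
      (Prog.size : P.Pg n κ → ℕ)).sum ≤ V * (256 * V ^ 2) := by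
    rw [List.map_map]
    refine (List.sum_le_card_nsmul _ (256 * V ^ 2) ?_).trans ?_
    · intro x hx
      obtain ⟨l, -, rfl⟩ := List.mem_map.1 hx
      exact h1 l
    · rw [List.length_map, List.length_finRange, smul_eq_mul]
      exact Nat.mul_le_mul_right _ h.len_le
  have h3 : (P.phaseGate i tg : P.Pg n κ).size ≤ 1024 * V ^ 2 := by
    simp only [Par.phaseGate, Prog.size]
    calc 4 ^ (P.m + 1 + 4 + 0) = 1024 * 4 ^ P.m := by ring
      _ ≤ 1024 * V ^ 2 := by omega
  have h0 := h.base
  refine le_pow_of_le_mul (c := 1281) (k := 3) h0 ?_ (by norm_num) (by norm_num)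
  have h4 : 1 ≤ V ^ 2 := Nat.one_le_pow _ _ (by omega)
  have h5 : V ^ 2 ≤ V ^ 3 := Nat.pow_le_pow_right (by omega) (by omega)
  have h6 : V * (256 * V ^ 2) = 256 * V ^ 3 := by ring
  simp only [Par.slotProg, Prog.size, Prog.size_seqs]
  omega

lemma Par.Small.attempt_le (h : P.Small n M N V) {t : ℕ} (ht : t ≤ P.K) (tg : P.Target n κ) :
    (P.attempt t tg : P.Pg n κ).size ≤ V ^ 7 := by
  have hm := four_pow_le h.m_le
  have h0 := h.base
  have h1 : (((List.range t).map fun i => P.slotProg i tg).map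
      (Prog.size : P.Pg n κ → ℕ)).sum ≤ V * V ^ 5 := by
    rw [List.map_map]
    refine (List.sum_le_card_nsmul _ (V ^ 5) ?_).trans ?_
    · intro x hx
      obtain ⟨l, -, rfl⟩ := List.mem_map.1 hx
      exact h.slotProg_le l tg
    · rw [List.length_map, List.length_range, smul_eq_mul]
      exact Nat.mul_le_mul_right _ (ht.trans h.K_le)
  have h2 : P.m ≤ V := (Nat.lt_two_pow_self).le.trans h.m_le
  have h3 := h.n_le
  refine le_pow_of_le_mul (c := 200) (k := 6) h0 ?_ (by norm_num) (by norm_num)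
  have h4 : V ≤ V ^ 6 := Nat.le_self_pow (by omega) V
  have h5 : V ^ 2 ≤ V ^ 6 := Nat.pow_le_pow_right (by omega) (by omega)
  have h6 : V * V ^ 5 = V ^ 6 := by ring
  have h7 : 4 ^ (P.m + 1) = 4 * 4 ^ P.m := by ring
  have h8 : 4 ^ (P.m + 1 + 1) = 16 * 4 ^ P.m := by ring
  simp only [Par.attempt, Par.lcu, Prog.size, Prog.size_seqs, size_measAll, size_resetAll,
    Par.zGate, List.length_map, List.length_finRange]
  omega

lemma Par.Small.trial_le (h : P.Small n M N V) {t : ℕ} (ht : t ≤ P.K) :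
    (P.trial t : P.Pg n κ).size ≤ V ^ 8 := by
  have h0 := h.base
  have h1 := h.attempt_le ht (P.workT : P.Target n κ)
  have h2 := four_pow_le h.cb_le
  have h3 := h.n_le
  refine le_pow_of_le_mul (c := 200) (k := 7) h0 ?_ (by norm_num) (by norm_num)
  have h4 : V ≤ V ^ 7 := Nat.le_self_pow (by omega) V
  have h5 : V ^ 2 ≤ V ^ 7 := Nat.pow_le_pow_right (by omega) (by omega)
  simp only [Par.trial, Prog.size, size_resetAll, List.length_map, List.length_finRange]
  omega

lemma Par.Small.est_le (h : P.Small n M N V) {t : ℕ} (ht : t ≤ P.K) :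
    (P.est M t : P.Pg n κ).size ≤ V ^ 10 := by
  have h0 := h.base
  refine le_pow_of_le_mul (c := 2) (k := 9) h0 ?_ (by norm_num) (by norm_num)
  have h4 : 1 ≤ V ^ 9 := Nat.one_le_pow _ _ (by omega)
  have h5 : M * (P.trial t : P.Pg n κ).size ≤ V * V ^ 8 := Nat.mul_le_mul h.M_le (h.trial_le ht)
  have h6 : V * V ^ 8 = V ^ 9 := by ring
  rw [Par.size_est]
  omega

lemma Par.Small.testTime_le (h : P.Small n M N V) {t : ℕ} (ht : t ≤ P.K) :
    P.testTime n M t ≤ V ^ 11 := by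
  have h0 := h.base
  have h1 := h.est_le (κ := Empty) ht
  rw [Par.size_est] at h1
  have h2 : 4 ^ (P.cb + P.cb + 1) ≤ 4 * V ^ 4 := by
    have := Nat.mul_le_mul (four_pow_le h.cb_le) (four_pow_le h.cb_le)
    calc 4 ^ (P.cb + P.cb + 1) = 4 * (4 ^ P.cb * 4 ^ P.cb) := by ring
      _ ≤ 4 * (V ^ 2 * V ^ 2) := by omega
      _ = 4 * V ^ 4 := by ring
  have h3 : P.cb ≤ V := (Nat.lt_two_pow_self).le.trans h.cb_le
  refine le_pow_of_le_mul (c := 1000) (k := 10) h0 ?_ (by norm_num) (by norm_num)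
  have h4 : V ≤ V ^ 10 := Nat.le_self_pow (by omega) V
  have h5 : V ^ 4 ≤ V ^ 10 := Nat.pow_le_pow_right (by omega) (by omega)
  rw [Par.testTime, show (4 : ℕ) ^ 4 = 256 by norm_num]
  calc _ = M * (P.trial t : P.Pg n Empty).size + 1 + 4 ^ (P.cb + P.cb + 1) + 6 * P.cb + 517 := by
        ring
    _ ≤ V ^ 10 + 4 * V ^ 10 + 6 * V ^ 10 + 517 * V ^ 10 := by
        gcongr
        · exact h2.trans (Nat.mul_le_mul_left 4 h5)
        · exact h3.trans h4
        · exact Nat.le_mul_of_pos_right _ (by positivity)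
    _ = 528 * V ^ 10 := by ring
    _ ≤ 1000 * V ^ 10 := Nat.mul_le_mul_right _ (by norm_num)

lemma Par.Small.overhead_le (h : P.Small n M N V) {T : ℕ} (hT : A.prog.size ≤ T) (hS : S ≤ T)
    (hT1 : 1 ≤ T) : A.overhead ≤ V ^ 2 * T := by
  have h0 := h.base
  have h1 := A.length_touched_le
  have h2 : S * n ≤ T * V := Nat.mul_le_mul hS h.n_le
  have h3 := h.len_le
  have h4 : V ≤ T * V := Nat.le_mul_of_pos_left V hT1
  have h5 : T ≤ T * V := Nat.le_mul_of_pos_right T (by omega)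
  have h6 : 4096 * (T * V) ≤ V * (T * V) := Nat.mul_le_mul_right _ h0
  have h7 : V * (T * V) = V ^ 2 * T := by ring
  rw [BaseAlg.overhead]
  omega

lemma Par.Small.genTime_le (h : P.Small n M N V) {T B t : ℕ} (hT : A.prog.size ≤ T) (hS : S ≤ T)
    (hT1 : 1 ≤ T) (ht : t ≤ P.K) (hB : B ≤ V * S) : P.genTime A t B T ≤ V ^ 9 * T := by
  have h0 := h.base
  have h1 := h.overhead_le hT hS hT1
  have h2 := h.attempt_le ht (P.workT : P.Target n A.wire)
  have h3 : B * ((P.attempt t P.workT : P.Pg n A.wire).size + 1) ≤ (V * T) * (V ^ 7 + 1) :=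
    Nat.mul_le_mul (hB.trans (Nat.mul_le_mul_left _ hS)) (by omega)
  have h4 : (V * T) * (V ^ 7 + 1) = V ^ 8 * T + V * T := by ring
  have h5 : V * T ≤ V ^ 8 * T := Nat.mul_le_mul_right _ (Nat.le_self_pow (by omega) V)
  have h6 : V ^ 2 * T ≤ V ^ 8 * T :=
    Nat.mul_le_mul_right _ (Nat.pow_le_pow_right (by omega) (by omega))
  have h7 : T ≤ V * T := Nat.le_mul_of_pos_left T (by omega)
  have h8 : 4096 * (V ^ 8 * T) ≤ V * (V ^ 8 * T) := Nat.mul_le_mul_right _ h0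
  have h9 : V * (V ^ 8 * T) = V ^ 9 * T := by ring
  rw [Par.genTime]
  omega

lemma Par.Small.tryTime_le (h : P.Small n M N V) {T B t : ℕ} (hT : A.prog.size ≤ T) (hS : S ≤ T)
    (hT1 : 1 ≤ T) (ht : t < P.K) (hB : B ≤ V * S) : P.tryTime A M t B T ≤ V ^ 12 * T := by
  have h0 := h.base
  have h1 := h.genTime_le hT hS hT1 ht.le hB
  have h2 : P.testTime n M (t + 1) ≤ V ^ 11 := h.testTime_le ht
  have h3 := h.len_le
  have h4 : V ^ 9 * T ≤ V ^ 11 * T :=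
    Nat.mul_le_mul_right _ (Nat.pow_le_pow_right (by omega) (by omega))
  have h5 : V ^ 11 ≤ V ^ 11 * T := Nat.le_mul_of_pos_right _ hT1
  have h6 : V ≤ V ^ 11 := Nat.le_self_pow (by omega) V
  have h8 : 4096 * (V ^ 11 * T) ≤ V * (V ^ 11 * T) := Nat.mul_le_mul_right _ h0
  have h9 : V * (V ^ 11 * T) = V ^ 12 * T := by ring
  rw [Par.tryTime]
  omega

lemma Par.Small.size_trySlot_le (h : P.Small n M N V) {T t : ℕ} (hT : A.prog.size ≤ T)
    (hS : S ≤ T) (hT1 : 1 ≤ T) (ht : t < P.K) : (P.trySlot A M t).size ≤ V ^ 12 * T := by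
  have h0 := h.base
  have h1 := h.overhead_le hT hS hT1
  have h2 : P.testTime n M (t + 1) ≤ V ^ 11 := h.testTime_le ht
  have h3 := h.len_le
  have hatt := h.attempt_le ht.le (P.workT : P.Target n A.wire)
  have hcopies : (((List.finRange S).map (P.copy A t)).map Prog.size).sum ≤ T * (V ^ 7 + 5) := by
    rw [List.map_map]
    refine (List.sum_le_card_nsmul _ (V ^ 7 + 5) ?_).trans ?_
    · intro x hx
      obtain ⟨c, -, rfl⟩ := List.mem_map.1 hx
      simp only [Function.comp_apply, Par.copy, Prog.size]
      rw [P.size_attempt_eq t (P.copyT A c) (P.workT : P.Target n A.wire)]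
      omega
    · rw [List.length_map, List.length_finRange, smul_eq_mul]
      exact Nat.mul_le_mul_right _ hS
  have htests : ((phases.map (P.test M t : Bits 4 → P.Pg n A.wire)).map Prog.size).sum ≤
      4 * V ^ 11 := by
    rw [List.map_map]
    refine (List.sum_le_card_nsmul _ (V ^ 11) ?_).trans (le_of_eq ?_)
    · intro x hx
      obtain ⟨p, -, rfl⟩ := List.mem_map.1 hx
      exact (P.size_test_le M t p).trans h2
    · simp [phases]
  have hcall : (P.callOut A t).size = A.overhead := by
    have : (((List.finRange (gateSeq n).length).map (P.copyOut A t)).map Prog.size).sum =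
        16 * (gateSeq n).length := by
      rw [List.map_map]
      have : Prog.size ∘ P.copyOut A t = fun _ => 16 := by
        funext l; simp [Par.copyOut, cxor, Prog.size]
      rw [this]
      simp [mul_comm]
    simp only [Par.callOut, Prog.size, size_measAll, size_resetAll, Prog.size_seqs, this,
      BaseAlg.overhead, List.length_map]
    ring
  have h4 : V ^ 2 * T ≤ V ^ 11 * T :=
    Nat.mul_le_mul_right _ (Nat.pow_le_pow_right (by omega) (by omega))
  have h5 : V ^ 11 ≤ V ^ 11 * T := Nat.le_mul_of_pos_right _ hT1
  have h6 : V ≤ V ^ 11 := Nat.le_self_pow (by omega) V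
  have h7 : T * (V ^ 7 + 5) = V ^ 7 * T + 5 * T := by ring
  have h10 : V ^ 7 * T ≤ V ^ 11 * T :=
    Nat.mul_le_mul_right _ (Nat.pow_le_pow_right (by omega) (by omega))
  have h11 : T ≤ V ^ 11 * T := Nat.le_mul_of_pos_left T (by omega)
  have h8 : 4096 * (V ^ 11 * T) ≤ V * (V ^ 11 * T) := Nat.mul_le_mul_right _ h0
  have h9 : V * (V ^ 11 * T) = V ^ 12 * T := by ring
  simp only [Par.trySlot, Par.gen, Prog.size, Prog.size_seqs, size_resetAll, List.length_map,
    List.length_finRange, hcall]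
  omega

lemma Par.Small.finish_le (h : P.Small n M N V) : 4 ^ (P.cb + (P.h + 1)) ≤ V ^ 5 := by
  refine le_pow_of_le_mul (c := 4) (k := 4) h.base ?_ (by norm_num) (by norm_num)
  have := Nat.mul_le_mul (four_pow_le h.cb_le) (four_pow_le h.h_le)
  calc 4 ^ (P.cb + (P.h + 1)) = 4 * (4 ^ P.cb * 4 ^ P.h) := by ring
    _ ≤ 4 * (V ^ 2 * V ^ 2) := by omega
    _ = 4 * V ^ 4 := by ring

lemma Par.Small.stageTime_le (h : P.Small n M N V) {T TT : ℕ} (hT1 : 1 ≤ T)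
    (hTT : TT ≤ V ^ 12 * T) : P.stageTime N TT ≤ V ^ 14 * T := by
  have h0 := h.base
  have h1 := four_pow_le h.cb_le
  have h2 : N * TT ≤ V * (V ^ 12 * T) := Nat.mul_le_mul h.N_le hTT
  have h3 : V * (V ^ 12 * T) = V ^ 13 * T := by ring
  have h4 : V ^ 2 ≤ V ^ 13 := Nat.pow_le_pow_right (by omega) (by omega)
  have h5 : V ^ 13 ≤ V ^ 13 * T := Nat.le_mul_of_pos_right _ hT1
  have h6 : 1 ≤ V ^ 13 := Nat.one_le_pow _ _ (by omega)
  have h7 : 4 ^ (P.cb + 1) = 4 * 4 ^ P.cb := by ring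
  have h8 : 4096 * (V ^ 13 * T) ≤ V * (V ^ 13 * T) := Nat.mul_le_mul_right _ h0
  have h9 : V * (V ^ 13 * T) = V ^ 14 * T := by ring
  rw [Par.stageTime]
  omega

lemma Par.Small.size_stage_le (h : P.Small n M N V) {T : ℕ} (hT : A.prog.size ≤ T) (hS : S ≤ T)
    (hT1 : 1 ≤ T) (ε : ℝ) (j t : ℕ) (hj : t + j = P.K) :
    (P.stage A M N ε j t).size ≤ j * (V ^ 14 * T) + V ^ 5 := by
  have h0 := h.base
  induction j generalizing t with
  | zero =>
    rw [Par.stage, zero_mul, zero_add]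
    exact h.finish_le
  | succ j ih =>
    have h1 := ih (t + 1) (by omega)
    have h2 := h.size_trySlot_le (t := t) hT hS hT1 (by omega)
    have h3 : N * (P.trySlot A M t).size ≤ V * (V ^ 12 * T) := Nat.mul_le_mul h.N_le h2
    have h4 : V * (V ^ 12 * T) = V ^ 13 * T := by ring
    have h5 := four_pow_le h.cb_le
    have h6 : V ^ 2 ≤ V ^ 13 := Nat.pow_le_pow_right (by omega) (by omega)
    have h6' : V ^ 5 ≤ V ^ 13 := Nat.pow_le_pow_right (by omega) (by omega)
    have h7 : V ^ 13 ≤ V ^ 13 * T := Nat.le_mul_of_pos_right _ hT1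
    have h8 : 1 ≤ V ^ 13 := Nat.one_le_pow _ _ (by omega)
    have h9 : 4 ^ (P.cb + 1) = 4 * 4 ^ P.cb := by ring
    have h10 : 4096 * (V ^ 13 * T) ≤ V * (V ^ 13 * T) := Nat.mul_le_mul_right _ h0
    have h11 : V * (V ^ 13 * T) = V ^ 14 * T := by ring
    have h12 : (P.finish M t : P.Pg n A.wire).size ≤ V ^ 5 := h.finish_le
    have h13 : (P.guard M t ε : P.Pg n A.wire).size = 4 ^ (P.cb + 1) := rfl
    have h14 : (j + 1) * (V ^ 14 * T) = j * (V ^ 14 * T) + V ^ 14 * T := by ring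
    simp only [Par.stage, Prog.size, Prog.size_seqs, List.map_replicate, List.sum_replicate,
      smul_eq_mul]
    omega

lemma Par.Small.size_alg_le (h : P.Small n M N V) {T : ℕ} (hT : A.prog.size ≤ T) (hS : S ≤ T)
    (hT1 : 1 ≤ T) (ε : ℝ) : (P.alg A M N ε).prog.size ≤ V ^ 16 * T := by
  have h0 := h.base
  have h1 := h.size_stage_le hT hS hT1 ε P.K 0 (by omega)
  have h2 := h.est_le (κ := A.wire) (Nat.zero_le P.K)
  have h3 : P.K * (V ^ 14 * T) ≤ V * (V ^ 14 * T) := Nat.mul_le_mul_right _ h.K_le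
  have h4 : V * (V ^ 14 * T) = V ^ 15 * T := by ring
  have h5 : V ^ 5 ≤ V ^ 15 := Nat.pow_le_pow_right (by omega) (by omega)
  have h6 : V ^ 10 ≤ V ^ 15 := Nat.pow_le_pow_right (by omega) (by omega)
  have h7 : V ^ 15 ≤ V ^ 15 * T := Nat.le_mul_of_pos_right _ hT1
  have h8 : 4096 * (V ^ 15 * T) ≤ V * (V ^ 15 * T) := Nat.mul_le_mul_right _ h0
  have h9 : V * (V ^ 15 * T) = V ^ 16 * T := by ring
  simp only [Prog.size]
  omega

lemma Par.Small.time_le (h : P.Small n M N V) {T TT : ℕ} (hT1 : 1 ≤ T)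
    (hTT : TT ≤ V ^ 12 * T) : (P.est M 0 : P.Pg n κ).size +
      (P.K * P.stageTime N TT + 4 ^ (P.cb + (P.h + 1))) ≤ V ^ 16 * T := by
  have h0 := h.base
  have h1 := h.finish_le
  have h2 := h.est_le (κ := κ) (Nat.zero_le P.K)
  have h3 : P.K * P.stageTime N TT ≤ V * (V ^ 14 * T) :=
    Nat.mul_le_mul h.K_le (h.stageTime_le hT1 hTT)
  have h4 : V * (V ^ 14 * T) = V ^ 15 * T := by ring
  have h5 : V ^ 5 ≤ V ^ 15 := Nat.pow_le_pow_right (by omega) (by omega)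
  have h6 : V ^ 10 ≤ V ^ 15 := Nat.pow_le_pow_right (by omega) (by omega)
  have h7 : V ^ 15 ≤ V ^ 15 * T := Nat.le_mul_of_pos_right _ hT1
  have h8 : 4096 * (V ^ 15 * T) ≤ V * (V ^ 15 * T) := Nat.mul_le_mul_right _ h0
  have h9 : V * (V ^ 15 * T) = V ^ 16 * T := by ring
  omega

lemma Par.Small.queries_le (h : P.Small n M N V) {B : ℕ} (hS1 : 1 ≤ S) (hB : B ≤ V * S) :
    M + P.K * (N * (B + 4 * M)) ≤ V ^ 5 * S := by
  have h0 := h.base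
  have hM := h.M_le
  have h1 : V ≤ V * S := Nat.le_mul_of_pos_right _ hS1
  have h2 : P.K * (N * (B + 4 * M)) ≤ V * (V * (5 * (V * S))) :=
    Nat.mul_le_mul h.K_le (Nat.mul_le_mul h.N_le (by omega))
  have h3 : V * (V * (5 * (V * S))) = 5 * (V ^ 3 * S) := by ring
  have h4 : V * S ≤ V ^ 3 * S := Nat.mul_le_mul_right _ (Nat.le_self_pow (by omega) V)
  have h5 : 4096 * (V ^ 3 * S) ≤ V * (V ^ 3 * S) := Nat.mul_le_mul_right _ h0
  have h6 : V * (V ^ 3 * S) = V ^ 4 * S := by ring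
  have h7 : V ^ 4 * S ≤ V ^ 5 * S :=
    Nat.mul_le_mul_right _ (Nat.pow_le_pow_right (by omega) (by omega))
  omega

end Costs

/-! ### Choice of the parameters -/

lemma half_pow_sq_eq (h : ℕ) : ((1 / 2 : ℝ) ^ h) ^ 2 = ((4 : ℝ) ^ h)⁻¹ := by
  rw [← pow_mul, mul_comm, pow_mul, ← inv_pow]
  norm_num

/-- The number of digits: `c = 2 ^ (-h)` with `c² ≤ η ε / 8` and `c²` of this order, so that the
number of terms is `O(1 / (η ε))`, which is `O(1 / η²)` as `η ≤ ε`. -/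
lemma exists_digits {ε η : ℝ} (hε : 0 < ε) (hε1 : ε < 1) (hη : 0 < η) (hηε : η ≤ ε) :
    ∃ h : ℕ, 1 ≤ h ∧ ((4 : ℝ) ^ h)⁻¹ ≤ η * ε / 8 ∧ (4 : ℝ) ^ h ≤ 32 / (η * ε) := by
  have hx : 0 < η * ε / 8 := by positivity
  have hx1 : η * ε / 8 ≤ 1 := by nlinarith
  obtain ⟨k, h1, h2⟩ := exists_nat_pow_near_of_lt_one hx hx1 (by norm_num : (0 : ℝ) < 1 / 4)
    (by norm_num)
  refine ⟨k + 1, by omega, ?_, ?_⟩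
  · rw [← inv_pow, ← one_div]
    exact h1.le
  · rw [le_div_iff₀ (by positivity)]
    have h3 : (4 : ℝ) ^ k * (1 / 4) ^ k = 1 := by rw [← mul_pow]; norm_num
    have h4 : (4 : ℝ) ^ k * (η * ε / 8) ≤ 4 ^ k * (1 / 4) ^ k :=
      mul_le_mul_of_nonneg_left h2 (by positivity)
    rw [pow_succ]
    nlinarith

/-- The parameters for digits up to `2^{-h}` and `M` attempts per norm estimate. -/
def stdPar (h M : ℕ) : Par where
  m := 2 * h + 2
  K := 4 * 4 ^ h
  cb := Nat.log 2 M + 1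
  h := h

lemma two_pow_index (h : ℕ) : 2 ^ (2 * h + 2) = 4 * 4 ^ h := by
  rw [pow_add, pow_mul, mul_comm]
  norm_num

lemma stdPar_Lam_le (h M t : ℕ) (ht : t ≤ 4 * 4 ^ h) : (stdPar h M).Lam t ^ 2 ≤ 25 * 4 ^ h := by
  have h1 : (t : ℝ) ≤ 4 * 4 ^ h := by exact_mod_cast ht
  have h2 : (4 : ℝ) ^ h = 2 ^ h * 2 ^ h := by rw [← mul_pow]; norm_num
  have h3 : (2 : ℝ) ^ h * (1 / 2) ^ h = 1 := by rw [← mul_pow]; norm_num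
  have h4 : (1 : ℝ) ≤ 2 ^ h := one_le_pow₀ (by norm_num)
  have h5 : (0 : ℝ) ≤ (1 / 2) ^ h := by positivity
  have h6 : (stdPar h M).Lam t ≤ 5 * 2 ^ h := by
    rw [Par.Lam]
    change 1 + (t : ℝ) * (1 / 2) ^ h ≤ _
    calc 1 + (t : ℝ) * (1 / 2) ^ h ≤ 1 + (4 * 4 ^ h) * (1 / 2) ^ h := by gcongr
      _ = 1 + 4 * 2 ^ h * (2 ^ h * (1 / 2) ^ h) := by rw [h2]; ring
      _ = 1 + 4 * 2 ^ h := by rw [h3, mul_one]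
      _ ≤ 5 * 2 ^ h := by linarith
  have h7 : 0 ≤ (stdPar h M).Lam t := by
    rw [Par.Lam]; positivity
  calc (stdPar h M).Lam t ^ 2 ≤ (5 * 2 ^ h) ^ 2 := pow_le_pow_left₀ h7 h6 2
    _ = 25 * 4 ^ h := by rw [h2]; ring

/-- The normalisation is at most `5 * 2 ^ h`, so that an accuracy of order `16 ^ (-h)` in the
success probabilities gives the squared norms up to `c² / 8`. -/
lemma stdPar_valid {h M : ℕ} {ε η : ℝ} (hε1 : ε < 1) (hη : 0 < η) (hηε : η ≤ ε) (h1 : 1 ≤ h)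
    (hc : ((4 : ℝ) ^ h)⁻¹ ≤ η * ε / 8) (hM : 0 < M) :
    (stdPar h M).Valid M (1 / (200 * 16 ^ h)) ε η where
  one_le_h := h1
  M_pos := hM
  M_lt := Nat.lt_pow_succ_log_self (by norm_num) M
  K_eq := rfl
  K_lt := (two_pow_index h).ge
  e_pos := by positivity
  e_le := by
    rw [div_le_one (by positivity)]
    have : (1 : ℝ) ≤ 16 ^ h := one_le_pow₀ (by norm_num)
    linarith
  acc := by
    refine (mul_le_mul_of_nonneg_right (stdPar_Lam_le h M _ le_rfl) (by positivity)).trans ?_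
    change _ ≤ ((1 / 2 : ℝ) ^ h) ^ 2 / 8
    rw [half_pow_sq_eq, show (16 : ℝ) ^ h = 4 ^ h * 4 ^ h by rw [← mul_pow]; norm_num]
    refine le_of_eq ?_
    field_simp
    norm_num
  η_pos := hη
  η_le := hηε
  ε_lt := hε1
  c_le := by
    change ((1 / 2 : ℝ) ^ h) ^ 2 ≤ _
    rwa [half_pow_sq_eq]

/-- Hoeffding's bound is at most `x` for a number of attempts of order `log (1 / x) / e²`. -/
lemma estErr_le {M : ℕ} {e x : ℝ} (he : 0 < e) (hx : 0 < x)
    (hM : 4 / e ^ 2 * Real.log (2 / x) ≤ M) : estErr M e ≤ x := by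
  have h1 : Real.log (2 / x) ≤ e ^ 2 * M / 4 := by
    rw [div_mul_eq_mul_div, div_le_iff₀ (by positivity)] at hM
    linarith
  have h2 : Real.exp (-(e ^ 2 * M / 4)) ≤ x / 2 := by
    calc Real.exp (-(e ^ 2 * M / 4)) ≤ Real.exp (-Real.log (2 / x)) :=
          Real.exp_le_exp.2 (neg_le_neg h1)
      _ = x / 2 := by rw [Real.exp_neg, Real.exp_log (by positivity), inv_div]
  rw [estErr]
  linarith

/-- If each of the attempts succeeds with probability at least `p₀`, then `S` successes are
missing with probability at most `x` after a number of attempts of order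
`(S + log (1 / x)) / p₀`. -/
lemma two_pow_div_le {S B : ℕ} {p p₀ x : ℝ} (hp₀ : 0 < p₀) (hp₀1 : p₀ ≤ 1) (hp : p₀ ≤ p)
    (hx : 0 < x) (hB : 4 / p₀ * (S + Real.log (1 / x)) ≤ B) :
    2 ^ S / (1 + p / 2) ^ B ≤ x := by
  have h1 : Real.exp (p₀ / 4) ≤ 1 + p₀ / 2 := by
    have h := Real.abs_exp_sub_one_sub_id_le (x := p₀ / 4) (by rw [abs_of_pos] <;> linarith)
    have := (abs_le.1 h).2
    nlinarith
  have h2 : (2 : ℝ) ≤ Real.exp 1 := by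
    have := Real.add_one_le_exp 1
    linarith
  have h3 : S + Real.log (1 / x) ≤ B * (p₀ / 4) := by
    rw [div_mul_eq_mul_div, div_le_iff₀ hp₀] at hB
    linarith
  have h4 : 2 ^ S * (1 / x) ≤ (1 + p / 2) ^ B :=
    calc 2 ^ S * (1 / x) ≤ Real.exp 1 ^ S * (1 / x) := by gcongr
      _ = Real.exp (S + Real.log (1 / x)) := by
          rw [Real.exp_add, Real.exp_log (by positivity), ← Real.exp_nat_mul, mul_one]
      _ ≤ Real.exp (B * (p₀ / 4)) := Real.exp_le_exp.2 h3
      _ = Real.exp (p₀ / 4) ^ B := by rw [Real.exp_nat_mul]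
      _ ≤ (1 + p / 2) ^ B :=
          pow_le_pow_left₀ (Real.exp_nonneg _) (h1.trans (by linarith)) _
  have h5 : 0 < 1 + p / 2 := by linarith
  rw [div_le_iff₀ (pow_pos h5 B)]
  rw [mul_one_div, div_le_iff₀ hx] at h4
  linarith

/-- The failure probabilities add up to at most `υ`. -/
lemma one_sub_le_success {K N : ℕ} {x y g r υ : ℝ} (hx0 : 0 ≤ x) (hx1 : x ≤ 1) (hg : g ≤ x)
    (hr : (1 - x) ^ 5 ≤ r) (hy0 : 0 ≤ y) (hy1 : y ≤ 1)
    (hsum : (1 + 5 * (N * K) : ℕ) * x + K * y ≤ υ) :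
    1 - υ ≤ (1 - g) * (r ^ N * (1 - y)) ^ K := by
  have h0 : 0 ≤ 1 - x := by linarith
  have h1 : (1 - x) ^ (1 + 5 * (N * K)) * (1 - y) ^ K ≤ (1 - g) * (r ^ N * (1 - y)) ^ K := by
    calc (1 - x) ^ (1 + 5 * (N * K)) * (1 - y) ^ K
        = (1 - x) * (((1 - x) ^ 5) ^ N * (1 - y)) ^ K := by
          rw [mul_pow, ← pow_mul, ← pow_mul, pow_add, pow_one]
          ring
      _ ≤ (1 - g) * (r ^ N * (1 - y)) ^ K := by
          have : 0 ≤ 1 - y := by linarith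
          have : 0 ≤ 1 - g := by linarith
          have : 0 ≤ r := (pow_nonneg h0 5).trans hr
          gcongr
  have h2 : 1 - (1 + 5 * (N * K) : ℕ) * x ≤ (1 - x) ^ (1 + 5 * (N * K)) := by
    have := one_add_mul_le_pow (a := -x) (by linarith) (1 + 5 * (N * K))
    rw [← sub_eq_add_neg] at this
    linarith
  have h3 : 1 - K * y ≤ (1 - y) ^ K := by
    have := one_add_mul_le_pow (a := -y) (by linarith) K
    rw [← sub_eq_add_neg] at this
    linarith
  have h4 : (1 - x) ^ (1 + 5 * (N * K)) ≤ 1 := pow_le_one₀ h0 (by linarith)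
  have h5 : (1 - y) ^ K ≤ 1 := pow_le_one₀ (by linarith) (by linarith)
  have h6 : 0 ≤ (1 - x) ^ (1 + 5 * (N * K)) := pow_nonneg h0 _
  have h7 : 0 ≤ (1 - y) ^ K := pow_nonneg (by linarith) _
  nlinarith

/-- Repeating the subroutine `N` times makes its failure probability at most `y`. -/
lemma pow_le_of_log_le {N : ℕ} {δ z : ℝ} (hδ0 : 0 < δ) (hδ1 : δ < 1) (hz : 0 < z)
    (hN : Real.log z⁻¹ / Real.log δ⁻¹ ≤ N) : δ ^ N ≤ z := by
  have h1 : 0 < Real.log δ⁻¹ := Real.log_pos (one_lt_inv₀ hδ0 |>.2 hδ1)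
  rw [div_le_iff₀ h1, Real.log_inv, Real.log_inv] at hN
  rw [← Real.log_le_log_iff (pow_pos hδ0 N) hz, Real.log_pow]
  linarith

/-- The quantity that the polynomial bounds refer to. -/
def scale (n : ℕ) (ε η υ : ℝ) : ℝ := n * ε⁻¹ * η⁻¹ * (1 + Real.log υ⁻¹)

section Scale

variable {n : ℕ} {ε η υ : ℝ}

lemma le_scale (hn : 1 ≤ n) (hε : 0 < ε) (hε1 : ε < 1) (hη : 0 < η) (hηε : η ≤ ε) (hυ : 0 < υ)
    (hυ1 : υ < 1) : (n : ℝ) ≤ scale n ε η υ ∧ ε⁻¹ ≤ scale n ε η υ ∧ η⁻¹ ≤ scale n ε η υ ∧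
      η⁻¹ * ε⁻¹ ≤ scale n ε η υ ∧ 1 + Real.log υ⁻¹ ≤ scale n ε η υ := by
  have h1 : (1 : ℝ) ≤ n := by exact_mod_cast hn
  have h2 : 1 ≤ ε⁻¹ := (one_le_inv₀ hε).2 hε1.le
  have h3 : 1 ≤ η⁻¹ := (one_le_inv₀ hη).2 (hηε.trans hε1.le)
  have h4 : 0 ≤ Real.log υ⁻¹ := Real.log_nonneg ((one_le_inv₀ hυ).2 hυ1.le)
  have h5 : 1 ≤ 1 + Real.log υ⁻¹ := by linarith
  have h6 : 1 ≤ (n : ℝ) * ε⁻¹ := one_le_mul_of_one_le_of_one_le h1 h2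
  have h7 : 1 ≤ (n : ℝ) * ε⁻¹ * η⁻¹ := one_le_mul_of_one_le_of_one_le h6 h3
  have h8 : (n : ℝ) * ε⁻¹ * η⁻¹ ≤ scale n ε η υ := le_mul_of_one_le_right (by linarith) h5
  have h9 : (n : ℝ) * ε⁻¹ ≤ n * ε⁻¹ * η⁻¹ := le_mul_of_one_le_right (by linarith) h3
  refine ⟨?_, ?_, ?_, ?_, le_mul_of_one_le_left (by linarith) h7⟩
  · exact (le_mul_of_one_le_right (by linarith) h2).trans (h9.trans h8)
  · exact (le_mul_of_one_le_left (by linarith) h1).trans (h9.trans h8)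
  · exact (le_mul_of_one_le_left (by linarith) h6).trans h8
  · refine le_trans ?_ h8
    rw [mul_assoc, mul_comm ε⁻¹]
    exact le_mul_of_one_le_left (by positivity) h1

end Scale

/-- The coefficient of the bound on the sizes. -/
def sizeConst (d : ℝ) : ℝ := 160000 * 32 ^ 4 * 1540 * d

/-- The logarithm of the inverse of the failure probability granted to each estimate is polynomial.
-/
lemma log_inv_failure_le {K N : ℕ} {X d υ : ℝ} (hX : 1 ≤ X) (hd : 1 ≤ d) (hK0 : 0 < K)
    (hN0 : 0 < N) (hυ : 0 < υ) (hL : 1 + Real.log υ⁻¹ ≤ X) (hK : (K : ℝ) ≤ 128 * X)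
    (hN : (N : ℝ) ≤ d * X) : Real.log (1 / (υ / (12 * N * K))) ≤ 1537 * d * X ^ 2 := by
  have hK1 : (0 : ℝ) < K := by exact_mod_cast hK0
  have hN1 : (0 : ℝ) < N := by exact_mod_cast hN0
  have h1 : 1 / (υ / (12 * N * K)) = (12 * N * K) * υ⁻¹ := by field_simp
  rw [h1, Real.log_mul (by positivity) (by positivity)]
  have h2 : Real.log (12 * N * K) ≤ 12 * N * K := Real.log_le_self (by positivity)
  have h3 : (12 : ℝ) * N * K ≤ 12 * (d * X) * (128 * X) := by gcongr
  have h4 : X ≤ d * X ^ 2 := by nlinarith [mul_le_mul hd hX (by norm_num) (by linarith)]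
  nlinarith

/-- The number of attempts per norm estimate is polynomial. -/
lemma attempts_le {h : ℕ} {X d l : ℝ} (hX : 1 ≤ X) (hd : 1 ≤ d) (hh : (4 : ℝ) ^ h ≤ 32 * X)
    (hl : l ≤ 1538 * d * X ^ 2) :
    ((⌈4 / (1 / (200 * (16 : ℝ) ^ h)) ^ 2 * l⌉₊ + 1 : ℕ) : ℝ) ≤ sizeConst d * X ^ 6 := by
  have h1 : 4 / (1 / (200 * (16 : ℝ) ^ h)) ^ 2 = 160000 * ((4 : ℝ) ^ h) ^ 4 := by
    rw [show (16 : ℝ) ^ h = 4 ^ h * 4 ^ h by rw [← mul_pow]; norm_num]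
    field_simp
    norm_num
  have h2 : 160000 * ((4 : ℝ) ^ h) ^ 4 * l ≤ 160000 * (32 * X) ^ 4 * (1538 * d * X ^ 2) := by
    refine mul_le_mul_of_nonneg_left hl (by positivity) |>.trans ?_
    have : 0 ≤ 1538 * d * X ^ 2 := by positivity
    gcongr
  have h4 : 1 ≤ d * X ^ 6 := one_le_mul_of_one_le_of_one_le hd (one_le_pow₀ hX)
  have h3 : 0 ≤ 160000 * (32 * X) ^ 4 * (1538 * d * X ^ 2) := by positivity
  have h5 : (⌈160000 * ((4 : ℝ) ^ h) ^ 4 * l⌉₊ : ℝ) ≤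
      160000 * (32 * X) ^ 4 * (1538 * d * X ^ 2) + 1 :=
    (Nat.cast_le.2 (Nat.ceil_mono h2)).trans (Nat.ceil_lt_add_one h3).le
  rw [h1]
  push_cast
  refine (add_le_add_left h5 1).trans ?_
  rw [sizeConst]
  have h6 : 160000 * (32 * X) ^ 4 * (1538 * d * X ^ 2) =
    160000 * 32 ^ 4 * 1538 * (d * X ^ 6) := by ring
  rw [h6, mul_assoc _ d]
  linarith

/-- The number of attempts to prepare the copies is `S` times a polynomial. -/
lemma preparations_le {h S : ℕ} {X d ε l : ℝ} (hX : 1 ≤ X) (hd : 1 ≤ d) (hS : 1 ≤ S) (hε : 0 < ε)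
    (hεX : ε⁻¹ ≤ X) (hh : (4 : ℝ) ^ h ≤ 32 * X) (hl : l ≤ 1537 * d * X ^ 2) :
    (⌈4 / (ε / 2 / (25 * (4 : ℝ) ^ h)) * (S + l)⌉₊ : ℝ) ≤ sizeConst d * X ^ 6 * S := by
  have hS1 : (1 : ℝ) ≤ S := by exact_mod_cast hS
  have h1 : 4 / (ε / 2 / (25 * (4 : ℝ) ^ h)) = 200 * (4 ^ h * ε⁻¹) := by
    field_simp
    norm_num
  have hd2 : 1 ≤ d * X ^ 2 := one_le_mul_of_one_le_of_one_le hd (one_le_pow₀ hX)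
  have h2 : S + l ≤ 1538 * d * X ^ 2 * S := by nlinarith
  have h3 : 200 * (4 ^ h * ε⁻¹) * (S + l) ≤ 200 * (32 * X * X) * (1538 * d * X ^ 2 * S) := by
    refine mul_le_mul_of_nonneg_left h2 (by positivity) |>.trans ?_
    have : 0 ≤ 1538 * d * X ^ 2 * S := by positivity
    gcongr
  have h4 : 0 ≤ 200 * (32 * X * X) * (1538 * d * X ^ 2 * S) := by positivity
  have h5 : (⌈200 * (4 ^ h * ε⁻¹) * (S + l)⌉₊ : ℝ) ≤
      200 * (32 * X * X) * (1538 * d * X ^ 2 * S) + 1 :=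
    (Nat.cast_le.2 (Nat.ceil_mono h3)).trans (Nat.ceil_lt_add_one h4).le
  rw [h1]
  refine h5.trans ?_
  have h6 : d * X ^ 4 * S ≤ d * X ^ 6 * S := by gcongr; norm_num
  have h7 : 1 ≤ d * X ^ 4 * S :=
    one_le_mul_of_one_le_of_one_le (one_le_mul_of_one_le_of_one_le hd (one_le_pow₀ hX)) hS1
  rw [sizeConst]
  have h8 : 200 * (32 * X * X) * (1538 * d * X ^ 2 * S) =
    200 * 32 * 1538 * (d * X ^ 4 * S) := by ring
  have h9 : 160000 * 32 ^ 4 * 1540 * d * X ^ 6 * S =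
    160000 * 32 ^ 4 * 1540 * (d * X ^ 6 * S) := by ring
  rw [h8, h9]
  linarith

/-- The registers and the numbers of repetitions are polynomial in the scale `X`. -/
lemma stdPar_small {n h M N : ℕ} {X d : ℝ} (hX : 1 ≤ X) (hd : 1 ≤ d) (hn : (n : ℝ) ≤ X)
    (hh : (4 : ℝ) ^ h ≤ 32 * X) (hN : (N : ℝ) ≤ d * X) (hM0 : M ≠ 0)
    (hM : (M : ℝ) ≤ sizeConst d * X ^ 6) :
    (stdPar h M).Small n M N ⌈2 * sizeConst d * X ^ 6⌉₊ := by
  have hdX : ∀ k ≤ 6, d * X ^ k ≤ d * X ^ 6 := fun k hk =>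
    mul_le_mul_of_nonneg_left (pow_le_pow_right₀ hX hk) (by linarith)
  have hX0 : ∀ k, X ^ k ≤ d * X ^ k := fun k => le_mul_of_one_le_left (by positivity) hd
  have hc : 2 * sizeConst d * X ^ 6 = 2 * (160000 * 32 ^ 4 * 1540) * (d * X ^ 6) := by
    rw [sizeConst]; ring
  have hX1 : X ≤ d * X ^ 6 := by
    have := (hX0 1).trans (hdX 1 (by norm_num))
    rwa [pow_one] at this
  have h1 : 1 ≤ d * X ^ 6 := hX.trans hX1
  have key : ∀ {a : ℕ}, (a : ℝ) ≤ 4096 * (d * X ^ 6) → a ≤ ⌈2 * sizeConst d * X ^ 6⌉₊ := by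
    intro a ha
    refine Nat.cast_le.1 ((ha.trans ?_).trans (Nat.le_ceil _))
    rw [hc]
    linarith
  have h4 : ((4 * 4 ^ h : ℕ) : ℝ) ≤ 4096 * (d * X ^ 6) := by
    push_cast
    linarith
  have hMV : 2 * M ≤ ⌈2 * sizeConst d * X ^ 6⌉₊ := by
    refine Nat.cast_le.1 (le_trans ?_ (Nat.le_ceil _))
    push_cast
    linarith
  refine ⟨key ?_, key ?_, key h4, key ?_, by omega, ?_, key ?_, ?_, ?_⟩
  · push_cast
    linarith
  · linarith
  · have := hdX 1 (by norm_num)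
    rw [pow_one] at this
    linarith
  · change 2 ^ (Nat.log 2 M + 1) ≤ _
    rw [pow_succ]
    have := Nat.pow_log_le_self 2 hM0
    omega
  · change ((2 ^ h : ℕ) : ℝ) ≤ _
    have : (2 : ℝ) ^ h ≤ 4 ^ h := pow_le_pow_left₀ (by norm_num) (by norm_num) h
    push_cast
    linarith
  · change 2 ^ (2 * h + 2) ≤ _
    rw [two_pow_index]
    exact key h4
  · rw [gateSeq_length]
    refine key ?_
    have h5 : (n : ℝ) ^ 3 ≤ X ^ 3 := pow_le_pow_left₀ (by positivity) hn 3
    have h6 : (n : ℝ) ^ 4 ≤ X ^ 4 := pow_le_pow_left₀ (by positivity) hn 4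
    have h7 := (hX0 3).trans (hdX 3 (by norm_num))
    have h8 := (hX0 4).trans (hdX 4 (by norm_num))
    have h9 : ((16 * n ^ 2 * (2 * n + n ^ 2) : ℕ) : ℝ) = 32 * n ^ 3 + 16 * n ^ 4 := by
      push_cast
      ring
    rw [h9]
    linarith

/-- The number of invocations of the subroutine per term, such that `δ ^ N ≤ υ η² / 256`. -/
def repeats (δ η υ : ℝ) : ℕ := ⌈Real.log (256 / (υ * η ^ 2)) / Real.log δ⁻¹⌉₊

lemma repeats_le {δ η υ X : ℝ} (hδ0 : 0 < δ) (hδ1 : δ < 1) (hη : 0 < η) (hυ : 0 < υ)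
    (hX : 1 ≤ X) (hηX : η⁻¹ ≤ X) (hL : 1 + Real.log υ⁻¹ ≤ X) :
    (repeats δ η υ : ℝ) ≤ (9 / Real.log δ⁻¹ + 1) * X := by
  have h1 : 0 < Real.log δ⁻¹ := Real.log_pos (one_lt_inv₀ hδ0 |>.2 hδ1)
  have h2 : Real.log (256 / (υ * η ^ 2)) ≤ 9 * X := by
    have h3 : 256 / (υ * η ^ 2) = 2 ^ 8 * υ⁻¹ * (η⁻¹) ^ 2 := by field_simp; norm_num
    rw [h3, Real.log_mul (by positivity) (by positivity),
      Real.log_mul (by positivity) (by positivity), Real.log_pow, Real.log_pow]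
    have h4 := Real.log_two_lt_d9
    have h5 : Real.log η⁻¹ ≤ η⁻¹ := Real.log_le_self (by positivity)
    push_cast
    linarith
  have h6 : Real.log (256 / (υ * η ^ 2)) / Real.log δ⁻¹ ≤ 9 * X / Real.log δ⁻¹ := by gcongr
  have h7 : 0 ≤ 9 * X / Real.log δ⁻¹ := by positivity
  calc (repeats δ η υ : ℝ) ≤ (⌈9 * X / Real.log δ⁻¹⌉₊ : ℝ) := Nat.cast_le.2 (Nat.ceil_mono h6)
    _ ≤ 9 * X / Real.log δ⁻¹ + 1 := (Nat.ceil_lt_add_one h7).le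
    _ ≤ (9 / Real.log δ⁻¹ + 1) * X := by
        rw [add_mul, one_mul, div_mul_eq_mul_div]
        linarith

lemma repeats_pos {δ η υ : ℝ} (hδ0 : 0 < δ) (hδ1 : δ < 1) (hη : 0 < η) (hη1 : η ≤ 1)
    (hυ : 0 < υ) (hυ1 : υ ≤ 1) : 0 < repeats δ η υ := by
  have h1 : 0 < Real.log δ⁻¹ := Real.log_pos (one_lt_inv₀ hδ0 |>.2 hδ1)
  have h2 : 1 < 256 / (υ * η ^ 2) := by
    rw [one_lt_div (by positivity)]
    have : υ * η ^ 2 ≤ 1 := mul_le_one₀ hυ1 (by positivity) (pow_le_one₀ hη.le hη1)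
    linarith
  have h3 := Real.log_pos h2
  exact Nat.ceil_pos.2 (by positivity)

/-- The exponent and the coefficient of the polynomial bounds. -/
def polyConst (δ : ℝ) : ℕ := max ⌈(3 * sizeConst (9 / Real.log δ⁻¹ + 1)) ^ 16⌉₊ 96

/-- The sixteenth power of the bound on the sizes, which dominates all costs, is polynomial. -/
lemma size_pow_le {δ X : ℝ} (hδ0 : 0 < δ) (hδ1 : δ < 1) (hX : 1 ≤ X) :
    ((⌈2 * sizeConst (9 / Real.log δ⁻¹ + 1) * X ^ 6⌉₊ : ℕ) : ℝ) ^ 16 ≤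
      polyConst δ * X ^ polyConst δ := by
  have h1 : 0 < Real.log δ⁻¹ := Real.log_pos (one_lt_inv₀ hδ0 |>.2 hδ1)
  set s := sizeConst (9 / Real.log δ⁻¹ + 1) with hs
  have hs1 : 1 ≤ s := by
    have : 0 < 9 / Real.log δ⁻¹ := by positivity
    rw [hs, sizeConst]
    linarith
  have h2 : 1 ≤ s * X ^ 6 := one_le_mul_of_one_le_of_one_le hs1 (one_le_pow₀ hX)
  have h3 : ((⌈2 * s * X ^ 6⌉₊ : ℕ) : ℝ) ≤ 3 * s * X ^ 6 := by
    have := (Nat.ceil_lt_add_one (a := 2 * s * X ^ 6) (by positivity)).le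
    linarith
  calc ((⌈2 * s * X ^ 6⌉₊ : ℕ) : ℝ) ^ 16 ≤ (3 * s * X ^ 6) ^ 16 :=
        pow_le_pow_left₀ (by positivity) h3 16
    _ = (3 * s) ^ 16 * X ^ 96 := by ring
    _ ≤ polyConst δ * X ^ polyConst δ := by
        have h4 : (3 * s) ^ 16 ≤ polyConst δ :=
          (Nat.le_ceil _).trans (Nat.cast_le.2 (le_max_left _ _))
        have h5 : X ^ 96 ≤ X ^ polyConst δ := pow_le_pow_right₀ hX (le_max_right _ _)
        exact mul_le_mul h4 h5 (by positivity) (by positivity)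

/-- There are at most `K = 4 * 4 ^ h` terms and `N` tries per term. Each try involves four norm
estimates and one preparation of the copies; with the initial estimate these account for one half of
`υ`. The other half is the failure of all `N` calls for one of the terms. -/
lemma failure_sum_le {h : ℕ} {δ ε η υ : ℝ} (hδ0 : 0 < δ) (hδ1 : δ < 1) (hη : 0 < η)
    (hηε : η ≤ ε) (hυ : 0 < υ) (hN0 : 0 < repeats δ η υ) (hh : (4 : ℝ) ^ h ≤ 32 / (η * ε)) :
    (1 + 5 * (repeats δ η υ * (4 * 4 ^ h)) : ℕ) *
      (υ / (12 * repeats δ η υ * (4 * 4 ^ h : ℕ))) + (4 * 4 ^ h : ℕ) * δ ^ repeats δ η υ ≤ υ := by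
  have hN1 : (1 : ℝ) ≤ repeats δ η υ := by exact_mod_cast hN0
  have hδN : δ ^ repeats δ η υ ≤ υ * η ^ 2 / 256 :=
    pow_le_of_log_le hδ0 hδ1 (by positivity) (by rw [inv_div]; exact Nat.le_ceil _)
  have hK1 : (1 : ℝ) ≤ (4 * 4 ^ h : ℕ) := by exact_mod_cast Nat.one_le_iff_ne_zero.2 (by positivity)
  have hKη : ((4 * 4 ^ h : ℕ) : ℝ) * (η * η) ≤ 128 := by
    rw [le_div_iff₀ (mul_pos hη (hη.trans_le hηε))] at hh
    push_cast
    have : η * η ≤ η * ε := by gcongr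
    have h1 : 4 * (4 : ℝ) ^ h * (η * η) ≤ 4 * 4 ^ h * (η * ε) := by gcongr
    linarith
  generalize ((4 * 4 ^ h : ℕ)) = K at *
  generalize repeats δ η υ = N at *
  have h1 : 1 ≤ (N : ℝ) * K := one_le_mul_of_one_le_of_one_le hN1 hK1
  have h2 : ((1 + 5 * (N * K) : ℕ) : ℝ) * (υ / (12 * N * K)) ≤ υ / 2 := by
    rw [mul_div_assoc', div_le_div_iff₀ (by positivity) (by norm_num)]
    push_cast
    nlinarith
  have h3 : (K : ℝ) * δ ^ N ≤ K * (υ * η ^ 2 / 256) := by gcongr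
  have h4 : (K : ℝ) * (υ * η ^ 2 / 256) ≤ υ / 2 := by nlinarith
  linarith

/-- The bound on the success of the preparation of the copies and the four norm estimates of a try.
-/
lemma le_tryProb {n S B h M : ℕ} {e ε x : ℝ} (R : Reg (stdPar h M) n) (ψ : Vec n) {t : ℕ}
    (ht : t ≤ 4 * 4 ^ h) (hε : 0 < ε) (hε1 : ε < 1) (hres : ε / 2 ≤ nsq (R.res ψ t)) (hx0 : 0 < x)
    (hx1 : x ≤ 1) (herr : estErr M e ≤ x)
    (hB : 4 / (ε / 2 / (25 * (4 : ℝ) ^ h)) * (S + Real.log (1 / x)) ≤ B) :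
    (1 - x) ^ 5 ≤ R.tryProb ψ S M B e t := by
  -- the success probability of an attempt to prepare a residual state that is not small
  have hp : ε / 2 / (25 * (4 : ℝ) ^ h) ≤ R.prob ψ t := by
    have h1 := stdPar_Lam_le h M t ht
    have h2 : 0 < (stdPar h M).Lam t := by rw [Par.Lam]; positivity
    have h3 : 0 < (stdPar h M).Lam t ^ 2 := pow_pos h2 2
    have h4 : 0 ≤ nsq (R.res ψ t) := by linarith
    rw [Reg.prob]
    exact div_le_div₀ h4 hres h3 h1
  have hp0 : 0 < ε / 2 / (25 * (4 : ℝ) ^ h) := by positivity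
  have hp1 : ε / 2 / (25 * (4 : ℝ) ^ h) ≤ 1 := by
    have h1 : (1 : ℝ) ≤ 4 ^ h := one_le_pow₀ (by norm_num)
    rw [div_le_one (by positivity)]
    linarith
  have h1 := two_pow_div_le (S := S) hp0 hp1 hp hx0 hB
  have h2 : 0 ≤ (1 - x) ^ 4 := pow_nonneg (by linarith) 4
  have h3 : (1 - x) ^ 4 ≤ (1 - estErr M e) ^ 4 :=
    pow_le_pow_left₀ (by linarith) (by linarith) 4
  rw [Reg.tryProb, pow_succ']
  exact mul_le_mul (by linarith) h3 h2 (by linarith)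

end StabDecomp

end

theorem mainTheorem2 :
    ∃ C : ℝ, ∀ δ : ℝ, 0 < δ → δ < 1 → ∃ c : ℕ,
      ∀ (n S T : ℕ) (ε η υ : ℝ) (A : StabDecomp.BaseAlg n S),
        1 ≤ n → 1 ≤ S → 0 < ε → ε < 1 → 0 < η → η ≤ ε → 0 < υ → υ < 1 →
        A.HasTime T → A.Succeeds T (ε ^ 6) η δ →
        ∃ (D : StabDecomp.DecompAlg n A.wire) (T' Q' N' : ℕ),
          (T' : ℝ) ≤ c * (n * ε⁻¹ * η⁻¹ * (1 + Real.log υ⁻¹)) ^ c * T ∧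
          (Q' : ℝ) ≤ c * (n * ε⁻¹ * η⁻¹ * (1 + Real.log υ⁻¹)) ^ c * S ∧
          (N' : ℝ) ≤ C / η ^ 2 * ⌈Real.log (C / (υ * η ^ 2)) / Real.log δ⁻¹⌉₊ ∧
          D.prog.size ≤ T' ∧
          ∀ (ψ : StabDecomp.Vec n) (U : Matrix.unitaryGroup (StabDecomp.Bits n) ℂ),
            (∀ b, (U : Matrix (StabDecomp.Bits n) (StabDecomp.Bits n) ℂ) b
              (StabDecomp.zeroBits n) = ψ b) →
            1 - υ ≤ StabDecomp.DecompAlg.prob A D U T' Q' N'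
              (fun b => D.IsDecomposition b ψ ε (C / η ^ 2)) := by
  open StabDecomp in
  refine ⟨256, fun δ hδ0 hδ1 => ⟨polyConst δ, ?_⟩⟩
  intro n S T ε η υ A hn hS hε hε1 hη hηε hυ hυ1 hA hAS
  obtain ⟨hAT, hST, hA1⟩ := hA
  obtain ⟨h, hh1, hhc, hh⟩ := exists_digits hε hε1 hη hηε
  obtain ⟨hnX, hεX, hηX, hηεX, hLX⟩ := le_scale hn hε hε1 hη hηε hυ hυ1
  have hd : 1 ≤ 9 / Real.log δ⁻¹ + 1 := by
    have : 0 < Real.log δ⁻¹ := Real.log_pos (one_lt_inv₀ hδ0 |>.2 hδ1)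
    have : 0 < 9 / Real.log δ⁻¹ := by positivity
    linarith
  have hX : 1 ≤ scale n ε η υ := le_trans (by exact_mod_cast hn) hnX
  have hN := repeats_le hδ0 hδ1 hη hυ hX hηX hLX
  have hN0 := repeats_pos hδ0 hδ1 hη (hηε.trans hε1.le) hυ hυ1.le
  have hT1 : 1 ≤ T := hS.trans hST
  have hhX : (4 : ℝ) ^ h ≤ 32 * scale n ε η υ := by
    refine hh.trans ?_
    rw [div_eq_mul_inv, mul_inv]
    gcongr
  have hpow := size_pow_le hδ0 hδ1 hX
  have hsum := failure_sum_le hδ0 hδ1 hη hηε hυ hN0 hh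
  change ∃ (D : StabDecomp.DecompAlg n A.wire) (T' Q' N' : ℕ),
    (T' : ℝ) ≤ polyConst δ * (scale n ε η υ) ^ polyConst δ * T ∧
    (Q' : ℝ) ≤ polyConst δ * (scale n ε η υ) ^ polyConst δ * S ∧
    (N' : ℝ) ≤ 256 / η ^ 2 * repeats δ η υ ∧ D.prog.size ≤ T' ∧ _
  set X := scale n ε η υ with hXdef
  set N := repeats δ η υ with hNdef
  set d := 9 / Real.log δ⁻¹ + 1 with hddef
  have hK0 : 0 < 4 * 4 ^ h := by positivity
  have hK1 : (1 : ℝ) ≤ (4 * 4 ^ h : ℕ) := by exact_mod_cast hK0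
  have hN1 : (1 : ℝ) ≤ N := by exact_mod_cast hN0
  have hKX : ((4 * 4 ^ h : ℕ) : ℝ) ≤ 128 * X := by push_cast; linarith
  -- the failure probability granted to each norm estimate and to each preparation of the copies
  set x := υ / (12 * N * (4 * 4 ^ h : ℕ)) with hx
  have hx0 : 0 < x := by positivity
  have hx1 : x ≤ 1 := by
    rw [hx, div_le_one (by positivity)]
    have := one_le_mul_of_one_le_of_one_le hN1 hK1
    linarith
  have hlog := log_inv_failure_le hX hd hK0 hN0 hυ hLX hKX hN
  rw [← hx] at hlog
  have hlog2 : Real.log (2 / x) ≤ 1538 * d * X ^ 2 := by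
    rw [← mul_one_div, Real.log_mul (by norm_num) (by positivity)]
    have := Real.log_two_lt_d9
    have : 1 ≤ d * X ^ 2 := one_le_mul_of_one_le_of_one_le hd (one_le_pow₀ hX)
    linarith
  obtain ⟨M, hM0, hM, hMge⟩ : ∃ M : ℕ, 0 < M ∧ (M : ℝ) ≤ sizeConst d * X ^ 6 ∧
      4 / (1 / (200 * (16 : ℝ) ^ h)) ^ 2 * Real.log (2 / x) ≤ M :=
    ⟨_, Nat.succ_pos _, attempts_le hX hd hhX hlog2, (Nat.le_ceil _).trans (by simp)⟩
  obtain ⟨B, hB, hBge⟩ : ∃ B : ℕ, (B : ℝ) ≤ sizeConst d * X ^ 6 * S ∧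
      4 / (ε / 2 / (25 * (4 : ℝ) ^ h)) * (S + Real.log (1 / x)) ≤ B :=
    ⟨_, preparations_le hX hd hS hε hεX hhX hlog, Nat.le_ceil _⟩
  have herr : estErr M (1 / (200 * 16 ^ h)) ≤ x := estErr_le (by positivity) hx0 hMge
  have hvalid := stdPar_valid hε1 hη hηε hh1 hhc hM0
  have hsmall := stdPar_small hX hd hnX hhX hN hM0.ne' hM
  set V := ⌈2 * sizeConst d * X ^ 6⌉₊ with hV
  have hV0 := hsmall.base
  have hBV : B ≤ V * S := by
    refine Nat.cast_le.1 (hB.trans ?_)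
    push_cast
    gcongr
    refine le_trans ?_ (Nat.le_ceil _)
    have : 0 ≤ sizeConst d * X ^ 6 := (Nat.cast_nonneg M).trans hM
    linarith
  have hVT : V ≤ V ^ 16 := Nat.le_self_pow (by norm_num) V
  have hTT' : T ≤ V ^ 16 * T := Nat.le_mul_of_pos_left T (by omega)
  refine ⟨(stdPar h M).alg A M N ε, V ^ 16 * T, V ^ 5 * S, 4 * 4 ^ h * N, ?_, ?_, ?_,
    hsmall.size_alg_le hAT hST hT1 ε, fun ψ U hU => ?_⟩
  · push_cast
    gcongr
  · push_cast
    have : (V : ℝ) ^ 5 ≤ (V : ℝ) ^ 16 :=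
      pow_le_pow_right₀ (by exact_mod_cast (by omega : 1 ≤ V)) (by norm_num)
    gcongr
    exact this.trans hpow
  · push_cast
    gcongr
    refine (mul_le_mul_of_nonneg_left hh (by norm_num)).trans ?_
    rw [mul_div_assoc', div_le_div_iff₀ (by positivity) (by positivity)]
    nlinarith
  · have hkmax : (((stdPar h M).K : ℕ) : ℝ) ≤ 256 / η ^ 2 := by
      change ((4 * 4 ^ h : ℕ) : ℝ) ≤ _
      push_cast
      refine (mul_le_mul_of_nonneg_left hh (by norm_num)).trans ?_
      rw [mul_div_assoc', div_le_div_iff₀ (by positivity) (by positivity)]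
      nlinarith
    have hU' : (U : Matrix (Bits n) (Bits n) ℂ).mulVec (ket (zeroBits n)) = ψ := by
      funext b
      rw [mulVec_ket]
      exact hU b
    refine le_trans (one_sub_le_success hx0.le hx1 herr (r := (1 - x) ^ 5) le_rfl
      (pow_nonneg hδ0.le N) (pow_le_one₀ hδ0.le hδ1.le) hsum)
      (le_prob_alg ψ hU' hvalid hkmax (herr.trans hx1) (B := B) (T := T) ?_ hTT' hA1 hδ0 hδ1 hAS
        (pow_nonneg (by linarith) _) (pow_le_one₀ (by linarith) (by linarith)) ?_
        (fun t ht => hsmall.tryTime_le hAT hST hT1 ht hBV) (hsmall.time_le hT1 le_rfl)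
        (hsmall.queries_le hS hBV) le_rfl)
    · have h1 : V * S ≤ V * T := Nat.mul_le_mul_left _ hST
      have h2 : V * 2 ≤ V ^ 16 := by
        rw [pow_succ']
        exact Nat.mul_le_mul_left _ ((by omega : 2 ≤ V).trans (Nat.le_self_pow (by norm_num) V))
      have h3 : V * 2 * T ≤ V ^ 16 * T := Nat.mul_le_mul_right _ h2
      have h4 : 1 ≤ V * T := Nat.mul_pos (by omega) hT1
      have h5 : V * 2 * T = 2 * (V * T) := by ring
      omega
    · exact fun R t ht hres => le_tryProb R ψ ht.le hε hε1 hres hx0 hx1 herr hBge
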